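/- Let $\delta>0$ and let $M_t$, $t\in(-\delta,\delta)$, be a smooth family of compact connected Riemann surfaces (of some fixed genus), with a smooth family of holomorphic quadratic differentials $Q_t$ on $M_t$ that have only simple zeros. Let $\pi_t\colon\hat M_t\to M_t$ be the Hitchin covering of $(M_t,Q_t)$, i.e. the double covering, branched over the zeros of $Q_t$, whose points over $p\in M_t$ are the cotangent vectors $\eta\in T^*_pM_t$ with $\eta^2=Q_t(p)$; let $\sigma_t\colon\eta\mapsto-\eta$ be the holomorphic involution of $\hat M_t$ interchanging the sheets, and let $\omega_t=\sqrt{Q_t}$ be the tautological holomorphic $1$-form on $\hat M_t$, so that $\omega_t^2=\pi_t^*Q_t$. Identify the smooth surfaces underlying the $\hat M_t$, smoothly in $t$, with one smooth surface $\hat M$ in such a way that all $\sigma_t$ are the same smooth map $\sigma\colon\hat M\to\hat M$. Assume that the periods of $\omega_t$ are constant in $t$: for every closed curve $\gamma$ in $\hat M$ the number $\int_\gamma\omega_t$ does not depend on $t$. Then all the Riemann surfaces $M_t$ are biholomorphic and the $Q_t$ are equivalent: for all $s,t\in(-\delta,\delta)$ there is a biholomorphic map $\varphi\colon M_s\to M_t$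 with $\varphi^*Q_t=Q_s$. -/

import Mathlib

open Set
open scoped Manifold ContDiff Topology

noncomputable section

/-- The parameter interval `(-δ, δ)`, as an open subset (hence an open submanifold) of `ℝ`. -/
abbrev ParamInterval (δ : ℝ) : TopologicalSpace.Opens ℝ := ⟨Ioo (-δ) δ, isOpen_Ioo⟩

section Holomorphic

variable (X : Type*) [TopologicalSpace X] [ChartedSpace ℂ X]

/-- (Not necessarily holomorphic) differential forms of type `(1,0)` on a Riemann surface `X`:
sections of the canonical bundle `K`. -/
abbrev OneForm : Type _ := ∀ p : X, TangentSpace 𝓘(ℂ) p →L[ℂ] ℂ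

/-- (Not necessarily holomorphic) quadratic differentials on a Riemann surface `X`: sections of
`K ⊗ K`. As tangent spaces are complex lines, every complex bilinear form is symmetric. -/
abbrev QuadraticDifferential : Type _ :=
  ∀ p : X, TangentSpace 𝓘(ℂ) p →L[ℂ] TangentSpace 𝓘(ℂ) p →L[ℂ] ℂ

variable {X}

/-- The coefficient `h` in the expression `h(z) dz` of a one-form in a chart `e`. -/
def OneForm.coeff (θ : OneForm X) (e : OpenPartialHomeomorph X ℂ) (z : ℂ) : ℂ :=
  θ (e.symm z) (mfderiv 𝓘(ℂ) 𝓘(ℂ) e.symm z (1 : ℂ))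

/-- Holomorphic one-forms: the coefficient is holomorphic in every chart. -/
def OneForm.IsHolomorphic (θ : OneForm X) : Prop :=
  ∀ e ∈ atlas ℂ X, DifferentiableOn ℂ (OneForm.coeff θ e) e.target

/-- The coefficient `q` in the expression `q(z) dz²` of a quadratic differential in a chart. -/
def QuadraticDifferential.coeff (Q : QuadraticDifferential X) (e : OpenPartialHomeomorph X ℂ)
    (z : ℂ) : ℂ :=
  Q (e.symm z) (mfderiv 𝓘(ℂ) 𝓘(ℂ) e.symm z (1 : ℂ)) (mfderiv 𝓘(ℂ) 𝓘(ℂ) e.symm z (1 : ℂ))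

/-- Holomorphic quadratic differentials. -/
def QuadraticDifferential.IsHolomorphic (Q : QuadraticDifferential X) : Prop :=
  ∀ e ∈ atlas ℂ X, DifferentiableOn ℂ (QuadraticDifferential.coeff Q e) e.target

/-- All zeros of `Q` are simple: in a chart around a zero, the coefficient has non-zero derivative
there. -/
def QuadraticDifferential.HasOnlySimpleZeros (Q : QuadraticDifferential X) : Prop :=
  ∀ p : X, Q p = 0 → deriv (QuadraticDifferential.coeff Q (chartAt ℂ p)) (chartAt ℂ p p) ≠ 0

/-- The Hitchin covering of `(X, Q)`: a Riemann surface `Y` whose points are the square roots of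
`Q`, that is, the pairs `(p, η)` of a point `p` of `X` and a cotangent vector `η` at `p` with
`η² = Q p`; the projection to `X` is holomorphic, and the tautological one-form
`ω = √Q`, `ω x = η ∘ dπ`, is holomorphic on `Y`. The involution interchanging the sheets is
`(p, η) ↦ (p, -η)`. -/
structure HitchinCovering (Q : QuadraticDifferential X) (Y : Type*) [TopologicalSpace Y]
    [ChartedSpace ℂ Y] where
  /-- The covering map `π`. -/
  proj : Y → X
  /-- The square root `η` of `Q` at `π x` which is represented by the point `x`. -/
  root : ∀ x : Y, TangentSpace 𝓘(ℂ) (proj x) →L[ℂ] ℂ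
  /-- The involution `σ` interchanging the sheets. -/
  invol : Y → Y
  mdifferentiable_proj : MDifferentiable 𝓘(ℂ) 𝓘(ℂ) proj
  bijOn_roots :
    BijOn (fun x : Y => (⟨proj x, root x⟩ : Σ p : X, (TangentSpace 𝓘(ℂ) p →L[ℂ] ℂ))) univ
      {q | ∀ v : TangentSpace 𝓘(ℂ) q.1, q.2 v ^ 2 = Q q.1 v v}
  invol_eq : ∀ x : Y,
    (⟨proj (invol x), root (invol x)⟩ : Σ p : X, (TangentSpace 𝓘(ℂ) p →L[ℂ] ℂ))
      = ⟨proj x, -root x⟩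
  isHolomorphic_omega : OneForm.IsHolomorphic (X := Y)
    (fun x => (root x).comp (mfderiv 𝓘(ℂ) 𝓘(ℂ) proj x))

/-- The holomorphic one-form `ω = √Q` on the Hitchin covering. -/
def HitchinCovering.omega {Q : QuadraticDifferential X} {Y : Type*} [TopologicalSpace Y]
    [ChartedSpace ℂ Y] (H : HitchinCovering Q Y) : OneForm Y :=
  fun x => (H.root x).comp (mfderiv 𝓘(ℂ) 𝓘(ℂ) H.proj x)

end Holomorphic

section Families

/-- A smooth family of Riemann surfaces `X t`, `t ∈ (-δ, δ)`, all identified with one smooth surface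
`S`: the complex structures which the identifications induce on `S` depend smoothly on `t`, that is,
near every point of `(-δ, δ) × S` there is a smooth complex-valued function which
restricts to a holomorphic coordinate on each slice. Riemann surfaces are considered as real
surfaces through the model `𝓘(ℝ, ℂ)`. -/
structure SmoothFamily (δ : ℝ) (S : Type*) [TopologicalSpace S] [ChartedSpace ℂ S]
    (X : ParamInterval δ → Type*) [∀ t, TopologicalSpace (X t)] [∀ t, ChartedSpace ℂ (X t)] where
  /-- The identification of `S` with the real surface underlying `X t`. -/
  ident : ∀ t, S ≃ₘ^∞⟮𝓘(ℝ, ℂ), 𝓘(ℝ, ℂ)⟯ X t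
  exists_coordinate : ∀ (t₀ : ParamInterval δ) (p₀ : S),
    ∃ (W : Set (ParamInterval δ × S)) (z : ParamInterval δ × S → ℂ),
      IsOpen W ∧ (t₀, p₀) ∈ W ∧
      ContMDiffOn (𝓘(ℝ, ℝ).prod 𝓘(ℝ, ℂ)) 𝓘(ℝ, ℂ) ∞ z W ∧
      ∀ t, InjOn (fun x : X t => z (t, (ident t).symm x)) {x | (t, (ident t).symm x) ∈ W} ∧
        MDifferentiableOn 𝓘(ℂ) 𝓘(ℂ) (fun x : X t => z (t, (ident t).symm x))
          {x | (t, (ident t).symm x) ∈ W}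

variable {δ : ℝ} {S : Type*} [TopologicalSpace S] [ChartedSpace ℂ S]
  {X : ParamInterval δ → Type*} [∀ t, TopologicalSpace (X t)] [∀ t, ChartedSpace ℂ (X t)]

/-- The pull-back to `S` of a one-form on `X t`, a complex-valued form on the real surface `S`. The
tangent spaces of `X t` for the models `𝓘(ℝ, ℂ)` and `𝓘(ℂ)` are the same (namely `ℂ`, by means of
the preferred chart at the point). -/
def SmoothFamily.pullOneForm (F : SmoothFamily δ S X) (t : ParamInterval δ) (θ : OneForm (X t))
    (p : S) (v : TangentSpace 𝓘(ℝ, ℂ) p) : ℂ :=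
  θ (F.ident t p) (mfderiv 𝓘(ℝ, ℂ) 𝓘(ℝ, ℂ) (F.ident t) p v)

/-- The pull-back to `S` of a quadratic differential on `X t`. -/
def SmoothFamily.pullQuadratic (F : SmoothFamily δ S X) (t : ParamInterval δ)
    (Q : QuadraticDifferential (X t)) (p : S) (v w : TangentSpace 𝓘(ℝ, ℂ) p) : ℂ :=
  Q (F.ident t p) (mfderiv 𝓘(ℝ, ℂ) 𝓘(ℝ, ℂ) (F.ident t) p v)
    (mfderiv 𝓘(ℝ, ℂ) 𝓘(ℝ, ℂ) (F.ident t) p w)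

/-- The one-forms `θ t` on `X t` depend smoothly on `t`: in every chart of `S` the components of their
pull-backs to `S` are smooth functions on `(-δ, δ) × S`. -/
def SmoothFamily.SmoothOneForms (F : SmoothFamily δ S X) (θ : ∀ t, OneForm (X t)) : Prop :=
  ∀ e ∈ atlas ℂ S, ∀ v : ℂ,
    ContMDiffOn (𝓘(ℝ, ℝ).prod 𝓘(ℝ, ℂ)) 𝓘(ℝ, ℂ) ∞
      (fun x : ParamInterval δ × ℂ => F.pullOneForm x.1 (θ x.1) (e.symm x.2)
        (mfderiv 𝓘(ℝ, ℂ) 𝓘(ℝ, ℂ) e.symm x.2 v))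
      (univ ×ˢ e.target)

/-- The quadratic differentials `Q t` on `X t` depend smoothly on `t`. -/
def SmoothFamily.SmoothQuadratics (F : SmoothFamily δ S X)
    (Q : ∀ t, QuadraticDifferential (X t)) : Prop :=
  ∀ e ∈ atlas ℂ S, ∀ v w : ℂ,
    ContMDiffOn (𝓘(ℝ, ℝ).prod 𝓘(ℝ, ℂ)) 𝓘(ℝ, ℂ) ∞
      (fun x : ParamInterval δ × ℂ => F.pullQuadratic x.1 (Q x.1) (e.symm x.2)
        (mfderiv 𝓘(ℝ, ℂ) 𝓘(ℝ, ℂ) e.symm x.2 v) (mfderiv 𝓘(ℝ, ℂ) 𝓘(ℝ, ℂ) e.symm x.2 w))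
      (univ ×ˢ e.target)

/-- Piecewise `C¹` closed curves `γ : [0, 1] → S` (values outside `[0, 1]` are irrelevant). -/
def IsClosedCurve (γ : ℝ → S) : Prop :=
  γ 0 = γ 1 ∧ ContinuousOn γ (Icc 0 1) ∧
    ∃ B : Finset ℝ, ∀ a b : ℝ, 0 ≤ a → a < b → b ≤ 1 → (∀ s ∈ B, s ∉ Ioo a b) →
      ContMDiffOn 𝓘(ℝ, ℝ) 𝓘(ℝ, ℂ) 1 γ (Icc a b)

/-- The period `∫_γ θ` along a closed curve `γ` in `S` of a one-form `θ` on `X t`. -/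
def SmoothFamily.period (F : SmoothFamily δ S X) (t : ParamInterval δ) (θ : OneForm (X t))
    (γ : ℝ → S) : ℂ :=
  ∫ s in (0 : ℝ)..1, F.pullOneForm t θ (γ s) (mfderiv 𝓘(ℝ, ℝ) 𝓘(ℝ, ℂ) γ s (1 : ℝ))

end Families

end

/-! Fix a parameter `s` and compare a nearby `t` with it on the common surface of the coverings.
Since the periods agree, the closed form `ω_t - ω_s` has a global primitive `F t`. Because `σ`
changes the sign of every `ω_t`, antisymmetrization makes `F t` odd under `σ`, so it vanishes at the
fixed points of `σ`. These are the common zeros of all the `ω_t`, and each of them is a zero of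
order exactly two (`HitchinCovering.analyticOrderAt_coeff_omega`).

The form `ω_s` defines a flat metric, with cone points at its zeros. Move each point `q` along the
straight line with displacement `F t q`. The resulting map `χ` satisfies `G ∘ χ = G + F t` for local
primitives `G` of `ω_s`, that is, it pulls `ω_s` back to `ω_t`. It is therefore holomorphic from the
`t`-structure to the `s`-structure off the zeros.

The delicate point is the neighbourhood of a zero, where `ω_s = d(w ^ 3)`. As all the forms vanish
there to second order, `F t` varies by at most a small multiple of `max |w|² |w| ^ 2` times the
distance in `w`; hence `F t / w ^ 3` is small and `χ` is `w * (1 + F t / w ^ 3) ^ (1/3)`. The same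
estimate gives injectivity, and compactness makes everything uniform for `t` near `s`
(`SmallDeformation.eventually_exists_map`, applied to the data from
`HitchinCovering.exists_smallDeformation`).

As `χ` commutes with `σ`, it descends to an injective continuous map of the base surfaces. This map
is holomorphic off the zeros of the quadratic differential, hence everywhere, hence biholomorphic by
compactness and connectedness; it respects the quadratic differentials because `χ` respects their
square roots (`HitchinCovering.equivalent_of_map`). So equivalence holds locally in the parameter,
and the interval is connected. -/

noncomputable section

/-! ### Local behaviour of holomorphic functions of one variable. -/

section Planar

open Filter

/-- Write `f = (z - z₀) ^ n * g`. The quotient `g / g z₀` is `1` at `z₀`, so its principal `n`-th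
root is analytic there, and a root `c` of `g z₀` supplies the missing constant. -/
theorem exists_analyticAt_eq_pow_of_analyticOrderAt {f : ℂ → ℂ} {z₀ : ℂ} (hf : AnalyticAt ℂ f z₀)
    {n : ℕ} (hn : n ≠ 0) (h : analyticOrderAt f z₀ = n) :
    ∃ w : ℂ → ℂ, AnalyticAt ℂ w z₀ ∧ w z₀ = 0 ∧ deriv w z₀ ≠ 0 ∧ ∀ᶠ z in 𝓝 z₀, f z = w z ^ n := by
  obtain ⟨g, hg, hg0, hfg⟩ := (hf.analyticOrderAt_eq_natCast).1 h
  obtain ⟨c, hc⟩ : ∃ c : ℂ, c ^ n = g z₀ := IsAlgClosed.exists_pow_nat_eq _ (Nat.pos_of_ne_zero hn)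
  have hc0 : c ≠ 0 := by
    rintro rfl
    exact hg0 (by rw [← hc, zero_pow hn])
  set r : ℂ → ℂ := fun z => c * (g z / g z₀) ^ ((n : ℂ)⁻¹) with hr
  have hq : AnalyticAt ℂ (fun z => g z / g z₀) z₀ := hg.div analyticAt_const hg0
  have hra : AnalyticAt ℂ r z₀ := by
    refine analyticAt_const.mul (hq.cpow analyticAt_const ?_)
    simp [div_self hg0]
  have hr0 : r z₀ = c := by simp [hr, div_self hg0]
  have hrn : ∀ z, r z ^ n = g z := by
    intro z
    rw [hr, mul_pow, Complex.cpow_nat_inv_pow _ hn, hc]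
    field_simp
  refine ⟨fun z => (z - z₀) * r z, by fun_prop, by simp, ?_, ?_⟩
  · have : HasDerivAt (fun z => (z - z₀) * r z) (1 * r z₀ + (z₀ - z₀) * deriv r z₀) z₀ :=
      ((hasDerivAt_id z₀).sub_const z₀).mul hra.differentiableAt.hasDerivAt
    rw [this.deriv]
    simpa [hr0] using hc0
  · filter_upwards [hfg] with z hz
    rw [hz, mul_pow, hrn, smul_eq_mul]

/-- The inverse function theorem for holomorphic functions. -/
theorem exists_openPartialHomeomorph_of_deriv_ne_zero {w : ℂ → ℂ} {z₀ : ℂ}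
    (hw : AnalyticAt ℂ w z₀) (hd : deriv w z₀ ≠ 0) {U : Set ℂ} (hU : U ∈ 𝓝 z₀) :
    ∃ e : OpenPartialHomeomorph ℂ ℂ, ⇑e = w ∧ z₀ ∈ e.source ∧ e.source ⊆ U ∧
      (∀ z ∈ e.source, AnalyticAt ℂ w z ∧ deriv w z ≠ 0) ∧
      ∀ y ∈ e.target, AnalyticAt ℂ e.symm y := by
  obtain ⟨e₀, he₀, hz₀⟩ : ∃ e : OpenPartialHomeomorph ℂ ℂ, ⇑e = w ∧ z₀ ∈ e.source := by
    have := hw.hasStrictDerivAt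
    refine ⟨(this.hasStrictFDerivAt_equiv hd).toOpenPartialHomeomorph w, rfl,
      HasStrictFDerivAt.mem_toOpenPartialHomeomorph_source _⟩
  have hev : ∀ᶠ z in 𝓝 z₀, AnalyticAt ℂ w z ∧ deriv w z ≠ 0 :=
    hw.eventually_analyticAt.and (hw.deriv.continuousAt.eventually_ne hd)
  obtain ⟨V, hV, hVo, hzV⟩ := mem_nhds_iff.1 (Filter.inter_mem hev hU)
  refine ⟨e₀.restrOpen V hVo, by simpa using he₀, ⟨hz₀, hzV⟩, fun z hz => (hV hz.2).2,
    fun z hz => (hV hz.2).1, fun y hy => ?_⟩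
  set e := e₀.restrOpen V hVo
  have hy' := e.map_target hy
  have hew : ⇑e = w := by simpa [e] using he₀
  obtain ⟨h1, h2⟩ := (hV hy'.2).1
  have h3 := (e.hasFPowerSeriesAt_symm (i := .unitsEquivAut ℂ (.mk0 _ h2)) hy'
    (by rw [hew]; exact h1.hasFPowerSeriesAt) (by ext; simp)).analyticAt
  rwa [e.right_inv hy] at h3

/-- In a coordinate `w` with `f - f z₀ = w ^ n`, the points where `w` is `r / 2` times an `n`-th
root of unity all have the same value of `f`. -/
theorem exists_injective_fiber_of_analyticOrderAt {f : ℂ → ℂ} {z₀ : ℂ} (hf : AnalyticAt ℂ f z₀)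
    {n : ℕ} (hn : n ≠ 0) (h : analyticOrderAt (fun z => f z - f z₀) z₀ = n) {N : Set ℂ}
    (hN : N ∈ 𝓝 z₀) :
    ∃ p : Fin n → ℂ, Function.Injective p ∧ (∀ i, p i ∈ N) ∧ ∀ i j, f (p i) = f (p j) := by
  obtain ⟨w, hw, hw0, hwd, hfw⟩ := exists_analyticAt_eq_pow_of_analyticOrderAt
    (f := fun z => f z - f z₀) (by fun_prop) hn h
  obtain ⟨e, rfl, hz₀, hsub, -, hsymm⟩ :=
    exists_openPartialHomeomorph_of_deriv_ne_zero hw hwd (Filter.inter_mem hfw hN)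
  have ht : e.target ∈ 𝓝 (0 : ℂ) := e.open_target.mem_nhds (hw0 ▸ e.map_source hz₀)
  obtain ⟨r, hr, hrt⟩ := Metric.mem_nhds_iff.1 ht
  have hζ := Complex.isPrimitiveRoot_exp n hn
  set ζ := Complex.exp (2 * Real.pi * Complex.I / n)
  have hζ1 : ‖ζ‖ = 1 := hζ.norm'_eq_one hn
  set y : Fin n → ℂ := fun i => (r / 2 : ℝ) * ζ ^ (i : ℕ)
  have hr2 : ((r / 2 : ℝ) : ℂ) ≠ 0 := by exact_mod_cast (half_pos hr).ne'
  have hy : ∀ i, y i ∈ e.target := fun i => hrt (by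
    simp only [y, Metric.mem_ball, dist_zero_right, norm_mul, norm_pow, hζ1, one_pow, mul_one,
      Complex.norm_real, Real.norm_eq_abs]
    rw [abs_of_pos (half_pos hr)]
    exact half_lt_self hr)
  refine ⟨fun i => e.symm (y i), fun i j hij => ?_, fun i => (hsub (e.map_target (hy i))).2,
    fun i j => ?_⟩
  · have h1 := e.symm.injOn (hy i) (hy j) hij
    exact Fin.ext (hζ.pow_inj i.2 j.2 (mul_left_cancel₀ hr2 h1))
  · have key : ∀ i, f (e.symm (y i)) - f z₀ = ((r / 2 : ℝ) : ℂ) ^ n := fun i => by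
      have h2 := (hsub (e.map_target (hy i))).1
      simp only [mem_ofPred_eq] at h2
      rw [h2, e.right_inv (hy i), mul_pow, ← pow_mul, mul_comm (i : ℕ), pow_mul, hζ.pow_eq_one,
        one_pow, mul_one]
    exact sub_left_injective ((key i).trans (key j).symm)

theorem analyticOrderAt_ne_top_of_injOn {f : ℂ → ℂ} {z₀ : ℂ} {N : Set ℂ}
    (hN : N ∈ 𝓝 z₀) (hinj : InjOn f N) : analyticOrderAt (fun z => f z - f z₀) z₀ ≠ ⊤ := by
  intro h
  rw [analyticOrderAt_eq_top] at h
  have h1 : ∀ᶠ z in 𝓝 z₀, z = z₀ := by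
    filter_upwards [h, hN] with z hz hzN
    exact hinj hzN (mem_of_mem_nhds hN) (sub_eq_zero.1 hz)
  have h2 : ({z₀} : Set ℂ) ∈ 𝓝 z₀ := h1
  exact not_isOpen_singleton z₀ (isOpen_singleton_iff_nhds_eq_pure z₀ |>.2
    (le_antisymm (by simpa using h2) (pure_le_nhds z₀)))

/-- If the derivative vanished, `f - f z₀` would have finite order at least two, and two distinct
points of `N` would lie in one fibre. -/
theorem deriv_ne_zero_of_injOn {f : ℂ → ℂ} {z₀ : ℂ} (hf : AnalyticAt ℂ f z₀) {N : Set ℂ}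
    (hN : N ∈ 𝓝 z₀) (hinj : InjOn f N) : deriv f z₀ ≠ 0 := by
  intro hd
  have htop := analyticOrderAt_ne_top_of_injOn hN hinj
  obtain ⟨n, hn⟩ := ENat.ne_top_iff_exists.1 htop
  have h0 : n ≠ 0 := by
    rintro rfl
    have := (AnalyticAt.analyticOrderAt_eq_zero (f := fun z => f z - f z₀) (z₀ := z₀)
      (by fun_prop)).1 (by exact_mod_cast hn.symm)
    simp at this
  have h1 : n ≠ 1 := by
    rintro rfl
    obtain ⟨g, hg, hg0, hfg⟩ := (AnalyticAt.analyticOrderAt_eq_natCast (f := fun z => f z - f z₀)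
      (z₀ := z₀) (by fun_prop)).1 hn.symm
    have h2 : HasDerivAt (fun z => (z - z₀) * g z) (1 * g z₀ + (z₀ - z₀) * deriv g z₀) z₀ :=
      ((hasDerivAt_id z₀).sub_const z₀).mul hg.differentiableAt.hasDerivAt
    simp only [pow_one, smul_eq_mul] at hfg
    have h3 := (h2.congr_of_eventuallyEq hfg).add_const (f z₀)
    simp only [sub_add_cancel] at h3
    rw [h3.deriv] at hd
    simp at hd
    exact hg0 hd
  obtain ⟨p, hp, hpN, hpf⟩ := exists_injective_fiber_of_analyticOrderAt hf h0 hn.symm hN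
  have := hp (hinj (hpN ⟨0, by omega⟩) (hpN ⟨1, by omega⟩) (hpf _ _))
  simp at this

end Planar

/-! ### Straight lines of the flat metric of a closed form. -/

section Straight

open Filter

variable {S : Type*} [TopologicalSpace S]

/-- `P G p` is to be read as: `G` is a primitive near `p` of a given closed one-form, whose set of
zeros is `B`. -/
structure PrimitiveAtlas (P : (S → ℂ) → S → Prop) (B : Set S) : Prop where
  unique : ∀ {G G' : S → ℂ} {p : S}, P G p → P G' p → ∀ᶠ q in 𝓝 p, G q - G p = G' q - G' p
  exists_chart : ∀ p ∉ B, ∃ w : OpenPartialHomeomorph S ℂ, p ∈ w.source ∧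
    ∀ q ∈ w.source, q ∉ B ∧ P w q

variable {P : (S → ℂ) → S → Prop} {B : Set S}

theorem PrimitiveAtlas.injOn (hP : PrimitiveAtlas P B) {p : S} (hp : p ∉ B) {G : S → ℂ}
    (hG : P G p) : ∃ U ∈ 𝓝 p, InjOn G U := by
  obtain ⟨w, hpw, hw⟩ := hP.exists_chart p hp
  refine ⟨_, inter_mem (hP.unique hG (hw p hpw).2) (w.open_source.mem_nhds hpw), ?_⟩
  rintro a ⟨ha, haw⟩ b ⟨hb, hbw⟩ hab
  simp only [mem_ofPred_eq] at ha hb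
  rw [hab, hb] at ha
  exact w.injOn haw hbw (sub_left_injective ha.symm)

/-- Curves on the unit interval, on which primitives are affine functions of slope `v`: the straight
lines of a flat metric. -/
def IsStraight (P : (S → ℂ) → S → Prop) (B : Set S) (v : ℂ) (γ : ℝ → S) : Prop :=
  ContinuousOn γ (Icc 0 1) ∧ ∀ τ ∈ Icc (0 : ℝ) 1, γ τ ∉ B ∧ ∃ G, P G (γ τ) ∧
    ∀ᶠ τ' : ℝ in 𝓝[Icc 0 1] τ, G (γ τ') - G (γ τ) = (τ' - τ) * v

/-- Both curves have the same values under a primitive, and primitives are locally injective off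
`B`; so the closed set of coincidence can always be continued to the right. -/
theorem IsStraight.eq_one [T2Space S] (hP : PrimitiveAtlas P B) {v : ℂ} {γ₁ γ₂ : ℝ → S}
    (h₁ : IsStraight P B v γ₁) (h₂ : IsStraight P B v γ₂) (h : γ₁ 0 = γ₂ 0) : γ₁ 1 = γ₂ 1 := by
  have hcl : IsClosed ({τ | γ₁ τ = γ₂ τ} ∩ Icc (0 : ℝ) 1) := by
    rw [inter_comm]
    exact (h₁.1.prodMk h₂.1).preimage_isClosed_of_isClosed isClosed_Icc isClosed_diagonal
  refine hcl.Icc_subset_of_forall_mem_nhdsWithin h ?_ (right_mem_Icc.2 zero_le_one)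
  rintro τ ⟨hτ, hτI⟩
  have hτI' := Ico_subset_Icc_self hτI
  have hle : 𝓝[>] τ ≤ 𝓝[Icc 0 1] τ :=
    nhdsWithin_le_of_mem (Icc_mem_nhdsGT_of_mem hτI)
  obtain ⟨hB, G₁, hG₁, hG₁'⟩ := h₁.2 τ hτI'
  obtain ⟨-, G₂, hG₂, hG₂'⟩ := h₂.2 τ hτI'
  have hτ' : γ₁ τ = γ₂ τ := hτ
  obtain ⟨U, hU, hinj⟩ := hP.injOn hB hG₁
  have hc₁ : Tendsto γ₁ (𝓝[Icc 0 1] τ) (𝓝 (γ₁ τ)) := h₁.1 τ hτI'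
  have hc₂ : Tendsto γ₂ (𝓝[Icc 0 1] τ) (𝓝 (γ₁ τ)) := hτ' ▸ h₂.1 τ hτI'
  rw [← hτ'] at hG₂
  refine hle ?_
  filter_upwards [hG₁', hG₂', hc₁ hU, hc₂ hU, hc₂.eventually (hP.unique hG₁ hG₂)]
    with τ' e1 e2 u1 u2 e3
  refine hinj u1 u2 ?_
  rw [hτ', ← e2, ← hτ', ← e3] at e1
  exact sub_left_injective e1

open Classical in
/-- The end point of the straight line from `q` in the direction `v` (and `q`, if there is none). -/
def straightExp (P : (S → ℂ) → S → Prop) (B : Set S) (q : S) (v : ℂ) : S :=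
  if h : ∃ γ, IsStraight P B v γ ∧ γ 0 = q then h.choose 1 else q

theorem straightExp_eq [T2Space S] (hP : PrimitiveAtlas P B) {v : ℂ} {γ : ℝ → S}
    (h : IsStraight P B v γ) : straightExp P B (γ 0) v = γ 1 := by
  have hex : ∃ γ', IsStraight P B v γ' ∧ γ' 0 = γ 0 := ⟨γ, h, rfl⟩
  rw [straightExp, dif_pos hex]
  exact hex.choose_spec.1.eq_one hP h hex.choose_spec.2

theorem straightExp_of_mem {q : S} (hq : q ∈ B) (v : ℂ) : straightExp P B q v = q := by
  refine dif_neg ?_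
  rintro ⟨γ, hγ, rfl⟩
  exact (hγ.2 0 (left_mem_Icc.2 zero_le_one)).1 hq

/-- The involution changes the sign of the form, hence of the slope. -/
theorem IsStraight.comp_invol {σ : S → S} (hσ : Continuous σ) (hσσ : ∀ p, σ (σ p) = p)
    (hσB : ∀ p, σ p ∈ B ↔ p ∈ B) (hPσ : ∀ G p, P G p → P (fun q => -G (σ q)) (σ p))
    {v : ℂ} {γ : ℝ → S} (h : IsStraight P B v γ) : IsStraight P B (-v) (σ ∘ γ) := by
  refine ⟨hσ.comp_continuousOn h.1, fun τ hτ => ?_⟩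
  obtain ⟨hB, G, hG, hG'⟩ := h.2 τ hτ
  refine ⟨by simpa [hσB] using hB, _, hPσ G _ hG, ?_⟩
  filter_upwards [hG'] with τ' h'
  simp only [Function.comp, hσσ]
  linear_combination -h'

theorem straightExp_invol [T2Space S] (hP : PrimitiveAtlas P B) {σ : S → S} (hσ : Continuous σ)
    (hσσ : ∀ p, σ (σ p) = p) (hσB : ∀ p, σ p ∈ B ↔ p ∈ B)
    (hPσ : ∀ G p, P G p → P (fun q => -G (σ q)) (σ p)) (q : S) (v : ℂ) :
    straightExp P B (σ q) (-v) = σ (straightExp P B q v) := by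
  by_cases h : ∃ γ, IsStraight P B v γ ∧ γ 0 = q
  · obtain ⟨γ, hγ, rfl⟩ := h
    rw [straightExp_eq hP hγ]
    exact straightExp_eq hP (hγ.comp_invol hσ hσσ hσB hPσ)
  · have h' : ¬∃ γ, IsStraight P B (-v) γ ∧ γ 0 = σ q := by
      rintro ⟨γ, hγ, hγ0⟩
      refine h ⟨σ ∘ γ, ?_, by simp [hγ0, hσσ]⟩
      simpa using hγ.comp_invol hσ hσσ hσB hPσ
    rw [straightExp, straightExp, dif_neg h, dif_neg h']

/-- Where `w` itself is a primitive, straight lines are segments in the coordinate `w`. -/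
theorem straightExp_eq_chart [T2Space S] (hP : PrimitiveAtlas P B)
    {w : OpenPartialHomeomorph S ℂ} (hw : ∀ q ∈ w.source, q ∉ B ∧ P w q) {q : S}
    (hq : q ∈ w.source) {v : ℂ} (hv : ∀ τ ∈ Icc (0 : ℝ) 1, w q + τ * v ∈ w.target) :
    straightExp P B q v = w.symm (w q + v) := by
  have h : IsStraight P B v (fun τ => w.symm (w q + τ * v)) := by
    refine ⟨w.continuousOn_symm.comp (by fun_prop) hv, fun τ hτ => ?_⟩
    obtain ⟨h1, h2⟩ := hw _ (w.map_target (hv τ hτ))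
    refine ⟨h1, w, h2, ?_⟩
    filter_upwards [self_mem_nhdsWithin] with τ' hτ'
    rw [w.right_inv (hv τ hτ), w.right_inv (hv τ' hτ')]
    ring
  have := straightExp_eq hP h
  simpa [w.left_inv hq] using this

/-- The principal branch of the cube root of `1 + x`. -/
def cbrtOneAdd (x : ℂ) : ℂ := (1 + x) ^ ((3 : ℕ) : ℂ)⁻¹

theorem cbrtOneAdd_pow (x : ℂ) : cbrtOneAdd x ^ 3 = 1 + x :=
  Complex.cpow_nat_inv_pow _ three_ne_zero

theorem cbrtOneAdd_zero : cbrtOneAdd 0 = 1 := by simp [cbrtOneAdd]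

theorem continuousAt_cbrtOneAdd {x : ℂ} (hx : ‖x‖ < 1) : ContinuousAt cbrtOneAdd x :=
  (continuousAt_const.add continuousAt_id).cpow continuousAt_const
    (Complex.mem_slitPlane_of_norm_lt_one hx)

theorem norm_cbrtOneAdd_le {x : ℂ} (hx : ‖x‖ < 1) : ‖cbrtOneAdd x‖ < 2 := by
  by_contra! h
  have h1 : (2 : ℝ) ^ 3 ≤ ‖cbrtOneAdd x‖ ^ 3 := by gcongr
  rw [← norm_pow, cbrtOneAdd_pow] at h1
  have := norm_add_le (1 : ℂ) x
  rw [norm_one] at this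
  linarith

theorem cbrtOneAdd_ne_zero {x : ℂ} (hx : ‖x‖ < 1) : cbrtOneAdd x ≠ 0 := by
  intro h
  have h1 := cbrtOneAdd_pow x
  rw [h, zero_pow three_ne_zero] at h1
  have : x = -1 := by linear_combination -h1
  simp [this] at hx

/-- Where `w ^ 3` is a primitive, a straight line satisfies `w ^ 3 = w q ^ 3 + τ v`. The bound on
`v` keeps `1 + τ v / w q ^ 3` in the unit disc around `1`, so the principal root is continuous and
nonzero along the line; its modulus is below `2`, which explains the radius in `hball`. -/
theorem straightExp_eq_branchChart [T2Space S] (hP : PrimitiveAtlas P B) {b : S} (hb : b ∈ B)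
    {w : OpenPartialHomeomorph S ℂ} (hbw : b ∈ w.source) (hwb : w b = 0)
    (hw : ∀ q ∈ w.source, (q ∈ B → q = b) ∧ P (fun q => w q ^ 3) q) {q : S}
    (hq : q ∈ w.source) (hball : ∀ z, ‖z‖ ≤ 2 * ‖w q‖ → z ∈ w.target) {v : ℂ}
    (hv : ‖v / w q ^ 3‖ < 1) :
    straightExp P B q v = w.symm (w q * cbrtOneAdd (v / w q ^ 3)) := by
  by_cases hqb : q ∈ B
  -- At the zero itself `straightExp` takes its default value, and the right-hand side is `w.symm 0`
  -- whatever `v` is.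
  · rw [straightExp_of_mem hqb, (hw q hq).1 hqb, hwb, zero_mul, ← hwb, w.left_inv hbw]
  have hwq : w q ≠ 0 := fun h => hqb (by
    rw [← hwb] at h
    rwa [w.injOn hq hbw h])
  have hx : ∀ τ ∈ Icc (0 : ℝ) 1, ‖(τ : ℂ) * (v / w q ^ 3)‖ < 1 := fun τ hτ => by
    rw [norm_mul, Complex.norm_real, Real.norm_eq_abs, abs_of_nonneg hτ.1]
    nlinarith [hτ.2, norm_nonneg (v / w q ^ 3)]
  have htar : ∀ τ ∈ Icc (0 : ℝ) 1, w q * cbrtOneAdd (τ * (v / w q ^ 3)) ∈ w.target :=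
    fun τ hτ => hball _ (by
      rw [norm_mul, mul_comm]
      gcongr
      exact (norm_cbrtOneAdd_le (hx τ hτ)).le)
  have h : IsStraight P B v (fun τ => w.symm (w q * cbrtOneAdd (τ * (v / w q ^ 3)))) := by
    refine ⟨w.continuousOn_symm.comp (fun τ hτ => ContinuousAt.continuousWithinAt ?_) htar,
      fun τ hτ => ?_⟩
    · exact continuousAt_const.mul (ContinuousAt.comp (f := fun τ : ℝ => (τ : ℂ) * (v / w q ^ 3))
        (continuousAt_cbrtOneAdd (hx τ hτ)) (by fun_prop))
    · obtain ⟨h1, h2⟩ := hw _ (w.map_target (htar τ hτ))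
      refine ⟨fun hB => ?_, _, h2, ?_⟩
      · have h3 := h1 hB
        have h4 : w q * cbrtOneAdd (τ * (v / w q ^ 3)) = 0 := by
          rw [← w.right_inv (htar τ hτ), h3, hwb]
        exact mul_ne_zero hwq (cbrtOneAdd_ne_zero (hx τ hτ)) h4
      · filter_upwards [self_mem_nhdsWithin] with τ' hτ'
        rw [w.right_inv (htar τ hτ), w.right_inv (htar τ' hτ'), mul_pow, mul_pow, cbrtOneAdd_pow,
          cbrtOneAdd_pow]
        field_simp
        ring
  have := straightExp_eq hP h
  simpa [w.left_inv hq, cbrtOneAdd_zero] using this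

end Straight

/-! ### Realizing a small deformation of primitives by a map. -/

section Deformation

open Filter

variable {S : Type*} [TopologicalSpace S]

/-- A deformation `F t` of the primitives `P`, near the parameter `s` at which it vanishes: it is
small in comparison with the coordinates in which the primitives are `w`, or `w ^ 3` at points
of `B`. -/
structure SmallDeformation {T : Type*} [TopologicalSpace T] (P : (S → ℂ) → S → Prop) (B : Set S)
    (F : T → S → ℂ) (s : T) : Prop where
  atlas : PrimitiveAtlas P B
  continuous : ∀ t, Continuous (F t)
  tendsto_zero : ∀ p, Tendsto (fun z : T × S => F z.1 z.2) (𝓝 (s, p)) (𝓝 0)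
  eq_zero : ∀ t, ∀ b ∈ B, F t b = 0
  chart : ∀ p ∉ B, ∃ w : OpenPartialHomeomorph S ℂ, p ∈ w.source ∧
    (∀ q ∈ w.source, q ∉ B ∧ P w q) ∧
    ∀ᶠ z : T × (S × S) in 𝓝 (s, (p, p)),
      ‖F z.1 z.2.1 - F z.1 z.2.2‖ ≤ 1 / 2 * ‖w z.2.1 - w z.2.2‖
  branchChart : ∀ b ∈ B, ∃ w : OpenPartialHomeomorph S ℂ, b ∈ w.source ∧ w b = 0 ∧
    (∀ q ∈ w.source, (q ∈ B → q = b) ∧ P (fun q => w q ^ 3) q) ∧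
    ∀ ε > 0, ∀ᶠ z : T × (S × S) in 𝓝 (s, (b, b)),
      ‖F z.1 z.2.1 - F z.1 z.2.2‖ ≤
        ε * max ‖w z.2.1‖ ‖w z.2.2‖ ^ 2 * ‖w z.2.1 - w z.2.2‖

namespace SmallDeformation

variable [T2Space S] {T : Type*} [TopologicalSpace T] {P : (S → ℂ) → S → Prop} {B : Set S}
    {F : T → S → ℂ} {s : T}

theorem eventually_straightExp_eq (h : SmallDeformation P B F s)
    {w : OpenPartialHomeomorph S ℂ} (hw : ∀ q ∈ w.source, q ∉ B ∧ P w q) {p : S}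
    (hp : p ∈ w.source) :
    ∀ᶠ z : T × S in 𝓝 (s, p), z.2 ∈ w.source ∧ w z.2 + F z.1 z.2 ∈ w.target ∧
      straightExp P B z.2 (F z.1 z.2) = w.symm (w z.2 + F z.1 z.2) := by
  obtain ⟨r, hr, hrt⟩ := Metric.mem_nhds_iff.1 (w.open_target.mem_nhds (w.map_source hp))
  have hc : Tendsto (fun z : T × S => w z.2) (𝓝 (s, p)) (𝓝 (w p)) :=
    (w.continuousAt hp).comp_of_eq continuousAt_snd rfl
  have h1 : ∀ᶠ z : T × S in 𝓝 (s, p), w z.2 ∈ Metric.ball (w p) (r / 2) :=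
    hc (Metric.ball_mem_nhds _ (half_pos hr))
  have h2 : ∀ᶠ z : T × S in 𝓝 (s, p), F z.1 z.2 ∈ Metric.ball 0 (r / 2) :=
    (h.tendsto_zero p) (Metric.ball_mem_nhds _ (half_pos hr))
  have h3 : ∀ᶠ z : T × S in 𝓝 (s, p), z.2 ∈ w.source :=
    continuousAt_snd.eventually (w.open_source.mem_nhds hp)
  filter_upwards [h1, h2, h3] with z h1 h2 h3
  have hτ : ∀ τ ∈ Icc (0 : ℝ) 1, w z.2 + τ * F z.1 z.2 ∈ w.target := fun τ hτ => hrt (by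
    rw [Metric.mem_ball, dist_eq_norm] at *
    calc ‖w z.2 + τ * F z.1 z.2 - w p‖ = ‖(w z.2 - w p) + τ * F z.1 z.2‖ := by ring_nf
      _ ≤ ‖w z.2 - w p‖ + ‖(τ : ℂ) * F z.1 z.2‖ := norm_add_le _ _
      _ < r := by
        rw [norm_mul, Complex.norm_real, Real.norm_eq_abs, abs_of_nonneg hτ.1]
        rw [sub_zero] at h2
        nlinarith [hτ.1, hτ.2, norm_nonneg (F z.1 z.2)])
  exact ⟨h3, by simpa using hτ 1 (by simp), straightExp_eq_chart h.atlas hw h3 hτ⟩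

/-- Comparing a point with `b`, where `F` vanishes, turns the hypothesis into `‖F‖ ≤ ε ‖w‖ ^ 3`, so
the argument of the cube root is small. -/
theorem eventually_straightExp_eq_branch (h : SmallDeformation P B F s) {b : S} (hb : b ∈ B)
    {w : OpenPartialHomeomorph S ℂ} (hbw : b ∈ w.source) (hwb : w b = 0)
    (hw : ∀ q ∈ w.source, (q ∈ B → q = b) ∧ P (fun q => w q ^ 3) q)
    (hF : ∀ ε > 0, ∀ᶠ z : T × (S × S) in 𝓝 (s, (b, b)),
      ‖F z.1 z.2.1 - F z.1 z.2.2‖ ≤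
        ε * max ‖w z.2.1‖ ‖w z.2.2‖ ^ 2 * ‖w z.2.1 - w z.2.2‖) {η : ℝ} (hη : 0 < η) :
    ∀ᶠ z : T × S in 𝓝 (s, b), z.2 ∈ w.source ∧ ‖F z.1 z.2 / w z.2 ^ 3‖ < 1 ∧
      ‖cbrtOneAdd (F z.1 z.2 / w z.2 ^ 3) - 1‖ < η ∧
      (∀ z', ‖z'‖ ≤ 2 * ‖w z.2‖ → z' ∈ w.target) ∧
      straightExp P B z.2 (F z.1 z.2) =
        w.symm (w z.2 * cbrtOneAdd (F z.1 z.2 / w z.2 ^ 3)) := by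
  obtain ⟨δ, hδ, hδη⟩ : ∃ δ > 0, ∀ x : ℂ, ‖x‖ < δ → ‖cbrtOneAdd x - 1‖ < η := by
    obtain ⟨δ, hδ, h⟩ := Metric.continuousAt_iff.1 (continuousAt_cbrtOneAdd (x := 0) (by simp)) η hη
    exact ⟨δ, hδ, fun x hx => by
      simpa [dist_eq_norm, cbrtOneAdd_zero] using @h x (by simpa using hx)⟩
  -- One bound serves closeness of the root to `1`, the other keeps the argument inside the unit
  -- disc.
  set ε := min (δ / 2) (1 / 2)
  have hε : 0 < ε := by positivity
  obtain ⟨r, hr, hrt⟩ := Metric.mem_nhds_iff.1 (w.open_target.mem_nhds (w.map_source hbw))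
  have hc : Tendsto (fun z : T × S => w z.2) (𝓝 (s, b)) (𝓝 (w b)) :=
    (w.continuousAt hbw).comp_of_eq continuousAt_snd rfl
  have h1 : ∀ᶠ z : T × S in 𝓝 (s, b), w z.2 ∈ Metric.ball (w b) (r / 2) :=
    hc (Metric.ball_mem_nhds _ (half_pos hr))
  have h3 : ∀ᶠ z : T × S in 𝓝 (s, b), z.2 ∈ w.source :=
    continuousAt_snd.eventually (w.open_source.mem_nhds hbw)
  have h2 : ∀ᶠ z : T × S in 𝓝 (s, b), ‖F z.1 z.2 - F z.1 b‖ ≤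
      ε * max ‖w z.2‖ ‖w b‖ ^ 2 * ‖w z.2 - w b‖ := by
    have hcb : ContinuousAt (fun z : T × S => (z.1, (z.2, b))) (s, b) := by fun_prop
    exact hcb.eventually (hF ε hε)
  filter_upwards [h1, h2, h3] with z h1 h2 h3
  rw [h.eq_zero _ b hb, hwb] at h2
  simp only [sub_zero, norm_zero, norm_nonneg, max_eq_left] at h2
  have h4 : ‖F z.1 z.2 / w z.2 ^ 3‖ ≤ ε := by
    rw [norm_div, norm_pow]
    refine div_le_of_le_mul₀ (by positivity) hε.le ?_
    linarith
  have hball : ∀ z', ‖z'‖ ≤ 2 * ‖w z.2‖ → z' ∈ w.target := fun z' hz' => hrt (by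
    rw [hwb, mem_ball_zero_iff] at *
    linarith)
  have h5 : ‖F z.1 z.2 / w z.2 ^ 3‖ < 1 :=
    h4.trans_lt (lt_of_le_of_lt (min_le_right _ _) (by norm_num))
  exact ⟨h3, h5, hδη _ (h4.trans_lt (lt_of_le_of_lt (min_le_left _ _) (by linarith))), hball,
    straightExp_eq_branchChart h.atlas hb hbw hwb hw h3 hball h5⟩

theorem tendsto_straightExp (h : SmallDeformation P B F s) (p : S) :
    Tendsto (fun z : T × S => straightExp P B z.2 (F z.1 z.2)) (𝓝 (s, p)) (𝓝 p) := by
  by_cases hp : p ∈ B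
  · obtain ⟨w, hpw, hwp, hw, hF⟩ := h.branchChart p hp
    have hev := h.eventually_straightExp_eq_branch hp hpw hwp hw hF one_pos
    have hc : Tendsto (fun z : T × S => ‖w z.2‖) (𝓝 (s, p)) (𝓝 ‖w p‖) :=
      ((w.continuousAt hpw).comp_of_eq continuousAt_snd rfl).norm
    have h1 : Tendsto (fun z : T × S => w z.2 * cbrtOneAdd (F z.1 z.2 / w z.2 ^ 3)) (𝓝 (s, p))
        (𝓝 (w p)) := by
      rw [hwp] at hc ⊢
      refine squeeze_zero_norm' (a := fun z => 2 * ‖w z.2‖) ?_ (by simpa using hc.const_mul 2)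
      filter_upwards [hev] with z hz
      rw [norm_mul, mul_comm]
      gcongr
      exact (norm_cbrtOneAdd_le hz.2.1).le
    have h2 := ((w.continuousAt_symm (w.map_source hpw)).tendsto).comp h1
    rw [w.left_inv hpw] at h2
    exact h2.congr' (hev.mono fun z hz => hz.2.2.2.2.symm)
  · obtain ⟨w, hpw, hw, -⟩ := h.chart p hp
    have hev := h.eventually_straightExp_eq hw hpw
    have h1 : Tendsto (fun z : T × S => w z.2 + F z.1 z.2) (𝓝 (s, p)) (𝓝 (w p + 0)) :=
      ((w.continuousAt hpw).comp_of_eq continuousAt_snd rfl).tendsto.add (h.tendsto_zero p)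
    rw [add_zero] at h1
    have h2 := ((w.continuousAt_symm (w.map_source hpw)).tendsto).comp h1
    rw [w.left_inv hpw] at h2
    exact h2.congr' (hev.mono fun z hz => hz.2.2.symm)

/-- Off `B` the map is `w + F` with `F` of Lipschitz constant `1 / 2`. At a point of `B`, equal
images give equal values of `w ^ 3 + F`, with the two coordinates nearly equal up to a factor close
to `1`; the difference of the cubes then dominates that of `F`. Distinct limit points are separated
by continuity. -/
theorem eventually_injective (h : SmallDeformation P B F s) (p p' : S) :
    ∀ᶠ z : T × (S × S) in 𝓝 (s, (p, p')),
      straightExp P B z.2.1 (F z.1 z.2.1) = straightExp P B z.2.2 (F z.1 z.2.2) →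
        z.2.1 = z.2.2 := by
  have hc1 : ContinuousAt (fun z : T × (S × S) => (z.1, z.2.1)) (s, (p, p')) := by fun_prop
  have hc2 : ContinuousAt (fun z : T × (S × S) => (z.1, z.2.2)) (s, (p, p')) := by fun_prop
  rcases ne_or_eq p p' with hne | rfl
  · obtain ⟨U, V, hU, hV, hpU, hpV, hd⟩ := t2_separation hne
    filter_upwards [hc1.eventually (h.tendsto_straightExp p (hU.mem_nhds hpU)),
      hc2.eventually (h.tendsto_straightExp p' (hV.mem_nhds hpV))] with z h1 h2 h3
    rw [h3] at h1
    exact absurd h2 (disjoint_left.1 hd h1)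
  by_cases hp : p ∈ B
  · obtain ⟨w, hpw, hwp, hw, hF⟩ := h.branchChart p hp
    -- With both roots within `1 / 10` of `1`, their quotient `k` is within `2 / 9 ≤ 1 / 4` of `1`.
    have hev := h.eventually_straightExp_eq_branch hp hpw hwp hw hF
      (show (0 : ℝ) < 1 / 10 by norm_num)
    filter_upwards [hc1.eventually hev, hc2.eventually hev, hF (1 / 2) (by norm_num)]
      with z ⟨a1, a2, a3, a4, a5⟩ ⟨b1, b2, b3, b4, b5⟩ hz heq
    rw [a5, b5] at heq
    have htar : ∀ q : S, ‖F z.1 q / w q ^ 3‖ < 1 → (∀ z', ‖z'‖ ≤ 2 * ‖w q‖ → z' ∈ w.target) →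
        w q * cbrtOneAdd (F z.1 q / w q ^ 3) ∈ w.target := fun q h1 h2 => h2 _ (by
      rw [norm_mul, mul_comm]
      gcongr
      exact (norm_cbrtOneAdd_le h1).le)
    have heq' := w.symm.injOn (htar _ a2 a4) (htar _ b2 b4) heq
    refine w.injOn a1 b1 ?_
    -- Cubing removes the choice of root. If `w q = 0`, then `q = p` and `F` vanishes there, so
    -- division by zero does no harm.
    have hcub : ∀ q ∈ w.source, (w q * cbrtOneAdd (F z.1 q / w q ^ 3)) ^ 3 = w q ^ 3 + F z.1 q := by
      intro q hq
      rw [mul_pow, cbrtOneAdd_pow]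
      by_cases h0 : w q = 0
      · have : q = p := w.injOn hq hpw (h0.trans hwp.symm)
        rw [this, h.eq_zero _ p hp, hwp]
        simp
      · field_simp
    have hsum : w z.2.1 ^ 3 + F z.1 z.2.1 = w z.2.2 ^ 3 + F z.1 z.2.2 := by
      rw [← hcub _ a1, ← hcub _ b1, heq']
    set a := w z.2.1
    set a' := w z.2.2
    set c := cbrtOneAdd (F z.1 z.2.1 / a ^ 3)
    set c' := cbrtOneAdd (F z.1 z.2.2 / a' ^ 3)
    by_contra hne
    have hc' : 9 / 10 ≤ ‖c'‖ := by
      have := norm_sub_norm_le (1 : ℂ) (1 - c')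
      rw [norm_sub_rev 1 c', norm_one, sub_sub_cancel] at this
      linarith
    have hc'0 : c' ≠ 0 := by
      intro h0
      rw [h0, norm_zero] at hc'
      norm_num at hc'
    obtain ⟨k, hk⟩ : ∃ k, k = c / c' := ⟨_, rfl⟩
    have hk1 : ‖k - 1‖ ≤ 1 / 4 := by
      have : k - 1 = ((c - 1) - (c' - 1)) / c' := by rw [hk]; field_simp; ring
      rw [this, norm_div, div_le_iff₀ (by linarith)]
      have := norm_sub_le (c - 1) (c' - 1)
      linarith
    have ha' : a' = a * k := by rw [hk]; field_simp; exact heq'.symm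
    have hkn : ‖k‖ ≤ 5 / 4 := by
      have := norm_add_le (k - 1) 1
      rw [sub_add_cancel, norm_one] at this
      linarith
    have ha0 : a ≠ 0 := by
      intro h0
      rw [h0, zero_mul] at ha'
      exact hne (h0.trans ha'.symm)
    -- This is the factor in `a' ^ 3 - a ^ 3 = (a' - a) * a ^ 2 * (1 + k + k ^ 2)`. Its lower bound
    -- `2` exceeds `(1 / 2) * (5 / 4) ^ 2`, the constant in the estimate of the difference of `F`.
    have hlow : 2 ≤ ‖1 + k + k ^ 2‖ := by
      have e : 1 + k + k ^ 2 = 3 - (-(k - 1) * (k + 2)) := by ring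
      have h1 := norm_sub_norm_le (3 : ℂ) (-(k - 1) * (k + 2))
      rw [← e, norm_mul, norm_neg] at h1
      have h2 := norm_add_le k 2
      simp only [Complex.norm_ofNat] at h1 h2
      nlinarith [norm_nonneg (k - 1), norm_nonneg (k + 2)]
    have hmax : max ‖a‖ ‖a'‖ ≤ 5 / 4 * ‖a‖ := by
      rw [ha', norm_mul]
      refine max_le ?_ ?_ <;> nlinarith [norm_nonneg a]
    have hdiff : F z.1 z.2.1 - F z.1 z.2.2 = (a' - a) * (a ^ 2 * (1 + k + k ^ 2)) := by
      have : F z.1 z.2.1 - F z.1 z.2.2 = a' ^ 3 - a ^ 3 := by linear_combination hsum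
      rw [this, ha']
      ring
    rw [hdiff, norm_mul, norm_sub_rev, mul_comm] at hz
    have h6 := le_of_mul_le_mul_right hz (norm_pos_iff.2 (sub_ne_zero.2 hne))
    rw [norm_mul, norm_pow] at h6
    have h7 : max ‖a‖ ‖a'‖ ^ 2 ≤ (5 / 4 * ‖a‖) ^ 2 := by gcongr
    have h8 : 0 < ‖a‖ ^ 2 := by positivity
    nlinarith
  · obtain ⟨w, hpw, hw, hF⟩ := h.chart p hp
    have hev := h.eventually_straightExp_eq hw hpw
    filter_upwards [hc1.eventually hev, hc2.eventually hev, hF]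
      with z ⟨a1, a2, a3⟩ ⟨b1, b2, b3⟩ hz heq
    rw [a3, b3] at heq
    have := w.symm.injOn a2 b2 heq
    refine w.injOn a1 b1 ?_
    have e : F z.1 z.2.1 - F z.1 z.2.2 = -(w z.2.1 - w z.2.2) := by linear_combination this
    rw [e, norm_neg] at hz
    have := norm_nonneg (w z.2.1 - w z.2.2)
    exact sub_eq_zero.1 (norm_eq_zero.1 (by linarith))

/-- One function, `w` or `w ^ 3`, is a primitive at the point and at its image, because both lie in
the source of one coordinate. In it the displacement formula is read off directly. -/
theorem eventually_local (h : SmallDeformation P B F s) (p : S) :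
    ∀ᶠ z : T × S in 𝓝 (s, p),
      ContinuousAt (fun q => straightExp P B q (F z.1 q)) z.2 ∧
      (z.2 ∉ B → straightExp P B z.2 (F z.1 z.2) ∉ B ∧
        ∃ G, P G z.2 ∧ P G (straightExp P B z.2 (F z.1 z.2)) ∧
          ∀ᶠ q in 𝓝 z.2, G (straightExp P B q (F z.1 q)) = G q + F z.1 q) := by
  have hct : ∀ z : T × S, ContinuousAt (fun q => (z.1, q)) z.2 := fun z => by fun_prop
  by_cases hp : p ∈ B
  · obtain ⟨w, hpw, hwp, hw, hF⟩ := h.branchChart p hp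
    have hev := h.eventually_straightExp_eq_branch hp hpw hwp hw hF one_pos
    filter_upwards [hev.eventually_nhds] with z hz
    obtain ⟨a1, a2, -, a4, a5⟩ := hz.self_of_nhds
    have hz' := (hct z).eventually hz
    have htar : ∀ q : S, ‖F z.1 q / w q ^ 3‖ < 1 → (∀ z', ‖z'‖ ≤ 2 * ‖w q‖ → z' ∈ w.target) →
        w q * cbrtOneAdd (F z.1 q / w q ^ 3) ∈ w.target := fun q h1 h2 => h2 _ (by
      rw [norm_mul, mul_comm]
      gcongr
      exact (norm_cbrtOneAdd_le h1).le)
    have hcw : ContinuousAt w z.2 := w.continuousAt a1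
    have hB0 : ∀ q ∈ w.source, w q = 0 → q ∈ B := fun q hq h0 => by
      rwa [w.injOn hq hpw (h0.trans hwp.symm)]
    refine ⟨?_, fun hzB => ?_⟩
    · have hc : ContinuousAt (fun q => w q * cbrtOneAdd (F z.1 q / w q ^ 3)) z.2 := by
        by_cases h0 : w z.2 = 0
        · rw [ContinuousAt, h0, zero_mul]
          refine squeeze_zero_norm' (a := fun q => 2 * ‖w q‖) ?_ ?_
          · filter_upwards [hz'] with q hq
            rw [norm_mul, mul_comm]
            gcongr
            exact (norm_cbrtOneAdd_le hq.2.1).le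
          · simpa [h0] using (hcw.norm.tendsto.const_mul 2)
        · refine hcw.mul (ContinuousAt.comp (g := cbrtOneAdd) (continuousAt_cbrtOneAdd a2) ?_)
          exact ((h.continuous z.1).continuousAt).div (hcw.pow 3) (pow_ne_zero 3 h0)
      have hc2 : ContinuousAt
          (fun q => w.symm (w q * cbrtOneAdd (F z.1 q / w q ^ 3))) z.2 :=
        ContinuousAt.comp (g := w.symm) (w.continuousAt_symm (htar _ a2 a4)) hc
      exact hc2.congr (hz'.mono fun q hq => hq.2.2.2.2.symm)
    · have hwz : w z.2 ≠ 0 := fun h0 => hzB (hB0 _ a1 h0)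
      have hsrc : straightExp P B z.2 (F z.1 z.2) ∈ w.source := by
        rw [a5]
        exact w.map_target (htar _ a2 a4)
      have hval : ∀ q ∈ w.source, ‖F z.1 q / w q ^ 3‖ < 1 →
          (∀ z', ‖z'‖ ≤ 2 * ‖w q‖ → z' ∈ w.target) →
          straightExp P B q (F z.1 q) = w.symm (w q * cbrtOneAdd (F z.1 q / w q ^ 3)) →
          w (straightExp P B q (F z.1 q)) = w q * cbrtOneAdd (F z.1 q / w q ^ 3) :=
        fun q _ h2 h3 h4 => by rw [h4, w.right_inv (htar _ h2 h3)]
      refine ⟨fun hB => ?_, fun q => w q ^ 3, (hw _ a1).2, (hw _ hsrc).2, ?_⟩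
      · have h1 := (hw _ hsrc).1 hB
        have h2 := hval _ a1 a2 a4 a5
        rw [h1, hwp] at h2
        exact mul_ne_zero hwz (cbrtOneAdd_ne_zero a2) h2.symm
      · filter_upwards [hz', hcw.eventually_ne hwz] with q ⟨b1, b2, _, b4, b5⟩ hq0
        rw [hval _ b1 b2 b4 b5, mul_pow, cbrtOneAdd_pow]
        field_simp
  · obtain ⟨w, hpw, hw, hF⟩ := h.chart p hp
    have hev := h.eventually_straightExp_eq hw hpw
    filter_upwards [hev.eventually_nhds] with z hz
    obtain ⟨a1, a2, a3⟩ := hz.self_of_nhds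
    have hz' := (hct z).eventually hz
    have hsrc : straightExp P B z.2 (F z.1 z.2) ∈ w.source := by
      rw [a3]
      exact w.map_target a2
    refine ⟨?_, fun _ => ⟨(hw _ hsrc).1, w, (hw _ a1).2, (hw _ hsrc).2, ?_⟩⟩
    · have hc2 : ContinuousAt (fun q => w.symm (w q + F z.1 q)) z.2 :=
        ContinuousAt.comp (g := w.symm) (w.continuousAt_symm a2)
          ((w.continuousAt a1).add (h.continuous z.1).continuousAt)
      exact hc2.congr (hz'.mono fun q hq => hq.2.2.symm)
    · filter_upwards [hz'] with q ⟨b1, b2, b3⟩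
      rw [b3, w.right_inv b2]

/-- A small deformation of the primitives is realized by a self-map of the (compact) space. -/
theorem eventually_exists_map [CompactSpace S] (h : SmallDeformation P B F s) {σ : S → S}
    (hσ : Continuous σ) (hσσ : ∀ p, σ (σ p) = p) (hσB : ∀ p, σ p ∈ B ↔ p ∈ B)
    (hPσ : ∀ G p, P G p → P (fun q => -G (σ q)) (σ p)) (hF : ∀ t p, F t (σ p) = -F t p) :
    ∀ᶠ t in 𝓝 s, ∃ χ : S → S, Continuous χ ∧ Function.Injective χ ∧ (∀ p, χ (σ p) = σ (χ p)) ∧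
      (∀ p ∈ B, χ p = p) ∧
      ∀ p ∉ B, χ p ∉ B ∧ ∃ G, P G p ∧ P G (χ p) ∧ ∀ᶠ q in 𝓝 p, G (χ q) = G q + F t q := by
  -- Compactness of `S`, and of `S × S` for injectivity, turns statements near each `(s, p)` into
  -- statements for all points and all `t` near `s`.
  have h1 := isCompact_univ.eventually_forall_of_forall_eventually
    (P := fun (t : T) (q : S) => ContinuousAt (fun q => straightExp P B q (F t q)) q ∧
      (q ∉ B → straightExp P B q (F t q) ∉ B ∧
        ∃ G, P G q ∧ P G (straightExp P B q (F t q)) ∧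
          ∀ᶠ q' in 𝓝 q, G (straightExp P B q' (F t q')) = G q' + F t q'))
    (x₀ := s) fun p (_ : p ∈ univ) => h.eventually_local p
  have h2 := isCompact_univ.eventually_forall_of_forall_eventually
    (P := fun (t : T) (q : S × S) =>
      straightExp P B q.1 (F t q.1) = straightExp P B q.2 (F t q.2) → q.1 = q.2)
    (x₀ := s) fun p (_ : p ∈ univ) => h.eventually_injective p.1 p.2
  filter_upwards [h1, h2] with t h1 h2
  refine ⟨fun q => straightExp P B q (F t q),
    continuous_iff_continuousAt.2 fun q => (h1 q trivial).1,
    fun q q' hqq' => h2 (q, q') trivial hqq', fun p => ?_, fun p hp => straightExp_of_mem hp _,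
    fun p hp => (h1 p trivial).2 hp⟩
  simp only [hF]
  exact straightExp_invol h.atlas hσ hσσ hσB hPσ p _

end SmallDeformation

end Deformation

/-! ### Complex derivatives of maps of Riemann surfaces. -/

section ComplexDerivative

variable {X Y Z : Type*} [TopologicalSpace X] [ChartedSpace ℂ X] [TopologicalSpace Y]
  [ChartedSpace ℂ Y] [TopologicalSpace Z] [ChartedSpace ℂ Z]

theorem HasMFDerivAt.restrictScalarsReal {f : X → Y} {x : X} {f' : ℂ →L[ℂ] ℂ}
    (h : HasMFDerivAt 𝓘(ℂ) 𝓘(ℂ) f x f') :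
    HasMFDerivAt 𝓘(ℝ, ℂ) 𝓘(ℝ, ℂ) f x (f'.restrictScalars ℝ) :=
  ⟨h.1, HasFDerivWithinAt.restrictScalars ℝ (E := ℂ) (F := ℂ) h.2⟩

theorem HasMFDerivAt.of_restrictScalarsReal {f : X → Y} {x : X} {f' : ℂ →L[ℂ] ℂ}
    (h : HasMFDerivAt 𝓘(ℝ, ℂ) 𝓘(ℝ, ℂ) f x (f'.restrictScalars ℝ)) :
    HasMFDerivAt 𝓘(ℂ) 𝓘(ℂ) f x f' :=
  ⟨h.1, HasFDerivWithinAt.of_restrictScalars ℝ (E := ℂ) (F := ℂ) h.2 rfl⟩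

/-- The derivative of a map between Riemann surfaces, as a complex number, by means of the preferred
charts. -/
def cderiv (f : X → Y) (x : X) : ℂ := mfderiv 𝓘(ℂ) 𝓘(ℂ) f x (1 : ℂ)

/-- Multiplication by a complex number, as a real linear map. -/
def realMul (c : ℂ) : ℂ →L[ℝ] ℂ := (c • ContinuousLinearMap.id ℂ ℂ).restrictScalars ℝ

@[simp]
theorem realMul_apply (c v : ℂ) : realMul c v = c * v := rfl

theorem mfderiv_eq_mul_cderiv (f : X → Y) (x : X) (v : ℂ) :
    mfderiv 𝓘(ℂ) 𝓘(ℂ) f x v = v * cderiv f x := by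
  have : v = v • (1 : ℂ) := by simp
  conv_lhs => rw [this]
  exact (mfderiv 𝓘(ℂ) 𝓘(ℂ) f x).map_smul v (1 : ℂ)

theorem OneForm.apply_eq_mul (θ : OneForm X) (x : X) (v : ℂ) : θ x v = v * θ x (1 : ℂ) := by
  have : v = v • (1 : ℂ) := by simp
  conv_lhs => rw [this]
  exact (θ x).map_smul v (1 : ℂ)

theorem QuadraticDifferential.apply_eq_mul (Q : QuadraticDifferential X) (x : X) (v w : ℂ) :
    Q x v w = v * w * Q x (1 : ℂ) (1 : ℂ) := by
  have hv : v = v • (1 : ℂ) := by simp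
  have hw : w = w • (1 : ℂ) := by simp
  conv_lhs => rw [hv, hw]
  have h1 : Q x (v • (1 : ℂ)) = v • Q x (1 : ℂ) := (Q x).map_smul v (1 : ℂ)
  rw [h1]
  have h2 : (Q x (1 : ℂ)) (w • (1 : ℂ)) = w • Q x (1 : ℂ) (1 : ℂ) := (Q x (1 : ℂ)).map_smul w (1 : ℂ)
  change v • (Q x (1 : ℂ)) (w • (1 : ℂ)) = _
  rw [h2, smul_eq_mul, smul_eq_mul, mul_assoc]

theorem MDifferentiableAt.hasMFDerivAt_cderiv {f : X → Y} {x : X}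
    (h : MDifferentiableAt 𝓘(ℂ) 𝓘(ℂ) f x) :
    HasMFDerivAt 𝓘(ℂ) 𝓘(ℂ) f x (cderiv f x • ContinuousLinearMap.id ℂ ℂ) := by
  refine h.hasMFDerivAt.congr_mfderiv (ContinuousLinearMap.ext fun v => ?_)
  exact (mfderiv_eq_mul_cderiv f x v).trans (mul_comm (G := ℂ) v (cderiv f x))

theorem HasMFDerivAt.cderiv_eq {f : X → Y} {x : X} {c : ℂ}
    (h : HasMFDerivAt 𝓘(ℂ) 𝓘(ℂ) f x (c • ContinuousLinearMap.id ℂ ℂ)) : cderiv f x = c := by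
  rw [cderiv, h.mfderiv]
  exact mul_one c

theorem cderiv_comp {g : Y → Z} {f : X → Y} {x : X} (hg : MDifferentiableAt 𝓘(ℂ) 𝓘(ℂ) g (f x))
    (hf : MDifferentiableAt 𝓘(ℂ) 𝓘(ℂ) f x) : cderiv (g ∘ f) x = cderiv g (f x) * cderiv f x := by
  rw [cderiv, mfderiv_comp x hg hf, mul_comm]
  exact mfderiv_eq_mul_cderiv g (f x) _

theorem cderiv_eq_deriv (f : ℂ → ℂ) (x : ℂ) : cderiv f x = deriv f x := by
  rw [cderiv, mfderiv_eq_fderiv]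
  exact fderiv_apply_one_eq_deriv (𝕜 := ℂ)

theorem cderiv_id (x : X) : cderiv (id : X → X) x = 1 := by
  rw [cderiv, mfderiv_id]
  rfl

theorem Filter.EventuallyEq.cderiv_eq {f g : X → Y} {x : X} (h : f =ᶠ[𝓝 x] g) :
    cderiv f x = cderiv g x := by
  rw [cderiv, cderiv, h.mfderiv_eq]
  rfl

theorem OneForm.coeff_eq (θ : OneForm X) (e : OpenPartialHomeomorph X ℂ) (z : ℂ) :
    θ.coeff e z = cderiv e.symm z * θ (e.symm z) (1 : ℂ) :=
  θ.apply_eq_mul _ _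

theorem QuadraticDifferential.coeff_eq (Q : QuadraticDifferential X)
    (e : OpenPartialHomeomorph X ℂ) (z : ℂ) :
    Q.coeff e z = cderiv e.symm z ^ 2 * Q (e.symm z) (1 : ℂ) (1 : ℂ) := by
  rw [sq]
  exact Q.apply_eq_mul _ _ _

theorem QuadraticDifferential.eq_zero_iff (Q : QuadraticDifferential X) (x : X) :
    Q x = 0 ↔ Q x (1 : ℂ) (1 : ℂ) = 0 := by
  refine ⟨fun h => by rw [h]; rfl, fun h => ?_⟩
  ext
  exact h

section Charts

variable [IsManifold 𝓘(ℂ) 1 X] {e : OpenPartialHomeomorph X ℂ}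

theorem cderiv_symm_mul_cderiv (he : e ∈ atlas ℂ X) {x : X} (hx : x ∈ e.source) :
    cderiv e.symm (e x) * cderiv e x = 1 := by
  rw [← cderiv_comp (mdifferentiableAt_atlas_symm he (e.map_source hx))
    (mdifferentiableAt_atlas he hx)]
  have : (e.symm ∘ e) =ᶠ[𝓝 x] id := by
    filter_upwards [e.open_source.mem_nhds hx] with y hy
    exact e.left_inv hy
  rw [this.cderiv_eq, cderiv_id]

theorem cderiv_symm_ne_zero (he : e ∈ atlas ℂ X) {z : ℂ} (hz : z ∈ e.target) :
    cderiv e.symm z ≠ 0 := by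
  have := cderiv_symm_mul_cderiv he (e.map_target hz)
  rw [e.right_inv hz] at this
  exact left_ne_zero_of_mul_eq_one this

theorem cderiv_chart_ne_zero (he : e ∈ atlas ℂ X) {x : X} (hx : x ∈ e.source) :
    cderiv e x ≠ 0 := right_ne_zero_of_mul_eq_one (cderiv_symm_mul_cderiv he hx)

variable [IsManifold 𝓘(ℂ) 1 Y]

theorem mdifferentiableAt_iff_chart {f : X → Y} {x : X} (he : e ∈ atlas ℂ X) (hx : x ∈ e.source)
    {e' : OpenPartialHomeomorph Y ℂ} (he' : e' ∈ atlas ℂ Y) (hc : ContinuousAt f x)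
    (hy : f x ∈ e'.source) :
    MDifferentiableAt 𝓘(ℂ) 𝓘(ℂ) f x ↔ DifferentiableAt ℂ (e' ∘ f ∘ e.symm) (e x) := by
  have hsymm := mdifferentiableAt_atlas_symm (I := 𝓘(ℂ)) he (e.map_source hx)
  rw [← mdifferentiableAt_iff_differentiableAt]
  constructor
  · intro h
    rw [← e.left_inv hx] at h hy
    exact MDifferentiableAt.comp (g := e') (f := f ∘ e.symm) (e x) (mdifferentiableAt_atlas he' hy)
      (h.comp _ hsymm)
  · intro h
    have h1 := h.comp x (mdifferentiableAt_atlas he hx)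
    have hev : f =ᶠ[𝓝 x] e'.symm ∘ ((e' ∘ f ∘ e.symm) ∘ e) := by
      filter_upwards [e.open_source.mem_nhds hx,
        hc.eventually (e'.open_source.mem_nhds hy)] with y h1 h2
      simp only [Function.comp, e.left_inv h1]
      exact (e'.left_inv h2).symm
    refine MDifferentiableAt.congr_of_eventuallyEq ?_ hev
    refine MDifferentiableAt.comp x ?_ h1
    refine mdifferentiableAt_atlas_symm he' ?_
    simp only [Function.comp, e.left_inv hx]
    exact e'.map_source hy

end Charts

end ComplexDerivative

/-! ### Local primitives of complex-valued forms on a real surface. -/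

section RealForms

variable {S : Type*} [TopologicalSpace S] [ChartedSpace ℂ S]

/-- `G` is a primitive, near `p`, of the complex-valued one-form `θ` on a real surface. -/
def IsPrimitiveAt (θ : ∀ p : S, TangentSpace 𝓘(ℝ, ℂ) p →L[ℝ] ℂ) (G : S → ℂ) (p : S) : Prop :=
  ∀ᶠ q in 𝓝 p, HasMFDerivAt 𝓘(ℝ, ℂ) 𝓘(ℝ, ℂ) G q (θ q)

/-- The expression of a complex-valued one-form in a chart. -/
def formInChart (θ : ∀ p : S, TangentSpace 𝓘(ℝ, ℂ) p →L[ℝ] ℂ) (e : OpenPartialHomeomorph S ℂ)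
    (x : ℂ) : ℂ →L[ℝ] ℂ :=
  ContinuousLinearMap.comp (M₁ := ℂ) (M₂ := ℂ) (θ (e.symm x)) (mfderiv 𝓘(ℝ, ℂ) 𝓘(ℝ, ℂ) e.symm x)

variable {θ : ∀ p : S, TangentSpace 𝓘(ℝ, ℂ) p →L[ℝ] ℂ}

theorem IsPrimitiveAt.neg_comp_invol {σ : S → S} (hσ : ContMDiff 𝓘(ℝ, ℂ) 𝓘(ℝ, ℂ) ∞ σ)
    (hσσ : ∀ p, σ (σ p) = p)
    (hθσ : ∀ p v, θ (σ p) (mfderiv 𝓘(ℝ, ℂ) 𝓘(ℝ, ℂ) σ p v) = -θ p v) {G : S → ℂ} {p : S}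
    (h : IsPrimitiveAt θ G p) : IsPrimitiveAt θ (fun q => -G (σ q)) (σ p) := by
  have hc : Filter.Tendsto σ (𝓝 (σ p)) (𝓝 p) := by
    simpa [hσσ] using (hσ.continuous.tendsto (σ p))
  filter_upwards [hc.eventually h] with q hq
  have h1 := (hq.comp q (hσ.mdifferentiable (by simp) q).hasMFDerivAt).neg
  refine h1.congr_mfderiv (ContinuousLinearMap.ext fun v => ?_)
  exact neg_eq_iff_eq_neg.2 (hθσ q v)

variable [IsManifold 𝓘(ℝ, ℂ) ∞ S] {e : OpenPartialHomeomorph S ℂ}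

theorem HasMFDerivAt.hasFDerivAt_inChart (he : e ∈ atlas ℂ S) {x : ℂ} (hx : x ∈ e.target)
    {G : S → ℂ} (hG : HasMFDerivAt 𝓘(ℝ, ℂ) 𝓘(ℝ, ℂ) G (e.symm x) (θ (e.symm x))) :
    HasFDerivAt (G ∘ e.symm) (formInChart θ e x) x := by
  exact hasMFDerivAt_iff_hasFDerivAt.1
    (hG.comp x (mdifferentiableAt_atlas_symm he hx).hasMFDerivAt)

theorem IsPrimitiveAt.unique {G G' : S → ℂ} {p : S} (h : IsPrimitiveAt θ G p)
    (h' : IsPrimitiveAt θ G' p) : ∀ᶠ q in 𝓝 p, G q - G p = G' q - G' p := by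
  set e := chartAt ℂ p
  have he : e ∈ atlas ℂ S := chart_mem_atlas ℂ p
  have hp : p ∈ e.source := mem_chart_source ℂ p
  have hev : ∀ᶠ x in 𝓝 (e p), x ∈ e.target ∧ HasFDerivAt (fun x => G (e.symm x) - G' (e.symm x))
      (0 : ℂ →L[ℝ] ℂ) x := by
    have hc := e.continuousAt_symm (e.map_source hp)
    rw [ContinuousAt, e.left_inv hp] at hc
    filter_upwards [e.open_target.mem_nhds (e.map_source hp), hc.eventually (h.and h')]
      with x hx hGG
    refine ⟨hx, ?_⟩
    simpa using! (hGG.1.hasFDerivAt_inChart he hx).sub (hGG.2.hasFDerivAt_inChart he hx)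
  obtain ⟨r, hr, hball⟩ := Metric.eventually_nhds_iff_ball.1 hev
  filter_upwards [(e.continuousAt hp).eventually (Metric.ball_mem_nhds _ hr),
    e.open_source.mem_nhds hp] with q hq hqs
  have hconst := (convex_ball (e p) r).is_const_of_fderivWithin_eq_zero (𝕜 := ℝ)
    (f := fun x => G (e.symm x) - G' (e.symm x))
    (fun x hx => (hball x hx).2.differentiableAt.differentiableWithinAt)
    (fun x hx => ((hball x hx).2.hasFDerivWithinAt).fderivWithin
      (Metric.isOpen_ball.uniqueDiffWithinAt hx)) hq (Metric.mem_ball_self hr)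
  simp only [e.left_inv hp, e.left_inv hqs] at hconst
  linear_combination hconst

end RealForms

/-! ### Integrals along piecewise smooth curves. -/

section PathIntegrals

open Filter MeasureTheory

open Classical in
/-- Concatenation of curves. -/
def concatCurve {S : Type*} (γ₁ γ₂ : ℝ → S) (s : ℝ) : S := if s ≤ 1 / 2 then γ₁ (2 * s + 0) else γ₂ (2 * s + -1)

/-- The summand `0` keeps both halves in the form `a * s + b` of `pathIntegrand_comp_affine`. -/
theorem concatCurve_eq_left {S : Type*} {γ₁ γ₂ : ℝ → S} {s : ℝ} (hs : s ≤ 1 / 2) : concatCurve γ₁ γ₂ s = γ₁ (2 * s + 0) :=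
  if_pos hs

theorem concatCurve_eq_right {S : Type*} {γ₁ γ₂ : ℝ → S} (h : γ₁ 1 = γ₂ 0) {s : ℝ} (hs : 1 / 2 ≤ s) :
    concatCurve γ₁ γ₂ s = γ₂ (2 * s + -1) := by
  rcases hs.eq_or_lt with rfl | hs
  · rw [concatCurve_eq_left le_rfl]
    norm_num [h]
  · exact if_neg (not_le.2 hs)

variable {S : Type*} [TopologicalSpace S] [ChartedSpace ℂ S]

/-- The integrand of the integral of a one-form along a curve. -/
def pathIntegrand (θ : ∀ p : S, TangentSpace 𝓘(ℝ, ℂ) p →L[ℝ] ℂ) (γ : ℝ → S) (s : ℝ) : ℂ :=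
  θ (γ s) (mfderiv 𝓘(ℝ, ℝ) 𝓘(ℝ, ℂ) γ s (1 : ℝ))

/-- Piecewise `C¹` curves, parametrized by the unit interval. -/
def IsPiecewiseCurve (γ : ℝ → S) : Prop :=
  ContinuousOn γ (Icc 0 1) ∧
    ∃ B : Finset ℝ, ∀ a b : ℝ, 0 ≤ a → a < b → b ≤ 1 → (∀ s ∈ B, s ∉ Ioo a b) →
      ContMDiffOn 𝓘(ℝ, ℝ) 𝓘(ℝ, ℂ) 1 γ (Icc a b)

/-- This is the chain rule. No differentiability is required: the affine map is invertible, so both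
curves fail to be differentiable together, and then both derivatives have the default value zero. -/
theorem pathIntegrand_comp_affine (θ : ∀ p : S, TangentSpace 𝓘(ℝ, ℂ) p →L[ℝ] ℂ) (γ : ℝ → S)
    {a : ℝ} (ha : a ≠ 0) (b s : ℝ) :
    pathIntegrand θ (fun s => γ (a * s + b)) s = a • pathIntegrand θ γ (a * s + b) := by
  have haff : ∀ a b s : ℝ, HasMFDerivAt 𝓘(ℝ, ℝ) 𝓘(ℝ, ℝ) (fun s => a * s + b) s
      (a • ContinuousLinearMap.id ℝ ℝ) := fun a b s => by
    refine hasMFDerivAt_iff_hasFDerivAt.2 ?_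
    exact (((hasFDerivAt_id s).const_mul a).add_const b)
  by_cases h : MDifferentiableAt 𝓘(ℝ, ℝ) 𝓘(ℝ, ℂ) γ (a * s + b)
  · have h1 := (h.hasMFDerivAt.comp s (haff a b s)).mfderiv
    have h2 : mfderiv 𝓘(ℝ, ℝ) 𝓘(ℝ, ℂ) (fun s => γ (a * s + b)) s (1 : ℝ) =
        a • mfderiv 𝓘(ℝ, ℝ) 𝓘(ℝ, ℂ) γ (a * s + b) (1 : ℝ) := by
      change mfderiv 𝓘(ℝ, ℝ) 𝓘(ℝ, ℂ) (γ ∘ fun s => a * s + b) s (1 : ℝ) = _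
      rw [h1]
      exact (mfderiv 𝓘(ℝ, ℝ) 𝓘(ℝ, ℂ) γ (a * s + b)).map_smul a (1 : ℝ)
    rw [pathIntegrand, h2]
    exact (θ _).map_smul a _
  · have h' : ¬MDifferentiableAt 𝓘(ℝ, ℝ) 𝓘(ℝ, ℂ) (fun s => γ (a * s + b)) s := by
      intro hd
      apply h
      have e1 : a⁻¹ * (a * s + b) + -(a⁻¹ * b) = s := by field_simp; ring
      have h1 : MDifferentiableAt 𝓘(ℝ, ℝ) 𝓘(ℝ, ℂ)
          ((fun s => γ (a * s + b)) ∘ fun s => a⁻¹ * s + -(a⁻¹ * b)) (a * s + b) :=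
        MDifferentiableAt.comp (a * s + b) (by rwa [e1]) (haff _ _ _).mdifferentiableAt
      have e2 : ((fun s => γ (a * s + b)) ∘ fun s => a⁻¹ * s + -(a⁻¹ * b)) = γ := by
        funext x
        have e3 : a * (a⁻¹ * x + -(a⁻¹ * b)) + b = x := by field_simp; ring
        exact congrArg γ e3
      rwa [e2] at h1
    rw [pathIntegrand, pathIntegrand, mfderiv_zero_of_not_mdifferentiableAt h,
      mfderiv_zero_of_not_mdifferentiableAt h']
    have hz : ∀ p : S, θ p (0 : TangentSpace 𝓘(ℝ, ℂ) p) = 0 := fun p => (θ p).map_zero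
    exact (hz _).trans (by rw [show (0 : TangentSpace 𝓘(ℝ, ℝ) (a * s + b) →L[ℝ]
      TangentSpace 𝓘(ℝ, ℂ) (γ (a * s + b))) (1 : ℝ) = 0 from rfl, hz, smul_zero])

variable {γ₁ γ₂ : ℝ → S}

theorem contMDiffOn_comp_affine {γ : ℝ → S} {a b d : ℝ}
    (h : ContMDiffOn 𝓘(ℝ, ℝ) 𝓘(ℝ, ℂ) 1 γ (Icc (2 * a + d) (2 * b + d))) :
    ContMDiffOn 𝓘(ℝ, ℝ) 𝓘(ℝ, ℂ) 1 (fun s => γ (2 * s + d)) (Icc a b) := by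
  have haff : ContMDiff 𝓘(ℝ, ℝ) 𝓘(ℝ, ℝ) 1 (fun s : ℝ => 2 * s + d) :=
    ContDiff.contMDiff (by fun_prop)
  refine h.comp haff.contMDiffOn fun s hs => ?_
  constructor <;> linarith [hs.1, hs.2]

theorem IsPiecewiseCurve.concat (h₁ : IsPiecewiseCurve γ₁) (h₂ : IsPiecewiseCurve γ₂)
    (h : γ₁ 1 = γ₂ 0) : IsPiecewiseCurve (concatCurve γ₁ γ₂) := by
  classical
  obtain ⟨hc₁, B₁, hB₁⟩ := h₁
  obtain ⟨hc₂, B₂, hB₂⟩ := h₂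
  constructor
  · have e1 : ContinuousOn (concatCurve γ₁ γ₂) (Icc 0 (1 / 2)) := by
      refine ContinuousOn.congr (f := fun s => γ₁ (2 * s + 0)) ?_
        fun s hs => concatCurve_eq_left hs.2
      refine hc₁.comp (by fun_prop) fun s hs => ?_
      constructor <;> linarith [hs.1, hs.2]
    have e2 : ContinuousOn (concatCurve γ₁ γ₂) (Icc (1 / 2) 1) := by
      refine ContinuousOn.congr (f := fun s => γ₂ (2 * s + -1)) ?_
        fun s hs => concatCurve_eq_right h hs.1
      refine hc₂.comp (by fun_prop) fun s hs => ?_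
      constructor <;> linarith [hs.1, hs.2]
    have := e1.union_of_isClosed e2 isClosed_Icc isClosed_Icc
    rwa [Icc_union_Icc_eq_Icc (by norm_num) (by norm_num)] at this
  -- Break points are the rescaled ones of the two curves and the junction.
  · refine ⟨insert (1 / 2) (B₁.image (fun s => s / 2) ∪ B₂.image (fun s => (s + 1) / 2)),
      fun a b ha hab hb hs => ?_⟩
    have hs1 : ∀ s ∈ B₁, s / 2 ∉ Ioo a b := fun s h => hs _ (by
      simp only [Finset.mem_insert, Finset.mem_union, Finset.mem_image]
      exact Or.inr (Or.inl ⟨s, h, rfl⟩))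
    have hs2 : ∀ s ∈ B₂, (s + 1) / 2 ∉ Ioo a b := fun s h => hs _ (by
      simp only [Finset.mem_insert, Finset.mem_union, Finset.mem_image]
      exact Or.inr (Or.inr ⟨s, h, rfl⟩))
    have hs3 : (1 / 2 : ℝ) ∉ Ioo a b := hs _ (Finset.mem_insert_self _ _)
    rcases le_or_gt b (1 / 2) with hb2 | hb2
    · refine ContMDiffOn.congr (f := fun s => γ₁ (2 * s + 0)) ?_
        fun s hs => concatCurve_eq_left (hs.2.trans hb2)
      refine contMDiffOn_comp_affine (hB₁ _ _ (by linarith) (by linarith) (by linarith)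
        fun s hsB hsI => hs1 s hsB ?_)
      constructor <;> linarith [hsI.1, hsI.2]
    · have ha2 : 1 / 2 ≤ a := by
        by_contra! h
        exact hs3 ⟨h, hb2⟩
      refine ContMDiffOn.congr (f := fun s => γ₂ (2 * s + -1)) ?_
        fun s hs => concatCurve_eq_right h (ha2.trans hs.1)
      refine contMDiffOn_comp_affine (hB₂ _ _ (by linarith) (by linarith) (by linarith)
        fun s hsB hsI => hs2 s hsB ?_)
      constructor <;> linarith [hsI.1, hsI.2]

theorem pathIntegrand_congr (θ : ∀ p : S, TangentSpace 𝓘(ℝ, ℂ) p →L[ℝ] ℂ) {s : ℝ}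
    (h : γ₁ =ᶠ[𝓝 s] γ₂) : pathIntegrand θ γ₁ s = pathIntegrand θ γ₂ s := by
  have h1 := h.self_of_nhds
  have h2 : mfderiv 𝓘(ℝ, ℝ) 𝓘(ℝ, ℂ) γ₁ s (1 : ℝ) = mfderiv 𝓘(ℝ, ℝ) 𝓘(ℝ, ℂ) γ₂ s (1 : ℝ) := by
    rw [h.mfderiv_eq]
    rfl
  unfold pathIntegrand
  have h3 : ∀ (p q : S) (v : ℂ), p = q → θ p v = θ q v := by
    rintro p _ v rfl
    rfl
  exact (congrArg (θ (γ₁ s)) h2).trans (h3 _ _ _ h1)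

/-- The integrands are compared on the open halves only, since the derivative at the junction
involves both curves; endpoints do not affect the integrals. -/
theorem intervalIntegral_concatCurve (θ : ∀ p : S, TangentSpace 𝓘(ℝ, ℂ) p →L[ℝ] ℂ)
    (h₁ : IntervalIntegrable (pathIntegrand θ γ₁) volume 0 1)
    (h₂ : IntervalIntegrable (pathIntegrand θ γ₂) volume 0 1) :
    IntervalIntegrable (pathIntegrand θ (concatCurve γ₁ γ₂)) volume 0 1 ∧
    ∫ s in (0 : ℝ)..1, pathIntegrand θ (concatCurve γ₁ γ₂) s =
      (∫ s in (0 : ℝ)..1, pathIntegrand θ γ₁ s) + ∫ s in (0 : ℝ)..1, pathIntegrand θ γ₂ s := by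
  have e1 : EqOn (fun s => (2 : ℝ) • pathIntegrand θ γ₁ (2 * s + 0))
      (pathIntegrand θ (concatCurve γ₁ γ₂)) (uIoo 0 (1 / 2)) := by
    intro s hs
    rw [uIoo_of_le (by norm_num)] at hs
    rw [pathIntegrand_congr θ (γ₂ := fun s => γ₁ (2 * s + 0))]
    · exact (pathIntegrand_comp_affine θ γ₁ two_ne_zero 0 s).symm
    · filter_upwards [Iio_mem_nhds hs.2] with s' hs'
      exact concatCurve_eq_left (le_of_lt hs')
  have e2 : EqOn (fun s => (2 : ℝ) • pathIntegrand θ γ₂ (2 * s + -1))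
      (pathIntegrand θ (concatCurve γ₁ γ₂)) (uIoo (1 / 2) 1) := by
    intro s hs
    rw [uIoo_of_le (by norm_num)] at hs
    rw [pathIntegrand_congr θ (γ₂ := fun s => γ₂ (2 * s + -1))]
    · exact (pathIntegrand_comp_affine θ γ₂ two_ne_zero (-1) s).symm
    · filter_upwards [Ioi_mem_nhds hs.1] with s' hs'
      exact if_neg (not_le.2 hs')
  have i1 : IntervalIntegrable (fun s => (2 : ℝ) • pathIntegrand θ γ₁ (2 * s + 0)) volume
      0 (1 / 2) := by
    have := ((h₁.comp_add_right 0).comp_mul_left (c := 2)).smul (2 : ℝ)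
    norm_num at this ⊢
    exact this
  have i2 : IntervalIntegrable (fun s => (2 : ℝ) • pathIntegrand θ γ₂ (2 * s + -1)) volume
      (1 / 2) 1 := by
    have := ((h₂.comp_add_right (-1)).comp_mul_left (c := 2)).smul (2 : ℝ)
    norm_num at this ⊢
    exact this
  have j1 := i1.congr_uIoo e1
  have j2 := i2.congr_uIoo e2
  refine ⟨j1.trans j2, ?_⟩
  rw [← intervalIntegral.integral_add_adjacent_intervals j1 j2,
    ← intervalIntegral.integral_congr_uIoo e1, ← intervalIntegral.integral_congr_uIoo e2,
    intervalIntegral.integral_smul, intervalIntegral.integral_smul,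
    intervalIntegral.smul_integral_comp_mul_add, intervalIntegral.smul_integral_comp_mul_add]
  norm_num

/-- `p` and `q` are joined by a piecewise `C¹` curve, along which the integral of `θ' - θ` is `I`. -/
def JoinedWithIntegral (θ θ' : ∀ p : S, TangentSpace 𝓘(ℝ, ℂ) p →L[ℝ] ℂ) (p q : S) (I : ℂ) : Prop :=
  ∃ γ : ℝ → S, γ 0 = p ∧ γ 1 = q ∧ IsPiecewiseCurve γ ∧
    IntervalIntegrable (pathIntegrand θ γ) volume 0 1 ∧
    IntervalIntegrable (pathIntegrand θ' γ) volume 0 1 ∧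
    (∫ s in (0 : ℝ)..1, pathIntegrand θ' γ s) - (∫ s in (0 : ℝ)..1, pathIntegrand θ γ s) = I

variable {θ θ' : ∀ p : S, TangentSpace 𝓘(ℝ, ℂ) p →L[ℝ] ℂ}

theorem JoinedWithIntegral.trans {p q r : S} {I J : ℂ} (h : JoinedWithIntegral θ θ' p q I)
    (h' : JoinedWithIntegral θ θ' q r J) : JoinedWithIntegral θ θ' p r (I + J) := by
  obtain ⟨γ₁, rfl, rfl, hγ₁, i₁, i₁', rfl⟩ := h
  obtain ⟨γ₂, h0, rfl, hγ₂, i₂, i₂', rfl⟩ := h'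
  obtain ⟨j, hj⟩ := intervalIntegral_concatCurve θ i₁ i₂
  obtain ⟨j', hj'⟩ := intervalIntegral_concatCurve θ' i₁' i₂'
  refine ⟨concatCurve γ₁ γ₂, ?_, ?_, hγ₁.concat hγ₂ h0.symm, j, j', ?_⟩
  · rw [concatCurve_eq_left (by norm_num)]
    norm_num
  · rw [concatCurve_eq_right h0.symm (by norm_num)]
    norm_num
  · rw [hj, hj']
    ring

end PathIntegrals

/-! ### Global primitives from equality of periods. -/

section GlobalPrimitive

open Filter MeasureTheory

variable {S : Type*} [TopologicalSpace S] [ChartedSpace ℂ S] [IsManifold 𝓘(ℝ, ℂ) ∞ S]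
  {θ θ' : ∀ p : S, TangentSpace 𝓘(ℝ, ℂ) p →L[ℝ] ℂ} {e : OpenPartialHomeomorph S ℂ}

/-- A segment in a chart. -/
def chartSegment (e : OpenPartialHomeomorph S ℂ) (x x' : ℂ) (s : ℝ) : S :=
  e.symm (x + s • (x' - x))

theorem segment_mem_ball {c x x' : ℂ} {r : ℝ} (hx : x ∈ Metric.ball c r)
    (hx' : x' ∈ Metric.ball c r) {s : ℝ} (hs : s ∈ Icc (0 : ℝ) 1) :
    x + s • (x' - x) ∈ Metric.ball c r :=
  (convex_ball c r).add_smul_sub_mem hx hx' hs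

theorem isPiecewiseCurve_chartSegment (he : e ∈ atlas ℂ S) {c x x' : ℂ} {r : ℝ}
    (hr : Metric.ball c r ⊆ e.target) (hx : x ∈ Metric.ball c r) (hx' : x' ∈ Metric.ball c r) :
    IsPiecewiseCurve (chartSegment e x x') := by
  have haff : ContMDiff 𝓘(ℝ, ℝ) 𝓘(ℝ, ℂ) 1 (fun s : ℝ => x + s • (x' - x)) :=
    ContDiff.contMDiff (by fun_prop)
  have hsm : ContMDiffOn 𝓘(ℝ, ℝ) 𝓘(ℝ, ℂ) 1 (chartSegment e x x') (Icc 0 1) :=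
    (contMDiffOn_symm_of_mem_maximalAtlas (IsManifold.subset_maximalAtlas he)).comp
      haff.contMDiffOn fun s hs => hr (segment_mem_ball hx hx' hs)
  exact ⟨hsm.continuousOn, ∅, fun a b ha _ hb _ => hsm.mono (Icc_subset_Icc ha hb)⟩

theorem pathIntegrand_chartSegment (he : e ∈ atlas ℂ S) {x x' : ℂ} {s : ℝ}
    (hs : x + s • (x' - x) ∈ e.target) :
    pathIntegrand θ (chartSegment e x x') s = formInChart θ e (x + s • (x' - x)) (x' - x) := by
  have h1 : HasMFDerivAt 𝓘(ℝ, ℝ) 𝓘(ℝ, ℂ) (fun s : ℝ => x + s • (x' - x)) s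
      ((ContinuousLinearMap.id ℝ ℝ).smulRight (x' - x)) :=
    hasMFDerivAt_iff_hasFDerivAt.2 (((hasFDerivAt_id s).smul_const (x' - x)).const_add x)
  have h2 := ((mdifferentiableAt_atlas_symm (I := 𝓘(ℝ, ℂ)) he hs).hasMFDerivAt.comp s h1).mfderiv
  have h3 : mfderiv 𝓘(ℝ, ℝ) 𝓘(ℝ, ℂ) (chartSegment e x x') s (1 : ℝ) =
      mfderiv 𝓘(ℝ, ℂ) 𝓘(ℝ, ℂ) e.symm (x + s • (x' - x)) (x' - x) := by
    change mfderiv 𝓘(ℝ, ℝ) 𝓘(ℝ, ℂ) (e.symm ∘ fun s : ℝ => x + s • (x' - x)) s (1 : ℝ) = _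
    rw [h2]
    change mfderiv 𝓘(ℝ, ℂ) 𝓘(ℝ, ℂ) e.symm (x + s • (x' - x)) ((1 : ℝ) • (x' - x)) = _
    rw [one_smul]
  exact congrArg (θ (chartSegment e x x' s)) h3

theorem intervalIntegral_chartSegment (he : e ∈ atlas ℂ S) {c x x' : ℂ} {r : ℝ}
    (hr : Metric.ball c r ⊆ e.target) (hx : x ∈ Metric.ball c r) (hx' : x' ∈ Metric.ball c r)
    (hc : ∀ v, ContinuousOn (fun y => formInChart θ e y v) e.target) {G : S → ℂ}
    (hG : ∀ y ∈ Metric.ball c r, HasMFDerivAt 𝓘(ℝ, ℂ) 𝓘(ℝ, ℂ) G (e.symm y) (θ (e.symm y))) :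
    IntervalIntegrable (pathIntegrand θ (chartSegment e x x')) volume 0 1 ∧
    ∫ s in (0 : ℝ)..1, pathIntegrand θ (chartSegment e x x') s =
      G (e.symm x') - G (e.symm x) := by
  have hmem : ∀ s ∈ Icc (0 : ℝ) 1, x + s • (x' - x) ∈ Metric.ball c r :=
    fun s hs => segment_mem_ball hx hx' hs
  have heq : EqOn (fun s : ℝ => formInChart θ e (x + s • (x' - x)) (x' - x))
      (pathIntegrand θ (chartSegment e x x')) (Icc 0 1) :=
    fun s hs => (pathIntegrand_chartSegment he (hr (hmem s hs))).symm
  have hcont : ContinuousOn (pathIntegrand θ (chartSegment e x x')) (uIcc 0 1) := by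
    rw [uIcc_of_le zero_le_one]
    refine ContinuousOn.congr ?_ heq.symm
    exact (hc (x' - x)).comp (by fun_prop) fun s hs => hr (hmem s hs)
  refine ⟨hcont.intervalIntegrable, ?_⟩
  rw [intervalIntegral.integral_eq_sub_of_hasDerivAt (f := fun s : ℝ => G (chartSegment e x x' s))
    (fun s hs => ?_) hcont.intervalIntegrable]
  · simp [chartSegment]
  · rw [uIcc_of_le zero_le_one] at hs
    rw [← heq hs]
    have h1 : HasDerivAt (fun s : ℝ => x + s • (x' - x)) (x' - x) s := by
      simpa using ((hasDerivAt_id s).smul_const (x' - x)).const_add x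
    exact ((hG _ (hmem s hs)).hasFDerivAt_inChart he (hr (hmem s hs))).comp_hasDerivAt s h1

/-- Near a point, points are joined by curves along which the integral is given by a primitive. -/
theorem eventually_joinedWithIntegral
    (hc : ∀ e ∈ atlas ℂ S, ∀ v, ContinuousOn (fun y => formInChart θ e y v) e.target)
    (hc' : ∀ e ∈ atlas ℂ S, ∀ v, ContinuousOn (fun y => formInChart θ' e y v) e.target)
    {p : S} {G G' : S → ℂ} (hG : IsPrimitiveAt θ G p) (hG' : IsPrimitiveAt θ' G' p) :
    ∃ N ∈ 𝓝 p, ∀ q ∈ N, ∀ q' ∈ N,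
      JoinedWithIntegral θ θ' q q' ((G' q' - G q') - (G' q - G q)) := by
  set e := chartAt ℂ p
  have he : e ∈ atlas ℂ S := chart_mem_atlas ℂ p
  have hp : p ∈ e.source := mem_chart_source ℂ p
  have hcs := e.continuousAt_symm (e.map_source hp)
  rw [ContinuousAt, e.left_inv hp] at hcs
  obtain ⟨r, hr, hball⟩ := Metric.eventually_nhds_iff_ball.1
    ((hcs.eventually (hG.and hG')).and (e.open_target.mem_nhds (e.map_source hp)))
  have hsub : Metric.ball (e p) r ⊆ e.target := fun y hy => (hball y hy).2
  refine ⟨e.source ∩ e ⁻¹' Metric.ball (e p) r, inter_mem (e.open_source.mem_nhds hp)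
    (e.continuousAt hp (Metric.ball_mem_nhds _ hr)), ?_⟩
  rintro q ⟨hq, hqb⟩ q' ⟨hq', hqb'⟩
  obtain ⟨i, hi⟩ := intervalIntegral_chartSegment he hsub hqb hqb' (hc e he)
    fun y hy => (hball y hy).1.1
  obtain ⟨i', hi'⟩ := intervalIntegral_chartSegment he hsub hqb hqb' (hc' e he)
    fun y hy => (hball y hy).1.2
  refine ⟨chartSegment e (e q) (e q'), by simp [chartSegment, e.left_inv hq],
    by simp [chartSegment, e.left_inv hq'], isPiecewiseCurve_chartSegment he hsub hqb hqb', i, i',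
    ?_⟩
  rw [hi, hi', e.left_inv hq, e.left_inv hq']
  ring

/-- A difference of two closed forms with the same periods has a global primitive. It can be
normalized to be zero at one point of each connected component. -/
theorem exists_primitive_of_periods_eq
    (hc : ∀ e ∈ atlas ℂ S, ∀ v, ContinuousOn (fun y => formInChart θ e y v) e.target)
    (hc' : ∀ e ∈ atlas ℂ S, ∀ v, ContinuousOn (fun y => formInChart θ' e y v) e.target)
    (hG : ∀ p, ∃ G, IsPrimitiveAt θ G p) (hG' : ∀ p, ∃ G, IsPrimitiveAt θ' G p)
    (hper : ∀ γ : ℝ → S, IsClosedCurve γ →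
      ∫ s in (0 : ℝ)..1, pathIntegrand θ γ s = ∫ s in (0 : ℝ)..1, pathIntegrand θ' γ s)
    (β : ConnectedComponents S → S) (hβ : ∀ c, ConnectedComponents.mk (β c) = c) :
    ∃ F : S → ℂ, (∀ p, HasMFDerivAt 𝓘(ℝ, ℂ) 𝓘(ℝ, ℂ) F p (θ' p - θ p)) ∧ ∀ c, F (β c) = 0 := by
  -- This is how the periods enter: the integral of `θ' - θ` over a closed curve is zero.
  have hclosed : ∀ p I, JoinedWithIntegral θ θ' p p I → I = 0 := by
    rintro p I ⟨γ, h0, h1, hγ, -, -, rfl⟩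
    rw [hper γ ⟨h0.trans h1.symm, hγ⟩, sub_self]
  have hjoin : ∀ b q : S, q ∈ connectedComponent b →
      (∃ I, JoinedWithIntegral θ θ' b q I) ∧ ∃ J, JoinedWithIntegral θ θ' q b J := by
    intro b
    -- Curves in both directions are recorded, so that closed curves can be formed without ever
    -- reversing a curve. The set is open and closed.
    set C := {q | (∃ I, JoinedWithIntegral θ θ' b q I) ∧ ∃ J, JoinedWithIntegral θ θ' q b J}
    have hloc : ∀ q, ∃ N ∈ 𝓝 q, ∀ q' ∈ N, ((q ∈ C → q' ∈ C) ∧ (q' ∈ C → q ∈ C)) := by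
      intro q
      obtain ⟨G, hG⟩ := hG q
      obtain ⟨G', hG'⟩ := hG' q
      obtain ⟨N, hN, h⟩ := eventually_joinedWithIntegral hc hc' hG hG'
      refine ⟨N, hN, fun q' hq' => ?_⟩
      have h1 := h q (mem_of_mem_nhds hN) q' hq'
      have h2 := h q' hq' q (mem_of_mem_nhds hN)
      exact ⟨fun ⟨⟨I, hI⟩, ⟨J, hJ⟩⟩ => ⟨⟨_, hI.trans h1⟩, ⟨_, h2.trans hJ⟩⟩,
        fun ⟨⟨I, hI⟩, ⟨J, hJ⟩⟩ => ⟨⟨_, hI.trans h2⟩, ⟨_, h1.trans hJ⟩⟩⟩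
    have hclopen : IsClopen C := by
      constructor
      · rw [← isOpen_compl_iff, isOpen_iff_mem_nhds]
        intro q hq
        obtain ⟨N, hN, h⟩ := hloc q
        exact mem_of_superset hN fun q' hq' hC => hq ((h q' hq').2 hC)
      · rw [isOpen_iff_mem_nhds]
        intro q hq
        obtain ⟨N, hN, h⟩ := hloc q
        exact mem_of_superset hN fun q' hq' => (h q' hq').1 hq
    have hb : b ∈ C := by
      obtain ⟨G, hG⟩ := hG b
      obtain ⟨G', hG'⟩ := hG' b
      obtain ⟨N, hN, h⟩ := eventually_joinedWithIntegral hc hc' hG hG'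
      have := h b (mem_of_mem_nhds hN) b (mem_of_mem_nhds hN)
      exact ⟨⟨_, this⟩, ⟨_, this⟩⟩
    exact fun q hq => hclopen.connectedComponent_subset hb hq
  have hcomp : ∀ q, q ∈ connectedComponent (β (ConnectedComponents.mk q)) := fun q => by
    rw [← ConnectedComponents.coe_eq_coe']
    exact (hβ _).symm
  have hF : ∀ q, ∃ I, JoinedWithIntegral θ θ' (β (ConnectedComponents.mk q)) q I :=
    fun q => (hjoin _ q (hcomp q)).1
  have hF' : ∀ q, ∃ I, JoinedWithIntegral θ θ' q (β (ConnectedComponents.mk q)) I :=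
    fun q => (hjoin _ q (hcomp q)).2
  choose F hF using hF
  choose F' hF' using hF'
  refine ⟨F, fun p => ?_, fun c => hclosed _ _ (by simpa only [hβ] using hF (β c))⟩
  obtain ⟨G, hG⟩ := hG p
  obtain ⟨G', hG'⟩ := hG' p
  obtain ⟨N, hN, h⟩ := eventually_joinedWithIntegral hc hc' hG hG'
  -- The closed curve from the base point to `p`, on to `q` and back shows that `F` differs from `G'
  -- - G` by a constant. Near `p` the base point is constant, as components are open.
  have hev : F =ᶠ[𝓝 p] fun q => G' q - G q + (F p - (G' p - G p)) := by
    have hLC : LocallyConnectedSpace S := ChartedSpace.locallyConnectedSpace ℂ S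
    have hcc : connectedComponent p ∈ 𝓝 p := isOpen_connectedComponent.mem_nhds mem_connectedComponent
    filter_upwards [hN, hcc] with q hq hqc
    have hcq : ConnectedComponents.mk q = ConnectedComponents.mk p :=
      ConnectedComponents.coe_eq_coe'.2 hqc
    have h1 := hF p
    have h2 := h p (mem_of_mem_nhds hN) q hq
    have h3 := hF' q
    have h4 := hF q
    have h5 := hclosed _ _ (h4.trans h3)
    rw [hcq] at h3
    have h6 := hclosed _ _ ((h1.trans h2).trans h3)
    linear_combination h5 - h6
  have hd := (hG'.self_of_nhds.sub hG.self_of_nhds).add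
    (hasMFDerivAt_const (F p - (G' p - G p)) p)
  refine HasMFDerivAt.congr_of_eventuallyEq ?_ hev
  exact hd.congr_mfderiv (add_zero (θ' p - θ p : TangentSpace 𝓘(ℝ, ℂ) p →L[ℝ] ℂ))

end GlobalPrimitive

/-! ### Variation of functions with a second order zero. -/

section SmallForms

open Filter

/-- If a `C²` function with parameters vanishes to second order at `x₀` for all parameters, then its
variation with the parameter is small to second order. -/
theorem eventually_norm_sub_le_mul_sq {f : ℝ × ℂ → ℂ} {r₀ : ℝ} {x₀ : ℂ} {U : Set (ℝ × ℂ)}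
    (hU : IsOpen U) (hmem : (r₀, x₀) ∈ U) (hf : ContDiffOn ℝ 2 f U)
    (hO : ∀ᶠ r in 𝓝 r₀, (fun x => f (r, x)) =O[𝓝 x₀] fun x => ‖x - x₀‖ ^ 2) {ε : ℝ} (hε : 0 < ε) :
    ∀ᶠ z in 𝓝 (r₀, x₀), ‖f z - f (r₀, z.2)‖ ≤ ε * ‖z.2 - x₀‖ ^ 2 := by
  set inr : ℂ →L[ℝ] ℝ × ℂ := ContinuousLinearMap.inr ℝ ℝ ℂ
  have hslice : ∀ (r : ℝ) (x : ℂ), HasFDerivAt (fun x : ℂ => (r, x)) inr x := fun r x =>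
    hasFDerivAt_prodMk_right r x
  set φ : ℝ × ℂ → ℂ →L[ℝ] ℂ := fun z => (fderiv ℝ f z).comp inr
  have hφ1 : ContDiffOn ℝ 1 φ U :=
    (hf.fderiv_of_isOpen hU (m := 1) (by norm_num)).clm_comp contDiffOn_const
  have hφ : ∀ r x, (r, x) ∈ U → HasFDerivAt (fun x => f (r, x)) (φ (r, x)) x := fun r x h =>
    (((hf.differentiableOn (by norm_num)).differentiableAt (hU.mem_nhds h)).hasFDerivAt).comp x
      (hslice r x)
  -- The second derivative in `x`. By its continuity `ψ (r, ·) - ψ (r₀, ·)` is bounded by `ε` near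
  -- the point, and two mean value estimates starting at `x₀` give the quadratic bound.
  set ψ : ℝ × ℂ → ℂ →L[ℝ] ℂ →L[ℝ] ℂ := fun z => (fderiv ℝ φ z).comp inr
  have hψc : ContinuousOn ψ U :=
    (hφ1.continuousOn_fderiv_of_isOpen hU le_rfl).clm_comp continuousOn_const
  have hψ : ∀ r x, (r, x) ∈ U → HasFDerivAt (fun x => φ (r, x)) (ψ (r, x)) x := fun r x h =>
    (((hφ1.differentiableOn (by norm_num)).differentiableAt (hU.mem_nhds h)).hasFDerivAt).comp x
      (hslice r x)
  -- The bound by `‖x - x₀‖ ^ 2` forces both the value and the `x`-derivative to vanish at `x₀`;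
  -- these are the initial values for the two estimates.
  have hzero : ∀ᶠ r in 𝓝 r₀, f (r, x₀) = 0 ∧ φ (r, x₀) = 0 := by
    have hUr : ∀ᶠ r in 𝓝 r₀, (r, x₀) ∈ U :=
      (Continuous.prodMk_left x₀).continuousAt.eventually (hU.mem_nhds hmem)
    filter_upwards [hO, hUr] with r hr hrU
    have h0 : f (r, x₀) = 0 := by
      have := hr.eq_zero_imp.self_of_nhds
      simpa using this
    refine ⟨h0, (hφ r x₀ hrU).unique ?_⟩
    rw [hasFDerivAt_iff_isLittleO]
    simp only [h0, sub_zero, zero_apply]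
    refine hr.trans_isLittleO ?_
    exact (Asymptotics.isLittleO_pow_sub_sub x₀ (by norm_num : 1 < 2)).norm_left.congr_left
      (by simp)
  have hψ0 : ContinuousAt ψ (r₀, x₀) := hψc.continuousAt (hU.mem_nhds hmem)
  have hsm : ∀ᶠ z in 𝓝 (r₀, x₀), z ∈ U ∧ dist (ψ z) (ψ (r₀, x₀)) < ε / 2 :=
    (hU.eventually_mem hmem).and (Metric.continuousAt_iff'.1 hψ0 _ (half_pos hε))
  rw [nhds_prod_eq] at hsm ⊢
  obtain ⟨pa, hpa, pb, hpb, hab⟩ := eventually_prod_iff.1 hsm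
  obtain ⟨ρ, hρ, hball⟩ := Metric.eventually_nhds_iff_ball.1 hpb
  refine eventually_prod_iff.2 ⟨fun r => pa r ∧ f (r, x₀) = 0 ∧ φ (r, x₀) = 0, hpa.and hzero,
    fun x => x ∈ Metric.ball x₀ ρ, Metric.ball_mem_nhds _ hρ, fun {r} hr {x} hx => ?_⟩
  obtain ⟨hra, hr1, hr2⟩ := hr
  have hr₀ := hpa.self_of_nhds
  have h₀ := hzero.self_of_nhds
  have hd1 : ∀ y ∈ Metric.ball x₀ ρ, ‖φ (r, y) - φ (r₀, y)‖ ≤ ε * ‖y - x₀‖ := by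
    intro y hy
    have := (convex_ball x₀ ρ).norm_image_sub_le_of_norm_hasFDerivWithin_le (𝕜 := ℝ)
      (f := fun y => φ (r, y) - φ (r₀, y)) (f' := fun y => ψ (r, y) - ψ (r₀, y)) (C := ε)
      (fun y hy => ((hψ r y (hab hra (hball y hy)).1).sub
        (hψ r₀ y (hab hr₀ (hball y hy)).1)).hasFDerivWithinAt)
      (fun y hy => ?_) (Metric.mem_ball_self hρ) hy
    · simpa [hr2, h₀.2] using this
    · have h1 := (hab hra (hball y hy)).2
      have h2 := (hab hr₀ (hball y hy)).2
      rw [← dist_eq_norm]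
      exact (dist_triangle_right _ _ (ψ (r₀, x₀))).trans (by linarith)
  have hsub : Metric.closedBall x₀ ‖x - x₀‖ ⊆ Metric.ball x₀ ρ := fun y hy => by
    have hx' : dist x x₀ < ρ := hx
    rw [dist_eq_norm] at hx'
    exact lt_of_le_of_lt (Metric.mem_closedBall.1 hy) hx'
  have := (convex_closedBall x₀ ‖x - x₀‖).norm_image_sub_le_of_norm_hasFDerivWithin_le (𝕜 := ℝ)
      (f := fun y => f (r, y) - f (r₀, y)) (f' := fun y => φ (r, y) - φ (r₀, y))
      (C := ε * ‖x - x₀‖)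
      (fun y hy => ((hφ r y (hab hra (hball y (hsub hy))).1).sub
        (hφ r₀ y (hab hr₀ (hball y (hsub hy))).1)).hasFDerivWithinAt)
      (fun y hy => (hd1 y (hsub hy)).trans ?_) (Metric.mem_closedBall_self (norm_nonneg _))
      (x := x₀) (y := x) (by simp [dist_eq_norm])
  · simp only [hr1, h₀.1, sub_zero] at this
    calc _ ≤ _ := this
      _ = _ := by ring
  · rw [Metric.mem_closedBall, dist_eq_norm] at hy
    gcongr

/-- Smoothness of a family of forms is stated for components; the components on `1` and `I` control
the operator norm. -/
theorem norm_realLinearMap_le (L : ℂ →L[ℝ] ℂ) : ‖L‖ ≤ ‖L 1‖ + ‖L Complex.I‖ := by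
  refine L.opNorm_le_bound (by positivity) fun z => ?_
  have hz : L z = z.re • L 1 + z.im • L Complex.I := by
    rw [← map_smul, ← map_smul, ← map_add]
    congr 1
    apply Complex.ext <;> simp
  rw [hz]
  calc _ ≤ ‖z.re • L 1‖ + ‖z.im • L Complex.I‖ := norm_add_le _ _
    _ = |z.re| * ‖L 1‖ + |z.im| * ‖L Complex.I‖ := by simp
    _ ≤ ‖z‖ * ‖L 1‖ + ‖z‖ * ‖L Complex.I‖ := by
      gcongr
      · exact Complex.abs_re_le_norm z
      · exact Complex.abs_im_le_norm z
    _ = _ := by ring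

end SmallForms

/-! ### Smooth families of forms and the size of their primitives. -/

section FormFamilies

open Filter

section

variable {T : Type*} [TopologicalSpace T] {S : Type*} [TopologicalSpace S] [ChartedSpace ℂ S]
  [IsManifold 𝓘(ℝ, ℂ) ∞ S] {A : T → ∀ p : S, TangentSpace 𝓘(ℝ, ℂ) p →L[ℝ] ℂ}
  {e : OpenPartialHomeomorph S ℂ} {F : T → S → ℂ}

/-- Mean value estimate for primitives, in a chart. -/
theorem eventually_norm_primitive_sub_le (he : e ∈ atlas ℂ S) {s : T} {x₀ : ℂ}
    (hx₀ : x₀ ∈ e.target)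
    (hF : ∀ t p, HasMFDerivAt 𝓘(ℝ, ℂ) 𝓘(ℝ, ℂ) (F t) p (A t p - A s p)) {ε : ℝ} {m : ℕ}
    (hε : 0 < ε)
    (hA : ∀ᶠ z : T × ℂ in 𝓝 (s, x₀),
      ‖formInChart (A z.1) e z.2 - formInChart (A s) e z.2‖ ≤ ε * ‖z.2 - x₀‖ ^ m) :
    ∀ᶠ z : T × (ℂ × ℂ) in 𝓝 (s, (x₀, x₀)),
      ‖F z.1 (e.symm z.2.1) - F z.1 (e.symm z.2.2)‖ ≤
        ε * max ‖z.2.1 - x₀‖ ‖z.2.2 - x₀‖ ^ m * ‖z.2.1 - z.2.2‖ := by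
  have h1 := hA.and (continuousAt_snd.eventually (e.open_target.mem_nhds hx₀))
  rw [nhds_prod_eq] at h1
  obtain ⟨pa, hpa, pb, hpb, hab⟩ := eventually_prod_iff.1 h1
  obtain ⟨ρ, hρ, hball⟩ := Metric.eventually_nhds_iff_ball.1 hpb
  have h2 : ∀ᶠ z : T × (ℂ × ℂ) in 𝓝 (s, (x₀, x₀)), pa z.1 ∧ z.2.1 ∈ Metric.ball x₀ ρ ∧
      z.2.2 ∈ Metric.ball x₀ ρ := by
    have c1 : ContinuousAt (fun z : T × (ℂ × ℂ) => z.1) (s, (x₀, x₀)) := by fun_prop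
    have c2 : ContinuousAt (fun z : T × (ℂ × ℂ) => z.2.1) (s, (x₀, x₀)) := by fun_prop
    have c3 : ContinuousAt (fun z : T × (ℂ × ℂ) => z.2.2) (s, (x₀, x₀)) := by fun_prop
    exact (c1.eventually hpa).and ((c2.eventually (Metric.ball_mem_nhds _ hρ)).and
      (c3.eventually (Metric.ball_mem_nhds _ hρ)))
  filter_upwards [h2] with z ⟨ha, hb1, hb2⟩
  set R := max ‖z.2.1 - x₀‖ ‖z.2.2 - x₀‖
  have hsub : Metric.closedBall x₀ R ⊆ Metric.ball x₀ ρ := fun y hy => by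
    rw [Metric.mem_ball, dist_eq_norm] at hb1 hb2
    exact lt_of_le_of_lt (Metric.mem_closedBall.1 hy) (max_lt hb1 hb2)
  have hd : ∀ y ∈ Metric.closedBall x₀ R, HasFDerivAt (F z.1 ∘ e.symm)
      (formInChart (A z.1) e y - formInChart (A s) e y) y := fun y hy =>
    HasMFDerivAt.hasFDerivAt_inChart (θ := fun p => A z.1 p - A s p) he
      (hab ha (hball y (hsub hy))).2 (hF z.1 _)
  refine (convex_closedBall x₀ R).norm_image_sub_le_of_norm_hasFDerivWithin_le (𝕜 := ℝ)
    (f := F z.1 ∘ e.symm) (fun y hy => (hd y hy).hasFDerivWithinAt) (fun y hy => ?_)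
    (by simp [dist_eq_norm, R]) (by simp [dist_eq_norm, R])
  refine (hab ha (hball y (hsub hy))).1.trans ?_
  rw [Metric.mem_closedBall, dist_eq_norm] at hy
  gcongr

/-- Mean value estimate for primitives, in terms of a local coordinate `w`. -/
theorem eventually_norm_primitive_sub_le_coordinate {p : S} {s : T}
    (hF : ∀ t p, HasMFDerivAt 𝓘(ℝ, ℂ) 𝓘(ℝ, ℂ) (F t) p (A t p - A s p)) {m : ℕ}
    (hA : ∀ ε > 0, ∀ᶠ z : T × ℂ in 𝓝 (s, chartAt ℂ p p),
      ‖formInChart (A z.1) (chartAt ℂ p) z.2 - formInChart (A s) (chartAt ℂ p) z.2‖ ≤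
        ε * ‖z.2 - chartAt ℂ p p‖ ^ m)
    {w : OpenPartialHomeomorph S ℂ} (hpw : p ∈ w.source)
    (hw : ContMDiffAt 𝓘(ℝ, ℂ) 𝓘(ℝ, ℂ) 1 w.symm (w p)) {ε : ℝ} (hε : 0 < ε) :
    ∀ᶠ z : T × (S × S) in 𝓝 (s, (p, p)),
      ‖F z.1 z.2.1 - F z.1 z.2.2‖ ≤
        ε * max ‖w z.2.1 - w p‖ ‖w z.2.2 - w p‖ ^ m * ‖w z.2.1 - w z.2.2‖ := by
  set e := chartAt ℂ p
  have he : e ∈ atlas ℂ S := chart_mem_atlas ℂ p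
  have hp : p ∈ e.source := mem_chart_source ℂ p
  have hsm : ContDiffAt ℝ 1 (e ∘ w.symm) (w p) := by
    rw [← contMDiffAt_iff_contDiffAt]
    refine ContMDiffAt.comp _ ?_ hw
    rw [w.left_inv hpw]
    exact (contMDiffAt_of_mem_maximalAtlas (IsManifold.subset_maximalAtlas he) hp)
  obtain ⟨K, V, hV, hLip⟩ := hsm.exists_lipschitzOnWith
  set K' : ℝ := K + 1
  have hK' : 0 < K' := by positivity
  have hlip : ∀ q ∈ w.source ∩ w ⁻¹' V, ∀ q' ∈ w.source ∩ w ⁻¹' V,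
      ‖e q - e q'‖ ≤ K' * ‖w q - w q'‖ := fun q hq q' hq' => by
    have := hLip.dist_le_mul _ hq.2 _ hq'.2
    simp only [Function.comp, w.left_inv hq.1, w.left_inv hq'.1, dist_eq_norm] at this
    refine this.trans ?_
    gcongr
    simp [K']
  -- The Lipschitz constant of the coordinate change enters `m` times through the power and once
  -- through the difference.
  set ε' := ε / (K' ^ m * K')
  have hε' : 0 < ε' := by positivity
  have h1 := eventually_norm_primitive_sub_le he (e.map_source hp) hF hε' (hA ε' hε')
  have c1 : ContinuousAt (fun z : T × (S × S) => (z.1, (e z.2.1, e z.2.2))) (s, (p, p)) :=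
    continuousAt_fst.prodMk
      (((e.continuousAt hp).comp_of_eq (continuousAt_fst.comp_of_eq continuousAt_snd rfl) rfl).prodMk
        ((e.continuousAt hp).comp_of_eq (continuousAt_snd.comp_of_eq continuousAt_snd rfl) rfl))
  have hN : e.source ∩ (w.source ∩ w ⁻¹' V) ∈ 𝓝 p := inter_mem (e.open_source.mem_nhds hp)
    (inter_mem (w.open_source.mem_nhds hpw) (w.continuousAt hpw hV))
  have c2 : ContinuousAt (fun z : T × (S × S) => z.2.1) (s, (p, p)) := by fun_prop
  have c3 : ContinuousAt (fun z : T × (S × S) => z.2.2) (s, (p, p)) := by fun_prop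
  filter_upwards [c1.eventually h1, c2.eventually hN, c3.eventually hN] with z hz h2 h3
  have hpN := mem_of_mem_nhds hN
  simp only [e.left_inv h2.1, e.left_inv h3.1] at hz
  refine hz.trans ?_
  have l1 := hlip _ h2.2 _ hpN.2
  have l2 := hlip _ h3.2 _ hpN.2
  have l3 := hlip _ h2.2 _ h3.2
  have l4 : max ‖e z.2.1 - e p‖ ‖e z.2.2 - e p‖ ≤ K' * max ‖w z.2.1 - w p‖ ‖w z.2.2 - w p‖ :=
    max_le (l1.trans (by gcongr; exact le_max_left _ _)) (l2.trans (by gcongr; exact le_max_right _ _))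
  calc _ ≤ ε' * (K' * max ‖w z.2.1 - w p‖ ‖w z.2.2 - w p‖) ^ m * (K' * ‖w z.2.1 - w z.2.2‖) := by
        gcongr
    _ = _ := by
        simp only [ε', mul_pow]
        field_simp

end

variable {T : Type*} [TopologicalSpace T] [ChartedSpace ℝ T]
  {S : Type*} [TopologicalSpace S] [ChartedSpace ℂ S]

/-- Smooth families of one-forms on a real surface. -/
def SmoothFormFamily (A : T → ∀ p : S, TangentSpace 𝓘(ℝ, ℂ) p →L[ℝ] ℂ) : Prop :=
  ∀ e ∈ atlas ℂ S, ∀ v : ℂ, ContMDiffOn (𝓘(ℝ, ℝ).prod 𝓘(ℝ, ℂ)) 𝓘(ℝ, ℂ) ∞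
    (fun x : T × ℂ => formInChart (A x.1) e x.2 v) (univ ×ˢ e.target)

variable {A : T → ∀ p : S, TangentSpace 𝓘(ℝ, ℂ) p →L[ℝ] ℂ} {e : OpenPartialHomeomorph S ℂ}

theorem SmoothFormFamily.continuousOn (hA : SmoothFormFamily A) (he : e ∈ atlas ℂ S) (t : T)
    (v : ℂ) : ContinuousOn (fun x => formInChart (A t) e x v) e.target :=
  (hA e he v).continuousOn.comp (f := fun x => (t, x)) (by fun_prop) fun _ hx => ⟨trivial, hx⟩

theorem SmoothFormFamily.contDiffOn [IsManifold 𝓘(ℝ, ℝ) ∞ T] (hA : SmoothFormFamily A)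
    (he : e ∈ atlas ℂ S) (s : T) (v : ℂ) :
    ContDiffOn ℝ ∞ (fun z : ℝ × ℂ => formInChart (A ((chartAt ℝ s).symm z.1)) e z.2 v)
      ((chartAt ℝ s).target ×ˢ e.target) := by
  have h1 : ContMDiffOn (𝓘(ℝ, ℝ).prod 𝓘(ℝ, ℂ)) (𝓘(ℝ, ℝ).prod 𝓘(ℝ, ℂ)) ∞
      (fun z : ℝ × ℂ => ((chartAt ℝ s).symm z.1, z.2)) ((chartAt ℝ s).target ×ˢ e.target) := by
    refine ContMDiffOn.prodMk ?_ contMDiffOn_snd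
    exact (contMDiffOn_chart_symm (I := 𝓘(ℝ, ℝ)) (x := s)).comp contMDiffOn_fst fun z hz => hz.1
  have h2 := (hA e he v).comp h1 fun z hz => ⟨trivial, hz.2⟩
  rw [← contMDiffOn_iff_contDiffOn, modelWithCornersSelf_prod, ← chartedSpaceSelf_prod]
  exact h2

/-- Continuity in all variables suffices. The power with exponent `0` matches the case `m = 0` of
the mean value estimates. -/
theorem SmoothFormFamily.eventually_norm_sub_le (hA : SmoothFormFamily A)
    (he : e ∈ atlas ℂ S) (s : T) {x₀ : ℂ} (hx₀ : x₀ ∈ e.target) {ε : ℝ} (hε : 0 < ε) :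
    ∀ᶠ z : T × ℂ in 𝓝 (s, x₀),
      ‖formInChart (A z.1) e z.2 - formInChart (A s) e z.2‖ ≤ ε * ‖z.2 - x₀‖ ^ 0 := by
  have key : ∀ v : ℂ, ∀ᶠ z : T × ℂ in 𝓝 (s, x₀),
      ‖formInChart (A z.1) e z.2 v - formInChart (A s) e z.2 v‖ < ε / 2 := by
    intro v
    have h1 : ContinuousAt (fun x : T × ℂ => formInChart (A x.1) e x.2 v) (s, x₀) :=
      (hA e he v).continuousOn.continuousAt (prod_mem_nhds univ_mem (e.open_target.mem_nhds hx₀))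
    have h2 : ContinuousAt (fun x : T × ℂ => formInChart (A s) e x.2 v) (s, x₀) :=
      ((hA.continuousOn he s v).continuousAt (e.open_target.mem_nhds hx₀)).comp_of_eq
        continuousAt_snd rfl
    exact (h1.sub h2).norm.eventually_lt continuousAt_const (by simpa using hε)
  filter_upwards [key 1, key Complex.I] with z h1 h2
  rw [pow_zero, mul_one]
  refine (norm_realLinearMap_le _).trans ?_
  simp only [sub_apply]
  linarith

/-- The hypothesis `hO` requires second order vanishing at one and the same point for all
parameters; `eventually_norm_sub_le_mul_sq` then applies to each component, with the parameter read
in a chart. -/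
theorem SmoothFormFamily.eventually_norm_sub_le_sq [IsManifold 𝓘(ℝ, ℝ) ∞ T]
    (hA : SmoothFormFamily A) (he : e ∈ atlas ℂ S) (s : T) {x₀ : ℂ} (hx₀ : x₀ ∈ e.target)
    (hO : ∀ t, formInChart (A t) e =O[𝓝 x₀] fun x => ‖x - x₀‖ ^ 2) {ε : ℝ} (hε : 0 < ε) :
    ∀ᶠ z : T × ℂ in 𝓝 (s, x₀),
      ‖formInChart (A z.1) e z.2 - formInChart (A s) e z.2‖ ≤ ε * ‖z.2 - x₀‖ ^ 2 := by
  set τ := chartAt ℝ s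
  have hs : s ∈ τ.source := mem_chart_source ℝ s
  have key : ∀ v : ℂ, ∀ᶠ z : T × ℂ in 𝓝 (s, x₀),
      ‖formInChart (A z.1) e z.2 v - formInChart (A s) e z.2 v‖ ≤ ε / 2 * ‖z.2 - x₀‖ ^ 2 := by
    intro v
    have h1 := eventually_norm_sub_le_mul_sq (τ.open_target.prod e.open_target)
      (mk_mem_prod (τ.map_source hs) hx₀)
      ((hA.contDiffOn he s v).of_le (WithTop.coe_le_coe.2 le_top))
      (Eventually.of_forall fun r => ?_) (half_pos hε)
    · have hc : ContinuousAt (fun z : T × ℂ => (τ z.1, z.2)) (s, x₀) :=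
        ((τ.continuousAt hs).comp_of_eq continuousAt_fst rfl).prodMk continuousAt_snd
      have hsrc : ∀ᶠ z : T × ℂ in 𝓝 (s, x₀), z.1 ∈ τ.source :=
        continuousAt_fst.eventually (τ.open_source.mem_nhds hs)
      filter_upwards [hc.eventually h1, hsrc] with z hz hzs
      have hz' : ‖formInChart (A (τ.symm (τ z.1))) e z.2 v - formInChart (A (τ.symm (τ s))) e z.2 v‖
        ≤ ε / 2 * ‖z.2 - x₀‖ ^ 2 := hz
      rwa [τ.left_inv hs, τ.left_inv hzs] at hz'
    · refine Asymptotics.IsBigO.trans ?_ (hO (τ.symm r))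
      refine Asymptotics.IsBigO.of_bound ‖v‖ (Eventually.of_forall fun x => ?_)
      rw [mul_comm]
      exact (formInChart (A (τ.symm r)) e x).le_opNorm v
  filter_upwards [key 1, key Complex.I] with z h1 h2
  refine (norm_realLinearMap_le _).trans ?_
  simp only [sub_apply]
  linarith

variable [IsManifold 𝓘(ℝ, ℂ) ∞ S] {F : T → S → ℂ}

/-- Primitives which vanish at one point of each connected component are small. -/
theorem SmoothFormFamily.tendsto_primitive (hA : SmoothFormFamily A) {s : T}
    (hF : ∀ t p, HasMFDerivAt 𝓘(ℝ, ℂ) 𝓘(ℝ, ℂ) (F t) p (A t p - A s p))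
    (β : ConnectedComponents S → S) (hβ : ∀ c, ConnectedComponents.mk (β c) = c)
    (hFβ : ∀ t c, F t (β c) = 0) (p : S) :
    Tendsto (fun z : T × S => F z.1 z.2) (𝓝 (s, p)) (𝓝 0) := by
  have hloc : ∀ p : S, ∃ N ∈ 𝓝 p, ∀ ε > 0, ∀ᶠ t in 𝓝 s, ∀ q ∈ N, ‖F t q - F t p‖ ≤ ε := by
    intro p
    set e := chartAt ℂ p
    have he : e ∈ atlas ℂ S := chart_mem_atlas ℂ p
    have hp : p ∈ e.source := mem_chart_source ℂ p
    obtain ⟨r, hr, hrt⟩ := Metric.nhds_basis_closedBall.mem_iff.1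
      (e.open_target.mem_nhds (e.map_source hp))
    -- Radius at most `1` turns the mean value bound `ε * ‖e q - e p‖` into `ε`.
    set ρ := min r 1
    have hρ : 0 < ρ := by positivity
    have hρt : Metric.closedBall (e p) ρ ⊆ e.target :=
      (Metric.closedBall_subset_closedBall (min_le_left _ _)).trans hrt
    refine ⟨e.source ∩ e ⁻¹' Metric.closedBall (e p) ρ, inter_mem (e.open_source.mem_nhds hp)
      (e.continuousAt hp (Metric.closedBall_mem_nhds _ hρ)), fun ε hε => ?_⟩
    have h1 := (isCompact_closedBall (e p) ρ).eventually_forall_of_forall_eventually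
      (P := fun t x => ‖formInChart (A t) e x - formInChart (A s) e x‖ ≤ ε) (x₀ := s)
      fun x hx => (hA.eventually_norm_sub_le he s (hρt hx) hε).mono fun z hz => by simpa using hz
    filter_upwards [h1] with t ht q hq
    have hd : ∀ y ∈ Metric.closedBall (e p) ρ, HasFDerivAt (F t ∘ e.symm)
        (formInChart (A t) e y - formInChart (A s) e y) y := fun y hy =>
      HasMFDerivAt.hasFDerivAt_inChart (θ := fun p => A t p - A s p) he (hρt hy) (hF t _)
    have h2 := (convex_closedBall (e p) ρ).norm_image_sub_le_of_norm_hasFDerivWithin_le (𝕜 := ℝ)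
      (f := F t ∘ e.symm) (fun y hy => (hd y hy).hasFDerivWithinAt) ht
      (Metric.mem_closedBall_self hρ.le) hq.2
    simp only [Function.comp, e.left_inv hq.1, e.left_inv hp] at h2
    have h3 : ‖e q - e p‖ ≤ 1 := by
      have := Metric.mem_closedBall.1 hq.2
      rw [dist_eq_norm] at this
      exact this.trans (min_le_right _ _)
    nlinarith
  -- The set of points at which `F t` tends to zero is open and closed by the uniform local
  -- estimate, and it contains the base points.
  have hpt : ∀ q, Tendsto (fun t => F t q) (𝓝 s) (𝓝 0) := by
    set C := {q | Tendsto (fun t => F t q) (𝓝 s) (𝓝 0)}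
    have hC : ∀ q, ∃ N ∈ 𝓝 q, ∀ q' ∈ N, (q ∈ C ↔ q' ∈ C) := by
      intro q
      obtain ⟨N, hN, h⟩ := hloc q
      refine ⟨N, hN, fun q' hq' => ?_⟩
      have h1 : Tendsto (fun t => F t q' - F t q) (𝓝 s) (𝓝 0) := by
        rw [Metric.tendsto_nhds]
        intro ε hε
        filter_upwards [h (ε / 2) (half_pos hε)] with t ht
        rw [dist_zero_right]
        linarith [ht q' hq']
      constructor <;> intro hq
      · have hq : Tendsto (fun t => F t q) (𝓝 s) (𝓝 0) := hq
        have h2 := h1.add hq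
        simp only [sub_add_cancel, add_zero] at h2
        exact h2
      · have hq : Tendsto (fun t => F t q') (𝓝 s) (𝓝 0) := hq
        have h2 := hq.sub h1
        simp only [sub_sub_cancel, sub_zero] at h2
        exact h2
    have hclopen : IsClopen C := by
      constructor
      · rw [← isOpen_compl_iff, isOpen_iff_mem_nhds]
        intro q hq
        obtain ⟨N, hN, h⟩ := hC q
        exact mem_of_superset hN fun q' hq' hq'C => hq ((h q' hq').2 hq'C)
      · rw [isOpen_iff_mem_nhds]
        intro q hq
        obtain ⟨N, hN, h⟩ := hC q
        exact mem_of_superset hN fun q' hq' => (h q' hq').1 hq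
    intro q
    have hb : β (ConnectedComponents.mk q) ∈ C :=
      tendsto_const_nhds.congr fun t => (hFβ t _).symm
    refine hclopen.connectedComponent_subset hb ?_
    rw [← ConnectedComponents.coe_eq_coe']
    exact (hβ _).symm
  obtain ⟨N, hN, h⟩ := hloc p
  rw [Metric.tendsto_nhds]
  intro ε hε
  have h0 : ∀ᶠ t in 𝓝 s, ‖F t p‖ < ε / 2 := by
    simpa using (Metric.tendsto_nhds.1 (hpt p)) (ε / 2) (half_pos hε)
  have h1 : ∀ᶠ z : T × S in 𝓝 (s, p), ‖F z.1 p‖ < ε / 2 :=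
    (continuousAt_fst (p := (s, p))).eventually h0
  filter_upwards [h1, continuousAt_fst.eventually (h (ε / 2) (half_pos hε)),
    continuousAt_snd.eventually hN] with z h1 h2 h3
  rw [dist_zero_right]
  have h4 := h2 _ h3
  have h5 := norm_add_le (F z.1 z.2 - F z.1 p) (F z.1 p)
  rw [sub_add_cancel] at h5
  linarith

end FormFamilies

/-! ### Coordinates adapted to a holomorphic form `h dz`. -/

section PlanarPrimitives

theorem exists_primitive_of_analyticAt {h : ℂ → ℂ} {z₀ : ℂ} (hh : AnalyticAt ℂ h z₀) :
    ∃ k : ℂ → ℂ, k z₀ = 0 ∧ AnalyticAt ℂ k z₀ ∧ ∀ᶠ z in 𝓝 z₀, HasDerivAt k (h z) z := by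
  obtain ⟨r, hr, hball⟩ := Metric.eventually_nhds_iff_ball.1 hh.eventually_analyticAt
  have hd : DifferentiableOn ℂ h (Metric.ball z₀ r) := fun z hz =>
    (hball z hz).differentiableAt.differentiableWithinAt
  obtain ⟨k, hk0, hk⟩ := hd.isExactOn_ball.with_val_at z₀ 0
  have hkd : DifferentiableOn ℂ k (Metric.ball z₀ r) := fun z hz =>
    (hk z hz).differentiableAt.differentiableWithinAt
  exact ⟨k, hk0, hkd.analyticAt (Metric.ball_mem_nhds _ hr),
    Filter.mem_of_superset (Metric.ball_mem_nhds _ hr) hk⟩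

theorem exists_coordinate_of_ne_zero {h : ℂ → ℂ} {z₀ : ℂ} (hh : AnalyticAt ℂ h z₀)
    (h0 : h z₀ ≠ 0) {U : Set ℂ} (hU : U ∈ 𝓝 z₀) :
    ∃ g : OpenPartialHomeomorph ℂ ℂ, z₀ ∈ g.source ∧ g.source ⊆ U ∧
      (∀ z ∈ g.source, h z ≠ 0 ∧ HasDerivAt g (h z) z) ∧ ∀ y ∈ g.target, AnalyticAt ℂ g.symm y := by
  obtain ⟨k, hk0, hka, hk⟩ := exists_primitive_of_analyticAt hh
  obtain ⟨g, rfl, hz, hgU, hg, hgs⟩ := exists_openPartialHomeomorph_of_deriv_ne_zero hka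
    (by rwa [hk.self_of_nhds.deriv]) (Filter.inter_mem hU hk)
  refine ⟨g, hz, fun z hz => (hgU hz).1, fun z hz => ⟨?_, (hgU hz).2⟩, hgs⟩
  rw [← (show HasDerivAt g (h z) z from (hgU hz).2).deriv]
  exact (hg z hz).2

/-- A primitive vanishing at `z₀` has order three there, hence is the cube of a coordinate `g`. From
`h = 3 g² g'` with `g' ≠ 0`, the only zero of `h` in the source is that of `g`. -/
theorem exists_coordinate_of_order_two {h : ℂ → ℂ} {z₀ : ℂ} (hh : AnalyticAt ℂ h z₀)
    (h2 : analyticOrderAt h z₀ = 2) {U : Set ℂ} (hU : U ∈ 𝓝 z₀) :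
    ∃ g : OpenPartialHomeomorph ℂ ℂ, z₀ ∈ g.source ∧ g z₀ = 0 ∧ g.source ⊆ U ∧
      (∀ z ∈ g.source, (h z = 0 → z = z₀) ∧ HasDerivAt (fun z => g z ^ 3) (h z) z) ∧
      ∀ y ∈ g.target, AnalyticAt ℂ g.symm y := by
  obtain ⟨k, hk0, hka, hk⟩ := exists_primitive_of_analyticAt hh
  have hord : analyticOrderAt k z₀ = (3 : ℕ) := by
    have h1 := hka.analyticOrderAt_deriv_add_one
    have h3 : deriv k =ᶠ[𝓝 z₀] h := hk.mono fun z hz => hz.deriv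
    rw [analyticOrderAt_congr h3, h2] at h1
    simp only [hk0, sub_zero] at h1
    rw [← h1]
    norm_num
  obtain ⟨w, hw, hw0, hwd, hkw⟩ := exists_analyticAt_eq_pow_of_analyticOrderAt hka three_ne_zero hord
  obtain ⟨g, rfl, hz₀, hgU, hg, hgs⟩ := exists_openPartialHomeomorph_of_deriv_ne_zero hw hwd
    (Filter.inter_mem hU (hk.and hkw.eventually_nhds))
  have hder : ∀ z ∈ g.source, HasDerivAt (fun z => g z ^ 3) (h z) z := fun z hz =>
    HasDerivAt.congr_of_eventuallyEq (hgU hz).2.1 ((hgU hz).2.2.mono fun y hy => hy.symm)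
  refine ⟨g, hz₀, hw0, fun z hz => (hgU hz).1, fun z hz => ⟨fun h0 => ?_, hder z hz⟩, hgs⟩
  have h1 := ((hg z hz).1.differentiableAt.hasDerivAt.pow 3).unique (hder z hz)
  rw [h0] at h1
  have h4 : g z = 0 := by
    simpa [(hg z hz).2] using h1
  exact g.injOn hz hz₀ (h4.trans hw0.symm)

end PlanarPrimitives

/-! ### Points, fibres and involution of the Hitchin covering. -/

section HitchinLocal

open Filter

variable {X Y : Type*} [TopologicalSpace X] [ChartedSpace ℂ X] [TopologicalSpace Y]
  [ChartedSpace ℂ Y] {Q : QuadraticDifferential X}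

namespace HitchinCovering

variable (H : HitchinCovering Q Y)

/-- The square root of `Q` represented by a point of the covering, as a complex number. -/
def rootValue (y : Y) : ℂ := H.root y (1 : ℂ)

theorem rootValue_sq (y : Y) : H.rootValue y ^ 2 = Q (H.proj y) (1 : ℂ) (1 : ℂ) :=
  H.bijOn_roots.mapsTo (mem_univ y) (1 : ℂ)

theorem proj_invol (y : Y) : H.proj (H.invol y) = H.proj y :=
  congrArg Sigma.fst (H.invol_eq y)

theorem rootValue_invol (y : Y) : H.rootValue (H.invol y) = -H.rootValue y :=
  congrArg (fun q : Σ p : X, (TangentSpace 𝓘(ℂ) p →L[ℂ] ℂ) => q.2 (1 : ℂ)) (H.invol_eq y)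

theorem ext_iff_rootValue {y y' : Y} (h : H.proj y = H.proj y')
    (h' : H.rootValue y = H.rootValue y') : y = y' := by
  refine H.bijOn_roots.injOn (mem_univ y) (mem_univ y') ?_
  have key : ∀ (p p' : X) (η : TangentSpace 𝓘(ℂ) p →L[ℂ] ℂ) (η' : TangentSpace 𝓘(ℂ) p' →L[ℂ] ℂ),
      p = p' → η (1 : ℂ) = η' (1 : ℂ) →
      (⟨p, η⟩ : Σ p : X, (TangentSpace 𝓘(ℂ) p →L[ℂ] ℂ)) = ⟨p', η'⟩ := by
    rintro p _ η η' rfl h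
    congr 1
    exact ContinuousLinearMap.ext_ring (R₁ := ℂ) h
  exact key _ _ _ _ h h'

theorem exists_eq_of_sq (x : X) (c : ℂ) (hc : c ^ 2 = Q x (1 : ℂ) (1 : ℂ)) :
    ∃ y, H.proj y = x ∧ H.rootValue y = c := by
  obtain ⟨y, -, hy⟩ := H.bijOn_roots.surjOn
    (show (⟨x, (c • ContinuousLinearMap.id ℂ ℂ : ℂ →L[ℂ] ℂ)⟩ :
      Σ p : X, (TangentSpace 𝓘(ℂ) p →L[ℂ] ℂ)) ∈ _ from fun (v : ℂ) => by
        change (c * v) ^ 2 = Q x v v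
        rw [Q.apply_eq_mul x v v, ← hc]
        ring)
  refine ⟨y, congrArg Sigma.fst hy, ?_⟩
  have := congrArg (fun q : Σ p : X, (TangentSpace 𝓘(ℂ) p →L[ℂ] ℂ) => q.2 (1 : ℂ)) hy
  exact this.trans (mul_one c)

theorem proj_surjective : Function.Surjective H.proj := fun x => by
  obtain ⟨c, hc⟩ : ∃ c : ℂ, c ^ 2 = Q x (1 : ℂ) (1 : ℂ) := IsAlgClosed.exists_pow_nat_eq _ two_pos
  obtain ⟨y, hy, -⟩ := H.exists_eq_of_sq x c hc
  exact ⟨y, hy⟩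

theorem eq_or_eq_invol {y y' : Y} (h : H.proj y = H.proj y') : y' = y ∨ y' = H.invol y := by
  have h1 : H.rootValue y' ^ 2 = H.rootValue y ^ 2 := by rw [rootValue_sq, rootValue_sq, h]
  rcases sq_eq_sq_iff_eq_or_eq_neg.1 h1 with h2 | h2
  · exact Or.inl (H.ext_iff_rootValue h.symm h2)
  · exact Or.inr (H.ext_iff_rootValue (h.symm.trans (H.proj_invol y).symm)
      (h2.trans (H.rootValue_invol y).symm))

theorem invol_eq_self_iff {y : Y} : H.invol y = y ↔ H.rootValue y = 0 := by
  constructor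
  · intro h
    have := H.rootValue_invol y
    rw [h] at this
    exact self_eq_neg.1 this
  · intro h
    exact H.ext_iff_rootValue (H.proj_invol y) (by rw [rootValue_invol, h, neg_zero])

theorem invol_invol (y : Y) : H.invol (H.invol y) = y :=
  H.ext_iff_rootValue (by rw [proj_invol, proj_invol]) (by simp [rootValue_invol])

theorem omega_apply_one (y : Y) : H.omega y (1 : ℂ) = H.rootValue y * cderiv H.proj y := by
  rw [mul_comm]
  have : ∀ v : ℂ, H.root y v = v * H.rootValue y := fun v => by
    have h1 : v = v • (1 : ℂ) := by simp
    conv_lhs => rw [h1]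
    exact (H.root y).map_smul v (1 : ℂ)
  exact this _


end HitchinCovering

end HitchinLocal

/-! ### Holomorphic maps in charts. -/

section ChartExpressions

open Filter

variable {X Y : Type*} [TopologicalSpace X] [ChartedSpace ℂ X] [TopologicalSpace Y]
  [ChartedSpace ℂ Y]

omit [ChartedSpace ℂ Y] in
theorem eventually_symm_of_eventually {e : OpenPartialHomeomorph Y ℂ} {y : Y} (hy : y ∈ e.source)
    {p : Y → Prop} (h : ∀ᶠ y' in 𝓝 y, p y') :
    ∀ᶠ z in 𝓝 (e y), z ∈ e.target ∧ p (e.symm z) := by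
  have hc := e.continuousAt_symm (e.map_source hy)
  rw [ContinuousAt, e.left_inv hy] at hc
  exact Filter.Eventually.and (e.open_target.mem_nhds (e.map_source hy)) (hc.eventually h)

/-- The expression of a map between Riemann surfaces in the preferred charts at a point and at its
image. -/
def mapInCharts (g : Y → X) (y : Y) : ℂ → ℂ := chartAt ℂ (g y) ∘ g ∘ (chartAt ℂ y).symm

theorem mapInCharts_apply (g : Y → X) (y : Y) :
    mapInCharts g y (chartAt ℂ y y) = chartAt ℂ (g y) (g y) := by
  simp [mapInCharts]

theorem OneForm.IsHolomorphic.analyticAt_coeff {θ : OneForm Y} (hθ : θ.IsHolomorphic) (y : Y) :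
    AnalyticAt ℂ (θ.coeff (chartAt ℂ y)) (chartAt ℂ y y) :=
  (hθ _ (chart_mem_atlas ℂ y)).analyticAt
    ((chartAt ℂ y).open_target.mem_nhds (mem_chart_target ℂ y))

theorem QuadraticDifferential.IsHolomorphic.analyticAt_coeff {Q : QuadraticDifferential X}
    (hQ : Q.IsHolomorphic) (x : X) : AnalyticAt ℂ (Q.coeff (chartAt ℂ x)) (chartAt ℂ x x) :=
  (hQ _ (chart_mem_atlas ℂ x)).analyticAt
    ((chartAt ℂ x).open_target.mem_nhds (mem_chart_target ℂ x))

variable {g : Y → X} {y : Y}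

/-- A set of points near `y` on which the chart expression of `g` describes `g`. -/
theorem exists_nhds_mapInCharts (hg : ContinuousAt g y) {N : Set Y} (hN : N ∈ 𝓝 y) :
    ∃ U ∈ 𝓝 (chartAt ℂ y y), ∀ z ∈ U, z ∈ (chartAt ℂ y).target ∧ (chartAt ℂ y).symm z ∈ N ∧
      g ((chartAt ℂ y).symm z) ∈ (chartAt ℂ (g y)).source := by
  have h1 := hg.eventually
    ((chartAt ℂ (g y)).open_source.mem_nhds (mem_chart_source ℂ (g y)))
  exact ⟨_, eventually_symm_of_eventually (mem_chart_source ℂ y) (Filter.Eventually.and hN h1),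
    fun z hz => hz⟩

variable [IsManifold 𝓘(ℂ) 1 X] [IsManifold 𝓘(ℂ) 1 Y]

theorem analyticAt_mapInCharts (hg : ∀ᶠ y' in 𝓝 y, MDifferentiableAt 𝓘(ℂ) 𝓘(ℂ) g y') :
    AnalyticAt ℂ (mapInCharts g y) (chartAt ℂ y y) := by
  rw [Complex.analyticAt_iff_eventually_differentiableAt]
  have h1 := hg.self_of_nhds.continuousAt.eventually
    ((chartAt ℂ (g y)).open_source.mem_nhds (mem_chart_source ℂ (g y)))
  filter_upwards [eventually_symm_of_eventually (mem_chart_source ℂ y) (hg.and h1)] with z hz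
  have := (mdifferentiableAt_iff_chart (chart_mem_atlas ℂ y) ((chartAt ℂ y).map_target hz.1)
    (chart_mem_atlas ℂ (g y)) hz.2.1.continuousAt hz.2.2).1 hz.2.1
  rwa [(chartAt ℂ y).right_inv hz.1] at this

theorem deriv_mapInCharts {z : ℂ} (hz : z ∈ (chartAt ℂ y).target)
    (hg : MDifferentiableAt 𝓘(ℂ) 𝓘(ℂ) g ((chartAt ℂ y).symm z))
    (hgz : g ((chartAt ℂ y).symm z) ∈ (chartAt ℂ (g y)).source) :
    deriv (mapInCharts g y) z = cderiv (chartAt ℂ (g y)) (g ((chartAt ℂ y).symm z)) *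
      (cderiv g ((chartAt ℂ y).symm z) * cderiv (chartAt ℂ y).symm z) := by
  have h1 := mdifferentiableAt_atlas_symm (I := 𝓘(ℂ)) (chart_mem_atlas ℂ y) hz
  have h2 := mdifferentiableAt_atlas (I := 𝓘(ℂ)) (chart_mem_atlas ℂ (g y)) hgz
  rw [← cderiv_eq_deriv, mapInCharts, ← cderiv_comp hg h1]
  exact cderiv_comp h2 (hg.comp _ h1)

theorem deriv_mapInCharts_self (hg : MDifferentiableAt 𝓘(ℂ) 𝓘(ℂ) g y) :
    deriv (mapInCharts g y) (chartAt ℂ y y) = cderiv (chartAt ℂ (g y)) (g y) *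
      (cderiv g y * cderiv (chartAt ℂ y).symm (chartAt ℂ y y)) := by
  have h := (chartAt ℂ y).left_inv (mem_chart_source ℂ y)
  have := deriv_mapInCharts (g := g) (mem_chart_target ℂ y) (by rwa [h]) (by rw [h]; exact mem_chart_source ℂ _)
  rwa [h] at this

theorem deriv_mapInCharts_self_eq_zero_iff (hg : MDifferentiableAt 𝓘(ℂ) 𝓘(ℂ) g y) :
    deriv (mapInCharts g y) (chartAt ℂ y y) = 0 ↔ cderiv g y = 0 := by
  rw [deriv_mapInCharts_self hg]
  simp [cderiv_chart_ne_zero (chart_mem_atlas ℂ (g y)) (mem_chart_source ℂ (g y)),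
    cderiv_symm_ne_zero (chart_mem_atlas ℂ y) (mem_chart_target ℂ y)]

theorem cderiv_ne_zero_of_injOn (hg : ∀ᶠ y' in 𝓝 y, MDifferentiableAt 𝓘(ℂ) 𝓘(ℂ) g y')
    {N : Set Y} (hN : N ∈ 𝓝 y) (hinj : InjOn g N) : cderiv g y ≠ 0 := by
  rw [Ne, ← deriv_mapInCharts_self_eq_zero_iff hg.self_of_nhds]
  obtain ⟨U, hU, hUN⟩ := exists_nhds_mapInCharts hg.self_of_nhds.continuousAt hN
  refine deriv_ne_zero_of_injOn (analyticAt_mapInCharts hg) hU fun a ha b hb hab => ?_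
  have h1 := (chartAt ℂ (g y)).injOn (hUN a ha).2.2 (hUN b hb).2.2 hab
  exact (chartAt ℂ y).symm.injOn (hUN a ha).1 (hUN b hb).1
    (hinj (hUN a ha).2.1 (hUN b hb).2.1 h1)

theorem exists_nhds_injOn_of_cderiv_ne_zero
    (hg : ∀ᶠ y' in 𝓝 y, MDifferentiableAt 𝓘(ℂ) 𝓘(ℂ) g y') (h : cderiv g y ≠ 0) :
    ∃ N ∈ 𝓝 y, InjOn g N := by
  rw [Ne, ← deriv_mapInCharts_self_eq_zero_iff hg.self_of_nhds] at h
  obtain ⟨w, hw, hz, -⟩ := exists_openPartialHomeomorph_of_deriv_ne_zero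
    (analyticAt_mapInCharts hg) h univ_mem
  have hc := (chartAt ℂ y).continuousAt (mem_chart_source ℂ y)
  refine ⟨_, Filter.inter_mem ((chartAt ℂ y).open_source.mem_nhds (mem_chart_source ℂ y))
    (hc.eventually (w.open_source.mem_nhds hz)), fun a ha b hb hab => ?_⟩
  refine (chartAt ℂ y).injOn ha.1 hb.1 (w.injOn ha.2 hb.2 ?_)
  rw [hw]
  simp only [mapInCharts, Function.comp, (chartAt ℂ y).left_inv ha.1,
    (chartAt ℂ y).left_inv hb.1, hab]

end ChartExpressions

/-! ### Branching of the covering and order of the zeros of `ω`. -/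

section HitchinLocal

open Filter

variable {X Y : Type*} [TopologicalSpace X] [ChartedSpace ℂ X] [TopologicalSpace Y]
  [ChartedSpace ℂ Y] {Q : QuadraticDifferential X}

namespace HitchinCovering

variable (H : HitchinCovering Q Y) [IsManifold 𝓘(ℂ) 1 X] [IsManifold 𝓘(ℂ) 1 Y]

theorem coeff_omega_sq {y : Y} {z : ℂ} (hz : z ∈ (chartAt ℂ y).target)
    (hyz : H.proj ((chartAt ℂ y).symm z) ∈ (chartAt ℂ (H.proj y)).source) :
    H.omega.coeff (chartAt ℂ y) z ^ 2 =
      Q.coeff (chartAt ℂ (H.proj y)) (mapInCharts H.proj y z) *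
        deriv (mapInCharts H.proj y) z ^ 2 := by
  have h2 : (chartAt ℂ (H.proj y)).symm (mapInCharts H.proj y z) =
      H.proj ((chartAt ℂ y).symm z) := (chartAt ℂ (H.proj y)).left_inv hyz
  rw [OneForm.coeff_eq, QuadraticDifferential.coeff_eq, omega_apply_one, h2, ← H.rootValue_sq,
    deriv_mapInCharts hz (H.mdifferentiable_proj _) hyz]
  have h3 := cderiv_symm_mul_cderiv (chart_mem_atlas ℂ (H.proj y)) hyz
  change cderiv (chartAt ℂ (H.proj y)).symm (mapInCharts H.proj y z) * _ = 1 at h3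
  set a := cderiv (chartAt ℂ (H.proj y)).symm (mapInCharts H.proj y z)
  set b := cderiv (chartAt ℂ (H.proj y)) (H.proj ((chartAt ℂ y).symm z))
  linear_combination (-(cderiv (chartAt ℂ y).symm z ^ 2 *
    H.rootValue ((chartAt ℂ y).symm z) ^ 2 * cderiv H.proj ((chartAt ℂ y).symm z) ^ 2 *
    (1 + a * b))) * h3

variable [T2Space Y] (hσ : Continuous H.invol)
include hσ

/-- Such a point differs from its image under the involution, and the two have disjoint
neighbourhoods; so the projection is injective near `y`. -/
theorem cderiv_proj_ne_zero {y : Y} (hy : H.rootValue y ≠ 0) : cderiv H.proj y ≠ 0 := by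
  obtain ⟨U, V, hU, hV, hyU, hyV, hUV⟩ :=
    t2_separation (Ne.symm (H.invol_eq_self_iff.not.2 hy))
  have hN : U ∩ H.invol ⁻¹' V ∈ 𝓝 y := inter_mem (hU.mem_nhds hyU)
    (hσ.continuousAt.eventually (hV.mem_nhds hyV))
  refine cderiv_ne_zero_of_injOn (Eventually.of_forall H.mdifferentiable_proj) hN
    fun a ha b hb hab => ?_
  rcases H.eq_or_eq_invol hab with h | h
  · exact h.symm
  · exact (disjoint_left.1 hUV hb.1 (h ▸ ha.2)).elim

-- Fibres are orbits of the involution, so they have at most two points, and a map of order `n` has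
-- nearby fibres of `n` points: `n ≤ 2`. For `n = 1` the projection would be injective near `y`, the
-- involution would be the identity there, and `Q` would vanish on an open set, contrary to the
-- simplicity of its zero.
omit [T2Space Y] in
theorem analyticOrderAt_proj (hQ : Q.IsHolomorphic) (hQ0 : Q.HasOnlySimpleZeros) {y : Y}
    (hy : H.rootValue y = 0) :
    analyticOrderAt (fun z => mapInCharts H.proj y z - mapInCharts H.proj y (chartAt ℂ y y))
      (chartAt ℂ y y) = 2 := by
  have hmd : ∀ᶠ y' in 𝓝 y, MDifferentiableAt 𝓘(ℂ) 𝓘(ℂ) H.proj y' :=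
    Eventually.of_forall H.mdifferentiable_proj
  have han := analyticAt_mapInCharts hmd
  have hσy := H.invol_eq_self_iff.2 hy
  have hc := (H.mdifferentiable_proj y).continuousAt
  set P := mapInCharts H.proj y with hP
  set z₀ := chartAt ℂ y y with hz₀
  obtain ⟨U, hU, hUN⟩ := exists_nhds_mapInCharts hc univ_mem
  have hfib : ∀ a ∈ U, ∀ b ∈ U, P a = P b →
      H.proj ((chartAt ℂ y).symm a) = H.proj ((chartAt ℂ y).symm b) := fun a ha b hb hab =>
    (chartAt ℂ (H.proj y)).injOn (hUN a ha).2.2 (hUN b hb).2.2 hab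
  have htop : analyticOrderAt (fun z => P z - P z₀) z₀ ≠ ⊤ := by
    rw [Ne, analyticOrderAt_eq_top]
    intro h
    obtain ⟨z, ⟨hz, hzU⟩, hne⟩ :=
      ((h.and hU).filter_mono nhdsWithin_le_nhds |>.and self_mem_nhdsWithin :
        ∀ᶠ z in 𝓝[≠] z₀, _).exists
    have h1 := hfib z₀ (mem_of_mem_nhds hU) z hzU (sub_eq_zero.1 hz).symm
    have h2 : (chartAt ℂ y).symm z₀ = y := (chartAt ℂ y).left_inv (mem_chart_source ℂ y)
    rw [h2] at h1
    have h3 : (chartAt ℂ y).symm z = y := by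
      rcases H.eq_or_eq_invol h1 with h | h
      · exact h
      · rw [h, hσy]
    exact hne ((chartAt ℂ y).symm.injOn (hUN z hzU).1 (mem_chart_target ℂ y) (h3.trans h2.symm))
  obtain ⟨n, hn⟩ := ENat.ne_top_iff_exists.1 htop
  have hn0 : n ≠ 0 := by
    rintro rfl
    have := analyticOrderAt_eq_zero.1 hn.symm
    rcases this with h | h
    · exact h (han.sub analyticAt_const)
    · exact h (sub_self _)
  have hn1 : n ≠ 1 := by
    rintro rfl
    have h0 : deriv P z₀ ≠ 0 := by
      have h1 := han.analyticOrderAt_deriv_add_one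
      rw [← hn] at h1
      have h2 : analyticOrderAt (deriv P) z₀ = 0 := by
        have : analyticOrderAt (deriv P) z₀ + 1 = 0 + 1 := by rw [h1]; simp
        exact WithTop.add_right_cancel ENat.one_ne_top this
      rcases analyticOrderAt_eq_zero.1 h2 with h | h
      · exact (h han.deriv).elim
      · exact h
    have h1 := h0
    rw [hP, hz₀, Ne, deriv_mapInCharts_self_eq_zero_iff hmd.self_of_nhds] at h1
    obtain ⟨N, hN, hinj⟩ := exists_nhds_injOn_of_cderiv_ne_zero hmd h1
    have hroot : ∀ᶠ y' in 𝓝 y, H.rootValue y' = 0 := by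
      have hc : ContinuousAt H.invol y := hσ.continuousAt
      rw [ContinuousAt, hσy] at hc
      filter_upwards [hN, hc.eventually hN] with y' hy' hy''
      exact H.invol_eq_self_iff.1 (hinj hy'' hy' (H.proj_invol y'))
    have hcomp : (Q.coeff (chartAt ℂ (H.proj y)) ∘ P) =ᶠ[𝓝 z₀] fun _ => 0 := by
      filter_upwards [eventually_symm_of_eventually (mem_chart_source ℂ y) hroot, hU] with z hz hzU
      have h2 : (chartAt ℂ (H.proj y)).symm (P z) = H.proj ((chartAt ℂ y).symm z) :=
        (chartAt ℂ (H.proj y)).left_inv (hUN z hzU).2.2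
      rw [Function.comp, QuadraticDifferential.coeff_eq, h2, ← H.rootValue_sq, hz.2]
      simp
    have hPz : P z₀ = chartAt ℂ (H.proj y) (H.proj y) := mapInCharts_apply _ _
    have hd := (hQ.analyticAt_coeff (H.proj y)).differentiableAt
    rw [← hPz] at hd
    have h3 := hd.hasDerivAt.comp z₀ han.differentiableAt.hasDerivAt
    have h4 := h3.unique ((hasDerivAt_const z₀ (0 : ℂ)).congr_of_eventuallyEq hcomp)
    refine mul_ne_zero ?_ h0 h4
    rw [hPz]
    refine hQ0 _ ((Q.eq_zero_iff _).2 ?_)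
    rw [← H.rootValue_sq, hy]
    simp
  -- Of three distinct points of a fibre, two would both be the image of the third under the
  -- involution.
  have hn3 : ¬ 3 ≤ n := fun h3 => by
    obtain ⟨p, hp, hpU, hpP⟩ := exists_injective_fiber_of_analyticOrderAt han hn0 hn.symm hU
    have key : ∀ i j, i ≠ j → (chartAt ℂ y).symm (p j) = H.invol ((chartAt ℂ y).symm (p i)) := by
      intro i j hij
      refine (H.eq_or_eq_invol (hfib _ (hpU i) _ (hpU j) (hpP i j))).resolve_left fun h => ?_
      exact hij (hp ((chartAt ℂ y).symm.injOn (hUN _ (hpU j)).1 (hUN _ (hpU i)).1 h)).symm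
    have h12 := (key ⟨0, by omega⟩ ⟨1, by omega⟩ (by simp)).trans
      (key ⟨0, by omega⟩ ⟨2, by omega⟩ (by simp)).symm
    have := hp ((chartAt ℂ y).symm.injOn (hUN _ (hpU _)).1 (hUN _ (hpU _)).1 h12)
    simp at this
  have : n = 2 := by omega
  rw [← hn, this]
  rfl

theorem coeff_omega_ne_zero {y : Y} (hy : H.rootValue y ≠ 0) :
    H.omega.coeff (chartAt ℂ y) (chartAt ℂ y y) ≠ 0 := by
  rw [OneForm.coeff_eq, (chartAt ℂ y).left_inv (mem_chart_source ℂ y), omega_apply_one]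
  exact mul_ne_zero (cderiv_symm_ne_zero (chart_mem_atlas ℂ y) (mem_chart_target ℂ y))
    (mul_ne_zero hy (H.cderiv_proj_ne_zero hσ hy))

-- Count orders in `ω² = π^*Q`: the right-hand side is `(Q ∘ π) * π' ^ 2`, of order `1 * 2 + 2 * 1 =
-- 4`.
omit [T2Space Y] in
theorem analyticOrderAt_coeff_omega (hQ : Q.IsHolomorphic) (hQ0 : Q.HasOnlySimpleZeros) {y : Y}
    (hy : H.rootValue y = 0) :
    analyticOrderAt (H.omega.coeff (chartAt ℂ y)) (chartAt ℂ y y) = 2 := by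
  have hmd : ∀ᶠ y' in 𝓝 y, MDifferentiableAt 𝓘(ℂ) 𝓘(ℂ) H.proj y' :=
    Eventually.of_forall H.mdifferentiable_proj
  have han := analyticAt_mapInCharts hmd
  have hord := H.analyticOrderAt_proj hσ hQ hQ0 hy
  have hω : AnalyticAt ℂ (H.omega.coeff (chartAt ℂ y)) (chartAt ℂ y y) :=
    OneForm.IsHolomorphic.analyticAt_coeff H.isHolomorphic_omega y
  have hq := hQ.analyticAt_coeff (H.proj y)
  have hq1 : analyticOrderAt (Q.coeff (chartAt ℂ (H.proj y)))
      (chartAt ℂ (H.proj y) (H.proj y)) = 1 := by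
    have hz : Q (H.proj y) (1 : ℂ) (1 : ℂ) = 0 := by rw [← H.rootValue_sq, hy]; simp
    refine hq.analyticOrderAt_eq_one_of_zero_deriv_ne_zero ?_ (hQ0 _ ((Q.eq_zero_iff _).2 hz))
    rw [QuadraticDifferential.coeff_eq,
      (chartAt ℂ (H.proj y)).left_inv (mem_chart_source ℂ _), hz, mul_zero]
  rw [← mapInCharts_apply] at hq hq1
  have hd1 : analyticOrderAt (deriv (mapInCharts H.proj y)) (chartAt ℂ y y) = 1 := by
    have h1 := han.analyticOrderAt_deriv_add_one
    rw [hord] at h1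
    exact WithTop.add_right_cancel ENat.one_ne_top
      (h1.trans (by norm_num : (2 : ℕ∞) = 1 + 1))
  have hev : H.omega.coeff (chartAt ℂ y) ^ 2 =ᶠ[𝓝 (chartAt ℂ y y)]
      (Q.coeff (chartAt ℂ (H.proj y)) ∘ mapInCharts H.proj y) *
        deriv (mapInCharts H.proj y) ^ 2 := by
    obtain ⟨U, hU, hUN⟩ := exists_nhds_mapInCharts (H.mdifferentiable_proj y).continuousAt univ_mem
    filter_upwards [hU] with z hz
    exact H.coeff_omega_sq (hUN z hz).1 (hUN z hz).2.2
  have h := analyticOrderAt_congr hev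
  rw [analyticOrderAt_pow hω, analyticOrderAt_mul (hq.comp han) (han.deriv.pow 2),
    analyticOrderAt_pow han.deriv, hq.analyticOrderAt_comp han, hq1, hd1, hord] at h
  rcases hn : analyticOrderAt (H.omega.coeff (chartAt ℂ y)) (chartAt ℂ y y) with _ | n
  · rw [hn] at h
    exact absurd h (by decide)
  · rw [hn] at h
    have h2 : 2 * n = 4 := by
      have : ((2 * n : ℕ) : ℕ∞) = (4 : ℕ) := by
        rw [Nat.cast_mul]
        refine Eq.trans ?_ (h.trans (by norm_num))
        simp
        rfl
      exact_mod_cast this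
    have : n = 2 := by omega
    rw [this]
    rfl

end HitchinCovering

end HitchinLocal

/-! ### From holomorphic coefficients to derivatives on the surface. -/

section HolomorphicPrimitives

variable {Y : Type*} [TopologicalSpace Y] [ChartedSpace ℂ Y]

theorem ContMDiffAt.restrictScalarsReal {X : Type*} [TopologicalSpace X] [ChartedSpace ℂ X]
    {g : X → Y} {x : X} {n : WithTop ℕ∞} (h : ContMDiffAt 𝓘(ℂ) 𝓘(ℂ) n g x) :
    ContMDiffAt 𝓘(ℝ, ℂ) 𝓘(ℝ, ℂ) n g x := by
  rw [contMDiffAt_iff] at h ⊢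
  exact ⟨h.1, h.2.restrict_scalars ℝ⟩

theorem OneForm.hasMFDerivAt_of_hasDerivAt_coeff [IsManifold 𝓘(ℂ) 1 Y] (θ : OneForm Y)
    {e : OpenPartialHomeomorph Y ℂ} (he : e ∈ atlas ℂ Y) {y : Y} (hy : y ∈ e.source) {G : ℂ → ℂ}
    (hG : HasDerivAt G (θ.coeff e (e y)) (e y)) :
    HasMFDerivAt 𝓘(ℂ) 𝓘(ℂ) (G ∘ e) y (θ y (1 : ℂ) • ContinuousLinearMap.id ℂ ℂ) := by
  have h1 := (mdifferentiableAt_atlas (I := 𝓘(ℂ)) he hy).hasMFDerivAt_cderiv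
  have h2 := (hasMFDerivAt_iff_hasFDerivAt.2 hG.hasFDerivAt).comp y h1
  refine h2.congr_mfderiv (ContinuousLinearMap.ext fun (v : ℂ) => ?_)
  change (cderiv e y * v) * θ.coeff e (e y) = θ y (1 : ℂ) * v
  rw [OneForm.coeff_eq, e.left_inv hy]
  linear_combination (v * θ y (1 : ℂ)) * cderiv_symm_mul_cderiv he hy

/-- The composition of a chart of a Riemann surface and of a holomorphic coordinate change. -/
theorem contMDiffAt_symm_of_analyticAt [IsManifold 𝓘(ℂ) 1 Y] {y : Y}
    {g : OpenPartialHomeomorph ℂ ℂ} (hy : chartAt ℂ y y ∈ g.source)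
    (hg : ∀ z ∈ g.target, AnalyticAt ℂ g.symm z) :
    ContMDiffAt 𝓘(ℝ, ℂ) 𝓘(ℝ, ℂ) 1 ((chartAt ℂ y).trans g).symm
      ((chartAt ℂ y).trans g y) := by
  refine ContMDiffAt.restrictScalarsReal ?_
  have h1 : ContMDiffAt 𝓘(ℂ) 𝓘(ℂ) 1 g.symm (g (chartAt ℂ y y)) :=
    ((hg _ (g.map_source hy)).contDiffAt).contMDiffAt
  have h2 : ContMDiffAt 𝓘(ℂ) 𝓘(ℂ) 1 (chartAt ℂ y).symm (g.symm (g (chartAt ℂ y y))) := by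
    rw [g.left_inv hy]
    exact (contMDiffOn_chart_symm (I := 𝓘(ℂ)) (x := y)).contMDiffAt
      ((chartAt ℂ y).open_target.mem_nhds (mem_chart_target ℂ y))
  exact h2.comp _ h1

end HolomorphicPrimitives

/-! ### Pull-back of holomorphic forms to the fixed real surface. -/

section PullBack

variable {S Y : Type*} [TopologicalSpace S] [ChartedSpace ℂ S] [TopologicalSpace Y]
  [ChartedSpace ℂ Y] (Φ : S ≃ₘ^∞⟮𝓘(ℝ, ℂ), 𝓘(ℝ, ℂ)⟯ Y)

/-- The pull-back of a one-form on a Riemann surface to a real surface. -/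
def pullForm (θ : OneForm Y) (p : S) : TangentSpace 𝓘(ℝ, ℂ) p →L[ℝ] ℂ :=
  ContinuousLinearMap.comp (M₁ := ℂ) (M₂ := ℂ) (realMul (θ (Φ p) (1 : ℂ)))
    (mfderiv 𝓘(ℝ, ℂ) 𝓘(ℝ, ℂ) Φ p)

theorem pullForm_apply (θ : OneForm Y) (p : S) (v : TangentSpace 𝓘(ℝ, ℂ) p) :
    pullForm Φ θ p v = θ (Φ p) (mfderiv 𝓘(ℝ, ℂ) 𝓘(ℝ, ℂ) Φ p v) := by
  exact (mul_comm (G := ℂ) _ _).trans (θ.apply_eq_mul (Φ p) _).symm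

theorem HasMFDerivAt.comp_pullForm {θ : OneForm Y} {G : Y → ℂ} {p : S}
    (hG : HasMFDerivAt 𝓘(ℂ) 𝓘(ℂ) G (Φ p) (θ (Φ p) (1 : ℂ) • ContinuousLinearMap.id ℂ ℂ)) :
    HasMFDerivAt 𝓘(ℝ, ℂ) 𝓘(ℝ, ℂ) (G ∘ Φ) p (pullForm Φ θ p) :=
  hG.restrictScalarsReal.comp p (Φ.contMDiff.mdifferentiable (by simp) p).hasMFDerivAt

/-- The derivative, transported to `Y`, is multiplication by a complex number. This is how complex
differentiability is recovered from a function known only on the real surface. -/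
theorem HasMFDerivAt.of_comp_pullForm {θ : OneForm Y} {G : S → ℂ} {y : Y}
    (hG : HasMFDerivAt 𝓘(ℝ, ℂ) 𝓘(ℝ, ℂ) G (Φ.symm y) (pullForm Φ θ (Φ.symm y))) :
    HasMFDerivAt 𝓘(ℂ) 𝓘(ℂ) (G ∘ Φ.symm) y (θ y (1 : ℂ) • ContinuousLinearMap.id ℂ ℂ) := by
  refine HasMFDerivAt.of_restrictScalarsReal ?_
  have hs := (Φ.symm.contMDiff.mdifferentiable (by simp) y)
  have hd : MDifferentiableAt 𝓘(ℝ, ℂ) 𝓘(ℝ, ℂ) Φ (Φ.symm y) :=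
    Φ.contMDiff.mdifferentiable (by simp) _
  refine (hG.comp y hs.hasMFDerivAt).congr_mfderiv (ContinuousLinearMap.ext fun (v : ℂ) => ?_)
  have h1 := mfderiv_comp y hd hs
  have h2 : (Φ ∘ Φ.symm : Y → Y) = id := funext Φ.apply_symm_apply
  rw [h2, mfderiv_id] at h1
  have h3 : mfderiv 𝓘(ℝ, ℂ) 𝓘(ℝ, ℂ) Φ (Φ.symm y) (mfderiv 𝓘(ℝ, ℂ) 𝓘(ℝ, ℂ) Φ.symm y v) = v :=
    (DFunLike.congr_fun h1 v).symm
  change pullForm Φ θ (Φ.symm y) (mfderiv 𝓘(ℝ, ℂ) 𝓘(ℝ, ℂ) Φ.symm y v) = θ y (1 : ℂ) * v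
  rw [pullForm_apply, h3, Φ.apply_symm_apply, OneForm.apply_eq_mul, mul_comm]

/-- A coordinate of the Riemann surface, as a coordinate of the real surface. -/
def pullCoordinate (p : S) (g : OpenPartialHomeomorph ℂ ℂ) : OpenPartialHomeomorph S ℂ :=
  Φ.toHomeomorph.transOpenPartialHomeomorph ((chartAt ℂ (Φ p)).trans g)

theorem mem_pullCoordinate_source {p q : S} {g : OpenPartialHomeomorph ℂ ℂ} :
    q ∈ (pullCoordinate Φ p g).source ↔
      Φ q ∈ (chartAt ℂ (Φ p)).source ∧ chartAt ℂ (Φ p) (Φ q) ∈ g.source := by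
  simp [pullCoordinate]

variable [IsManifold 𝓘(ℂ) 1 Y] {θ : OneForm Y}

theorem OneForm.IsHolomorphic.exists_primitive_pullForm (hθ : θ.IsHolomorphic) (p : S) :
    ∃ k : ℂ → ℂ, ∀ᶠ q in 𝓝 p,
      HasDerivAt k (θ.coeff (chartAt ℂ (Φ p)) (chartAt ℂ (Φ p) (Φ q))) (chartAt ℂ (Φ p) (Φ q)) ∧
      HasMFDerivAt 𝓘(ℝ, ℂ) 𝓘(ℝ, ℂ) (k ∘ chartAt ℂ (Φ p) ∘ Φ) q (pullForm Φ θ q) := by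
  obtain ⟨k, -, -, hk⟩ := exists_primitive_of_analyticAt (hθ.analyticAt_coeff (Φ p))
  refine ⟨k, ?_⟩
  have hc := Φ.continuous.continuousAt (x := p)
  have hsrc := hc.eventually ((chartAt ℂ (Φ p)).open_source.mem_nhds (mem_chart_source ℂ (Φ p)))
  filter_upwards [hsrc,
    (((chartAt ℂ (Φ p)).continuousAt (mem_chart_source ℂ (Φ p))).comp hc).eventually hk] with q h1 h2
  exact ⟨h2, HasMFDerivAt.comp_pullForm Φ
    (θ.hasMFDerivAt_of_hasDerivAt_coeff (chart_mem_atlas ℂ (Φ p)) h1 h2)⟩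

theorem OneForm.IsHolomorphic.exists_isPrimitiveAt (hθ : θ.IsHolomorphic) (p : S) :
    ∃ G, IsPrimitiveAt (pullForm Φ θ) G p := by
  obtain ⟨k, hk⟩ := hθ.exists_primitive_pullForm Φ p
  exact ⟨_, hk.mono fun q hq => hq.2⟩

theorem contMDiffAt_pullCoordinate_symm {p : S} {g : OpenPartialHomeomorph ℂ ℂ}
    (hp : chartAt ℂ (Φ p) (Φ p) ∈ g.source) (hg : ∀ z ∈ g.target, AnalyticAt ℂ g.symm z) :
    ContMDiffAt 𝓘(ℝ, ℂ) 𝓘(ℝ, ℂ) 1 (pullCoordinate Φ p g).symm (pullCoordinate Φ p g p) := by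
  have h1 := contMDiffAt_symm_of_analyticAt hp hg
  have h2 : ContMDiff 𝓘(ℝ, ℂ) 𝓘(ℝ, ℂ) 1 Φ.symm := Φ.symm.contMDiff.of_le (by simp)
  exact h2.contMDiffAt.comp _ h1

theorem OneForm.IsHolomorphic.exists_pullCoordinate_of_ne_zero (hθ : θ.IsHolomorphic) {p : S}
    (h0 : θ.coeff (chartAt ℂ (Φ p)) (chartAt ℂ (Φ p) (Φ p)) ≠ 0) :
    ∃ w : OpenPartialHomeomorph S ℂ, p ∈ w.source ∧
      (∀ q ∈ w.source, θ (Φ q) (1 : ℂ) ≠ 0 ∧ IsPrimitiveAt (pullForm Φ θ) w q) ∧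
      ContMDiffAt 𝓘(ℝ, ℂ) 𝓘(ℝ, ℂ) 1 w.symm (w p) := by
  obtain ⟨g, hz, -, hg, hgs⟩ := exists_coordinate_of_ne_zero (hθ.analyticAt_coeff (Φ p)) h0
    Filter.univ_mem
  refine ⟨pullCoordinate Φ p g, (mem_pullCoordinate_source Φ).2 ⟨mem_chart_source ℂ _, hz⟩,
    fun q hq => ⟨fun h => ?_, ?_⟩, contMDiffAt_pullCoordinate_symm Φ hz hgs⟩
  · have hq' := (mem_pullCoordinate_source Φ).1 hq
    refine (hg _ hq'.2).1 ?_
    rw [OneForm.coeff_eq, (chartAt ℂ (Φ p)).left_inv hq'.1, h, mul_zero]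
  · filter_upwards [(pullCoordinate Φ p g).open_source.mem_nhds hq] with q' hq'
    have hq'' := (mem_pullCoordinate_source Φ).1 hq'
    exact HasMFDerivAt.comp_pullForm Φ (θ.hasMFDerivAt_of_hasDerivAt_coeff
      (chart_mem_atlas ℂ (Φ p)) hq''.1 (hg _ hq''.2).2)

theorem OneForm.IsHolomorphic.exists_pullCoordinate_of_order_two (hθ : θ.IsHolomorphic) {p : S}
    (h2 : analyticOrderAt (θ.coeff (chartAt ℂ (Φ p))) (chartAt ℂ (Φ p) (Φ p)) = 2) :
    ∃ w : OpenPartialHomeomorph S ℂ, p ∈ w.source ∧ w p = 0 ∧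
      (∀ q ∈ w.source, (θ (Φ q) (1 : ℂ) = 0 → q = p) ∧
        IsPrimitiveAt (pullForm Φ θ) (fun q => w q ^ 3) q) ∧
      ContMDiffAt 𝓘(ℝ, ℂ) 𝓘(ℝ, ℂ) 1 w.symm (w p) := by
  obtain ⟨g, hz, hz0, -, hg, hgs⟩ := exists_coordinate_of_order_two (hθ.analyticAt_coeff (Φ p)) h2
    Filter.univ_mem
  have hp : p ∈ (pullCoordinate Φ p g).source :=
    (mem_pullCoordinate_source Φ).2 ⟨mem_chart_source ℂ _, hz⟩
  refine ⟨pullCoordinate Φ p g, hp, hz0, fun q hq => ⟨fun h => ?_, ?_⟩,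
    contMDiffAt_pullCoordinate_symm Φ hz hgs⟩
  · have hq' := (mem_pullCoordinate_source Φ).1 hq
    have h3 := (hg _ hq'.2).1 (by
      rw [OneForm.coeff_eq, (chartAt ℂ (Φ p)).left_inv hq'.1, h, mul_zero])
    exact Φ.injective ((chartAt ℂ (Φ p)).injOn hq'.1 (mem_chart_source ℂ _) h3)
  · filter_upwards [(pullCoordinate Φ p g).open_source.mem_nhds hq] with q' hq'
    have hq'' := (mem_pullCoordinate_source Φ).1 hq'
    exact HasMFDerivAt.comp_pullForm Φ (θ.hasMFDerivAt_of_hasDerivAt_coeff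
      (chart_mem_atlas ℂ (Φ p)) hq''.1 (hg _ hq''.2).2)

/-- In charts the pull-back is `h (ψ x)` times the derivative of the identification `ψ`. That
derivative is bounded and `ψ` is differentiable, so the second order zero of `h` survives although
`ψ` is not holomorphic. -/
theorem OneForm.IsHolomorphic.formInChart_isBigO [IsManifold 𝓘(ℝ, ℂ) ∞ S] (hθ : θ.IsHolomorphic)
    {p : S} (h2 : analyticOrderAt (θ.coeff (chartAt ℂ (Φ p))) (chartAt ℂ (Φ p) (Φ p)) = 2) :
    formInChart (pullForm Φ θ) (chartAt ℂ p) =O[𝓝 (chartAt ℂ p p)]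
      fun x => ‖x - chartAt ℂ p p‖ ^ 2 := by
  set e := chartAt ℂ p with he
  set f := chartAt ℂ (Φ p) with hf
  set h := θ.coeff f with hh
  have heA : e ∈ atlas ℂ S := chart_mem_atlas ℂ p
  have hpe : p ∈ e.source := mem_chart_source ℂ p
  set ψ : ℂ → ℂ := f ∘ Φ ∘ e.symm with hψ
  have hψp : ψ (e p) = f (Φ p) := by simp [hψ, e.left_inv hpe]
  have hψs : ContDiffAt ℝ 1 ψ (e p) := by
    rw [← contMDiffAt_iff_contDiffAt]
    have hΦ : ContMDiff 𝓘(ℝ, ℂ) 𝓘(ℝ, ℂ) 1 Φ := Φ.contMDiff.of_le (by simp)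
    have h1 : ContMDiffAt 𝓘(ℝ, ℂ) 𝓘(ℝ, ℂ) 1 e.symm (e p) :=
      ((contMDiffOn_chart_symm (I := 𝓘(ℝ, ℂ)) (n := ∞) (x := p)).contMDiffAt
        (e.open_target.mem_nhds (e.map_source hpe))).of_le (by simp)
    have h3 : ContMDiffAt 𝓘(ℝ, ℂ) 𝓘(ℝ, ℂ) 1 f (Φ (e.symm (e p))) := by
      rw [e.left_inv hpe]
      refine ContMDiffAt.restrictScalarsReal ?_
      exact contMDiffAt_of_mem_maximalAtlas (IsManifold.chart_mem_maximalAtlas (Φ p))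
        (mem_chart_source ℂ (Φ p))
    have h4 : ContMDiffAt 𝓘(ℝ, ℂ) 𝓘(ℝ, ℂ) 1 (Φ ∘ e.symm) (e p) :=
      (hΦ.contMDiffAt (x := e.symm (e p))).comp (e p) h1
    exact h3.comp (e p) h4
  have hψd : ∀ᶠ x in 𝓝 (e p), DifferentiableAt ℝ ψ x :=
    (hψs.eventually (by simp)).mono fun x hx => hx.differentiableAt (by simp)
  have hD : fderiv ℝ ψ =O[𝓝 (e p)] fun _ => (1 : ℝ) :=
    (hψs.fderiv_right (m := 0) (by norm_num)).continuousAt.isBigO_one ℝ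
  have hψO : (fun x => ψ x - f (Φ p)) =O[𝓝 (e p)] fun x => x - e p := by
    rw [← hψp]
    exact hψd.self_of_nhds.isBigO_sub
  obtain ⟨k, hk⟩ := hθ.exists_primitive_pullForm Φ p
  have hform : ∀ᶠ x in 𝓝 (e p), formInChart (pullForm Φ θ) e x =
      (realMul (h (ψ x))).comp (fderiv ℝ ψ x) := by
    filter_upwards [eventually_symm_of_eventually hpe hk, hψd] with x hx hxd
    have h1 := hx.2.2.hasFDerivAt_inChart heA hx.1
    refine h1.unique ?_
    have h2 : HasFDerivAt k (realMul (h (ψ x))) (ψ x) := by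
      refine (hx.2.1.hasFDerivAt.restrictScalars ℝ).congr_fderiv
        (ContinuousLinearMap.ext fun v => ?_)
      exact mul_comm v _
    exact h2.comp x hxd.hasFDerivAt
  have hhO : h =O[𝓝 (f (Φ p))] fun z => ‖z - f (Φ p)‖ ^ 2 := by
    obtain ⟨g, hg, -, hev⟩ := (AnalyticAt.analyticOrderAt_eq_natCast (n := 2)
      (hθ.analyticAt_coeff (Φ p))).1 h2
    refine (Asymptotics.isBigO_congr hev Filter.EventuallyEq.rfl).2 ?_
    have := (Asymptotics.isBigO_refl (fun z => (z - f (Φ p)) ^ 2) (𝓝 (f (Φ p)))).smul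
      (hg.continuousAt.isBigO_one ℂ)
    refine this.trans (Asymptotics.IsBigO.of_bound 1 (Filter.Eventually.of_forall fun z => ?_))
    simp
  have hψt : Filter.Tendsto ψ (𝓝 (e p)) (𝓝 (f (Φ p))) := by
    rw [← hψp]
    exact hψs.continuousAt
  have h5 : (fun x => h (ψ x)) =O[𝓝 (e p)] fun x => ‖x - e p‖ ^ 2 :=
    (hhO.comp_tendsto hψt).trans (hψO.norm_norm.pow 2)
  refine (Asymptotics.isBigO_congr hform Filter.EventuallyEq.rfl).2 ?_
  refine Asymptotics.IsBigO.trans (Asymptotics.IsBigO.of_bound 1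
    (Filter.Eventually.of_forall fun x => ?_)) ((h5.norm_left.mul hD.norm_left).trans
      (Asymptotics.IsBigO.of_bound 1 (Filter.Eventually.of_forall fun x => by simp)))
  have hr : ‖realMul (h (ψ x))‖ ≤ ‖h (ψ x)‖ :=
    ContinuousLinearMap.opNorm_le_bound _ (norm_nonneg _) fun v => by simp
  calc ‖(realMul (h (ψ x))).comp (fderiv ℝ ψ x)‖ ≤ ‖realMul (h (ψ x))‖ * ‖fderiv ℝ ψ x‖ :=
        ContinuousLinearMap.opNorm_comp_le _ _
    _ ≤ ‖h (ψ x)‖ * ‖fderiv ℝ ψ x‖ := by gcongr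
    _ ≤ 1 * ‖‖h (ψ x)‖ * ‖fderiv ℝ ψ x‖‖ := by simp

end PullBack

/-! ### The involution on the fixed real surface. -/

section HitchinIdentified

open Filter

variable {X Y S : Type*} [TopologicalSpace X] [ChartedSpace ℂ X] [TopologicalSpace Y]
  [ChartedSpace ℂ Y] [TopologicalSpace S] [ChartedSpace ℂ S] {Q : QuadraticDifferential X}

namespace HitchinCovering

variable (H : HitchinCovering Q Y) (Φ : S ≃ₘ^∞⟮𝓘(ℝ, ℂ), 𝓘(ℝ, ℂ)⟯ Y) {σ : S → S}

theorem continuous_invol (hσ : Continuous σ) (hσΦ : ∀ p, Φ (σ p) = H.invol (Φ p)) :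
    Continuous H.invol := by
  have : H.invol = Φ ∘ σ ∘ Φ.symm := funext fun y => by
    rw [Function.comp, Function.comp, hσΦ, Φ.apply_symm_apply]
  rw [this]
  exact Φ.continuous.comp (hσ.comp Φ.symm.continuous)

theorem involutive_of_conj (hσΦ : ∀ p, Φ (σ p) = H.invol (Φ p)) (p : S) : σ (σ p) = p :=
  Φ.injective ((hσΦ _).trans ((congrArg H.invol (hσΦ p)).trans (H.invol_invol _)))

theorem fixed_iff_of_conj (hσΦ : ∀ p, Φ (σ p) = H.invol (Φ p)) (p : S) :
    σ p = p ↔ H.rootValue (Φ p) = 0 := by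
  rw [← H.invol_eq_self_iff, ← hσΦ]
  exact Φ.injective.eq_iff.symm

/-- The form is the root times the derivative of the projection. The involution changes the sign of
the first factor and preserves the projection. -/
theorem pullForm_omega_invol (hσ : ContMDiff 𝓘(ℝ, ℂ) 𝓘(ℝ, ℂ) ∞ σ)
    (hσΦ : ∀ p, Φ (σ p) = H.invol (Φ p)) (p : S) (v : TangentSpace 𝓘(ℝ, ℂ) p) :
    pullForm Φ H.omega (σ p) (mfderiv 𝓘(ℝ, ℂ) 𝓘(ℝ, ℂ) σ p v) = -pullForm Φ H.omega p v := by
  set D : ∀ p : S, ℂ →L[ℝ] ℂ := fun p => ContinuousLinearMap.comp (M₁ := ℂ) (M₂ := ℂ)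
    (realMul (cderiv H.proj (Φ p))) (mfderiv 𝓘(ℝ, ℂ) 𝓘(ℝ, ℂ) Φ p) with hD
  have hDer : ∀ p, HasMFDerivAt 𝓘(ℝ, ℂ) 𝓘(ℝ, ℂ) (H.proj ∘ Φ) p (D p) := fun p =>
    (H.mdifferentiable_proj (Φ p)).hasMFDerivAt_cderiv.restrictScalarsReal.comp p
      (Φ.contMDiff.mdifferentiable (by simp) p).hasMFDerivAt
  have hform : ∀ p (v : ℂ), pullForm Φ H.omega p v = H.rootValue (Φ p) * D p v := fun p v => by
    set u : ℂ := mfderiv 𝓘(ℝ, ℂ) 𝓘(ℝ, ℂ) Φ p v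
    change H.omega (Φ p) (1 : ℂ) * u = H.rootValue (Φ p) * (cderiv H.proj (Φ p) * u)
    rw [omega_apply_one, mul_assoc]
  have hcomp := (hDer (σ p)).comp p (hσ.mdifferentiable (by simp) p).hasMFDerivAt
  have hfun : (H.proj ∘ Φ) ∘ σ = H.proj ∘ Φ := funext fun q => by
    simp only [Function.comp, hσΦ, H.proj_invol]
  have key : ∀ (f g : S → X) (A B : ℂ →L[ℝ] ℂ), f = g → HasMFDerivAt 𝓘(ℝ, ℂ) 𝓘(ℝ, ℂ) f p A →
      HasMFDerivAt 𝓘(ℝ, ℂ) 𝓘(ℝ, ℂ) g p B → A = B := by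
    rintro f _ A B rfl h h'
    exact hasMFDerivAt_unique h h'
  have h1 : D (σ p) (mfderiv 𝓘(ℝ, ℂ) 𝓘(ℝ, ℂ) σ p v) = D p v :=
    DFunLike.congr_fun (key _ _ _ _ hfun hcomp (hDer p)) v
  refine (hform (σ p) _).trans (Eq.trans ?_ (congrArg Neg.neg (hform p v).symm))
  rw [hσΦ, H.rootValue_invol, neg_mul, ← h1]

end HitchinCovering

end HitchinIdentified

/-! ### The deformation defined by constant periods. -/

section Deformation

open Filter

variable {T : Type*} [TopologicalSpace T] [ChartedSpace ℝ T] [IsManifold 𝓘(ℝ, ℝ) ∞ T]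
  {S : Type*} [TopologicalSpace S] [ChartedSpace ℂ S] [IsManifold 𝓘(ℝ, ℂ) ∞ S]
  {X Y : T → Type*} [∀ t, TopologicalSpace (X t)] [∀ t, ChartedSpace ℂ (X t)]
  [∀ t, IsManifold 𝓘(ℂ) 1 (X t)] [∀ t, TopologicalSpace (Y t)] [∀ t, ChartedSpace ℂ (Y t)]
  [∀ t, IsManifold 𝓘(ℂ) 1 (Y t)] [∀ t, T2Space (Y t)] {Q : ∀ t, QuadraticDifferential (X t)}

/-- All forms have the same zeros, the fixed points of `σ`, and all these zeros are double. This is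
what makes the estimate at points of `B` available for the primitives of `ω_t - ω_s`. -/
theorem HitchinCovering.exists_smallDeformation (H : ∀ t, HitchinCovering (Q t) (Y t))
    (hQ : ∀ t, (Q t).IsHolomorphic) (hQ0 : ∀ t, (Q t).HasOnlySimpleZeros)
    (Φ : ∀ t, S ≃ₘ^∞⟮𝓘(ℝ, ℂ), 𝓘(ℝ, ℂ)⟯ Y t)
    (hA : SmoothFormFamily fun t => pullForm (Φ t) (H t).omega)
    {σ : S → S} (hσ : ContMDiff 𝓘(ℝ, ℂ) 𝓘(ℝ, ℂ) ∞ σ)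
    (hσΦ : ∀ t p, Φ t (σ p) = (H t).invol (Φ t p)) (s : T)
    (hper : ∀ t γ, IsClosedCurve γ →
      ∫ r in (0 : ℝ)..1, pathIntegrand (pullForm (Φ s) (H s).omega) γ r =
        ∫ r in (0 : ℝ)..1, pathIntegrand (pullForm (Φ t) (H t).omega) γ r) :
    ∃ F : T → S → ℂ,
      SmallDeformation (IsPrimitiveAt (pullForm (Φ s) (H s).omega)) {p | σ p = p} F s ∧
      (∀ t p, F t (σ p) = -F t p) ∧
      ∀ t p, HasMFDerivAt 𝓘(ℝ, ℂ) 𝓘(ℝ, ℂ) (F t) p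
        (pullForm (Φ t) (H t).omega p - pullForm (Φ s) (H s).omega p) := by
  set A : T → ∀ p : S, TangentSpace 𝓘(ℝ, ℂ) p →L[ℝ] ℂ := fun t => pullForm (Φ t) (H t).omega
    with hAdef
  have hhol : ∀ t, (H t).omega.IsHolomorphic := fun t => (H t).isHolomorphic_omega
  have hσσ : ∀ p, σ (σ p) = p := (H s).involutive_of_conj (Φ s) (hσΦ s)
  have hcont : ∀ t, Continuous (H t).invol := fun t =>
    (H t).continuous_invol (Φ t) hσ.continuous (hσΦ t)
  have hfix : ∀ t p, σ p = p ↔ (H t).rootValue (Φ t p) = 0 := fun t =>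
    (H t).fixed_iff_of_conj (Φ t) (hσΦ t)
  have hne : ∀ t p, σ p ≠ p →
      (H t).omega.coeff (chartAt ℂ (Φ t p)) (chartAt ℂ (Φ t p) (Φ t p)) ≠ 0 := fun t p hp =>
    (H t).coeff_omega_ne_zero (hcont t) ((hfix t p).not.1 hp)
  have htwo : ∀ t p, σ p = p →
      analyticOrderAt ((H t).omega.coeff (chartAt ℂ (Φ t p))) (chartAt ℂ (Φ t p) (Φ t p)) = 2 :=
    fun t p hp => (H t).analyticOrderAt_coeff_omega (hcont t) (hQ t) (hQ0 t) ((hfix t p).1 hp)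
  have homega : ∀ t p, (H t).omega (Φ t p) (1 : ℂ) ≠ 0 → σ p ≠ p := fun t p h hp => by
    rw [(H t).omega_apply_one, (hfix t p).1 hp, zero_mul] at h
    exact h rfl
  have hprim : ∀ t p, ∃ G, IsPrimitiveAt (A t) G p := fun t p =>
    (hhol t).exists_isPrimitiveAt (Φ t) p
  -- The covering surface need not be connected, so one base point is chosen in each component.
  set β : ConnectedComponents S → S := Quotient.out with hβdef
  have hβ : ∀ c, ConnectedComponents.mk (β c) = c := fun c => Quotient.out_eq c
  choose F₀ hF₀ hF₀β using fun t => exists_primitive_of_periods_eq (θ := A s) (θ' := A t)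
    (fun e he v => hA.continuousOn he s v) (fun e he v => hA.continuousOn he t v)
    (hprim s) (hprim t) (hper t) β hβ
  have hF₀t := hA.tendsto_primitive hF₀ β hβ hF₀β
  have hAσ : ∀ t p v, A t (σ p) (mfderiv 𝓘(ℝ, ℂ) 𝓘(ℝ, ℂ) σ p v) = -A t p v := fun t =>
    (H t).pullForm_omega_invol (Φ t) hσ (hσΦ t)
  -- Since `σ` changes the sign of the forms, the odd part of `F₀` has the same differential as
  -- `F₀`; being odd, it vanishes at the fixed points.
  set F : T → S → ℂ := fun t p => (1 / 2 : ℝ) • (F₀ t p - F₀ t (σ p)) with hFdef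
  have hF : ∀ t p, HasMFDerivAt 𝓘(ℝ, ℂ) 𝓘(ℝ, ℂ) (F t) p (A t p - A s p) := by
    intro t p
    have h1 := (hF₀ t (σ p)).comp p (hσ.mdifferentiable (by simp) p).hasMFDerivAt
    have h2 := ((hF₀ t p).sub h1).const_smul (1 / 2 : ℝ)
    refine h2.congr_mfderiv (ContinuousLinearMap.ext fun v => ?_)
    change (1 / 2 : ℝ) • ((A t p v - A s p v) -
      (A t (σ p) (mfderiv 𝓘(ℝ, ℂ) 𝓘(ℝ, ℂ) σ p v) - A s (σ p) (mfderiv 𝓘(ℝ, ℂ) 𝓘(ℝ, ℂ) σ p v))) =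
      A t p v - A s p v
    rw [hAσ, hAσ, Complex.real_smul]
    push_cast
    ring
  have hFσ : ∀ t p, F t (σ p) = -F t p := fun t p => by
    simp only [hFdef, hσσ]
    rw [← smul_neg, neg_sub]
  refine ⟨F, ⟨⟨fun {G G' p} h h' => h.unique h', fun p hp => ?_⟩,
    fun t => continuous_iff_continuousAt.2 fun p => (hF t p).continuousAt, fun p => ?_,
    fun t b hb => ?_, fun p hp => ?_, fun b hb => ?_⟩, hFσ, hF⟩
  · obtain ⟨w, hw, hwq, -⟩ := (hhol s).exists_pullCoordinate_of_ne_zero (Φ s) (hne s p hp)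
    exact ⟨w, hw, fun q hq => ⟨homega s q (hwq q hq).1, (hwq q hq).2⟩⟩
  · have h1 : Tendsto (fun z : T × S => F₀ z.1 (σ z.2)) (𝓝 (s, p)) (𝓝 0) :=
      (hF₀t (σ p)).comp ((continuous_fst.prodMk (hσ.continuous.comp continuous_snd)).tendsto (s, p))
    have h2 := ((hF₀t p).sub h1).const_smul (1 / 2 : ℝ)
    rwa [sub_zero, smul_zero] at h2
  · have := hFσ t b
    rw [show σ b = b from hb] at this
    exact self_eq_neg.1 this
  · obtain ⟨w, hw, hwq, hws⟩ := (hhol s).exists_pullCoordinate_of_ne_zero (Φ s) (hne s p hp)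
    refine ⟨w, hw, fun q hq => ⟨homega s q (hwq q hq).1, (hwq q hq).2⟩, ?_⟩
    have h1 := eventually_norm_primitive_sub_le_coordinate hF (m := 0)
      (fun ε hε => hA.eventually_norm_sub_le (chart_mem_atlas ℂ p) s (mem_chart_target ℂ p) hε)
      hw hws (ε := 1 / 2) (by norm_num)
    filter_upwards [h1] with z hz
    simpa using hz
  · obtain ⟨w, hw, hw0, hwq, hws⟩ :=
      (hhol s).exists_pullCoordinate_of_order_two (Φ s) (htwo s b hb)
    refine ⟨w, hw, hw0, fun q hq => ⟨fun hqB => (hwq q hq).1 ?_, (hwq q hq).2⟩, fun ε hε => ?_⟩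
    · rw [(H s).omega_apply_one, (hfix s q).1 hqB, zero_mul]
    · have h1 := eventually_norm_primitive_sub_le_coordinate hF (m := 2)
        (fun ε hε => hA.eventually_norm_sub_le_sq (chart_mem_atlas ℂ b) s (mem_chart_target ℂ b)
          (fun t => (hhol t).formInChart_isBigO (Φ t) (htwo t b hb)) hε) hw hws hε
      simpa only [hw0, sub_zero] using h1

end Deformation

/-! ### Local inverses, removable singularities and biholomorphic maps. -/

section HolomorphicMaps

open Filter

variable {X Y : Type*} [TopologicalSpace X] [ChartedSpace ℂ X] [TopologicalSpace Y]
  [ChartedSpace ℂ Y] [IsManifold 𝓘(ℂ) 1 X] [IsManifold 𝓘(ℂ) 1 Y] {g : Y → X} {y : Y}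

theorem MDifferentiable.contMDiff_omega (hg : MDifferentiable 𝓘(ℂ) 𝓘(ℂ) g) :
    ContMDiff 𝓘(ℂ) 𝓘(ℂ) ω g := fun y => by
  rw [contMDiffAt_iff]
  exact ⟨(hg y).continuousAt,
    (analyticAt_mapInCharts (Eventually.of_forall hg)).contDiffAt.contDiffWithinAt⟩

theorem exists_local_inverse (hg : ∀ᶠ y' in 𝓝 y, MDifferentiableAt 𝓘(ℂ) 𝓘(ℂ) g y')
    (h : cderiv g y ≠ 0) :
    ∃ s : X → Y, MDifferentiableAt 𝓘(ℂ) 𝓘(ℂ) s (g y) ∧ s (g y) = y ∧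
      (∀ᶠ y' in 𝓝 y, s (g y') = y') ∧ ∀ᶠ x in 𝓝 (g y), g (s x) = x := by
  rw [Ne, ← deriv_mapInCharts_self_eq_zero_iff hg.self_of_nhds] at h
  obtain ⟨w, hw, hz, -, -, hws⟩ := exists_openPartialHomeomorph_of_deriv_ne_zero
    (analyticAt_mapInCharts hg) h univ_mem
  set e := chartAt ℂ y
  set f := chartAt ℂ (g y)
  have hye : y ∈ e.source := mem_chart_source ℂ y
  have hgf : g y ∈ f.source := mem_chart_source ℂ (g y)
  have hwz : w (e y) = f (g y) := by rw [hw, mapInCharts_apply]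
  have hwt : f (g y) ∈ w.target := hwz ▸ w.map_source hz
  have hws0 : w.symm (f (g y)) = e y := by rw [← hwz, w.left_inv hz]
  have hwg : ∀ y' ∈ e.source, w (e y') = f (g y') := fun y' hy' => by
    simp only [hw, mapInCharts, Function.comp]
    rw [e.left_inv hy']
  have hs : MDifferentiableAt 𝓘(ℂ) 𝓘(ℂ) (e.symm ∘ (w.symm ∘ f)) (g y) := by
    have h1 : MDifferentiableAt 𝓘(ℂ) 𝓘(ℂ) (w.symm ∘ f) (g y) :=
      MDifferentiableAt.comp (g y) (hws _ hwt).differentiableAt.mdifferentiableAt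
        (mdifferentiableAt_atlas (chart_mem_atlas ℂ (g y)) hgf)
    refine MDifferentiableAt.comp (g y) ?_ h1
    rw [Function.comp, hws0]
    exact mdifferentiableAt_atlas_symm (chart_mem_atlas ℂ y) (e.map_source hye)
  have hsy : (e.symm ∘ (w.symm ∘ f)) (g y) = y := by
    rw [Function.comp, Function.comp, hws0, e.left_inv hye]
  refine ⟨_, hs, hsy, ?_, ?_⟩
  · filter_upwards [e.open_source.mem_nhds hye,
      (e.continuousAt hye).eventually (w.open_source.mem_nhds hz)] with y' h1 h2
    rw [Function.comp, Function.comp, ← hwg y' h1, w.left_inv h2, e.left_inv h1]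
  · have hc := hs.continuousAt
    have h1 : ∀ᶠ x in 𝓝 (g y), g ((e.symm ∘ (w.symm ∘ f)) x) ∈ f.source := by
      have hgc : ContinuousAt g ((e.symm ∘ (w.symm ∘ f)) (g y)) := by
        rw [hsy]
        exact hg.self_of_nhds.continuousAt
      refine (hgc.comp hc).eventually (f.open_source.mem_nhds ?_)
      rw [Function.comp, hsy]
      exact hgf
    have h2 : ∀ᶠ x in 𝓝 (g y), w.symm (f x) ∈ e.target := by
      refine ((w.continuousAt_symm hwt).comp (f.continuousAt hgf)).eventually
        (e.open_target.mem_nhds ?_)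
      rw [Function.comp, hws0]
      exact e.map_source hye
    filter_upwards [h1, h2, f.open_source.mem_nhds hgf,
      (f.continuousAt hgf).eventually (w.open_target.mem_nhds hwt)] with x h1 h2 h3 h4
    refine f.injOn h1 h3 ?_
    have h5 := hwg _ (e.map_target h2)
    rw [e.right_inv h2, w.right_inv h4] at h5
    exact h5.symm

/-- A map which is continuous at a point and holomorphic off this point is holomorphic. -/
theorem mdifferentiableAt_of_punctured (hyc : ContinuousAt g y)
    (hd : ∀ᶠ y' in 𝓝[≠] y, MDifferentiableAt 𝓘(ℂ) 𝓘(ℂ) g y') :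
    MDifferentiableAt 𝓘(ℂ) 𝓘(ℂ) g y := by
  have hye := mem_chart_source ℂ y
  rw [mdifferentiableAt_iff_chart (chart_mem_atlas ℂ y) hye
    (chart_mem_atlas ℂ (g y)) hyc (mem_chart_source ℂ (g y))]
  refine (Complex.analyticAt_of_differentiable_on_punctured_nhds_of_continuousAt ?_
    ?_).differentiableAt
  · rw [eventually_nhdsWithin_iff] at hd ⊢
    have hsrc := hyc.eventually ((chartAt ℂ (g y)).open_source.mem_nhds (mem_chart_source ℂ (g y)))
    filter_upwards [eventually_symm_of_eventually hye (hd.and hsrc)] with z hz hne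
    have h1 : (chartAt ℂ y).symm z ≠ y := fun h => hne (by
      rw [mem_singleton_iff, ← (chartAt ℂ y).right_inv hz.1, h])
    have h2 := hz.2.1 h1
    have := (mdifferentiableAt_iff_chart (chart_mem_atlas ℂ y) ((chartAt ℂ y).map_target hz.1)
      (chart_mem_atlas ℂ (g y)) h2.continuousAt hz.2.2).1 h2
    rwa [(chartAt ℂ y).right_inv hz.1] at this
  · have h1 := (chartAt ℂ y).continuousAt_symm ((chartAt ℂ y).map_source hye)
    refine ContinuousAt.comp ?_ (ContinuousAt.comp ?_ h1)
    · rw [Function.comp, (chartAt ℂ y).left_inv hye]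
      exact (chartAt ℂ (g y)).continuousAt (mem_chart_source ℂ (g y))
    · rwa [(chartAt ℂ y).left_inv hye]

/-- An injective holomorphic map from a compact to a connected Riemann surface is biholomorphic. -/
theorem exists_diffeomorph_of_injective [CompactSpace Y] [Nonempty Y] [T2Space X]
    [PreconnectedSpace X] (hg : MDifferentiable 𝓘(ℂ) 𝓘(ℂ) g) (hinj : Function.Injective g) :
    ∃ φ : Y ≃ₘ^ω⟮𝓘(ℂ), 𝓘(ℂ)⟯ X, ⇑φ = g := by
  have hinv : ∀ y, ∃ s : X → Y, MDifferentiableAt 𝓘(ℂ) 𝓘(ℂ) s (g y) ∧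
      ∀ᶠ x in 𝓝 (g y), g (s x) = x := fun y => by
    obtain ⟨s, h1, -, -, h2⟩ := exists_local_inverse (y := y) (Eventually.of_forall hg)
      (cderiv_ne_zero_of_injOn (Eventually.of_forall hg) univ_mem hinj.injOn)
    exact ⟨s, h1, h2⟩
  -- Local inverses show that the image is open; it is also compact, hence everything.
  have hopen : IsOpen (range g) := by
    refine isOpen_iff_mem_nhds.2 ?_
    rintro _ ⟨y, rfl⟩
    obtain ⟨s, -, hs⟩ := hinv y
    filter_upwards [hs] with x hx
    exact ⟨_, hx⟩
  have hsurj : Function.Surjective g := range_eq_univ.1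
    (IsClopen.eq_univ ⟨(isCompact_range hg.continuous).isClosed, hopen⟩ (range_nonempty g))
  set E := Equiv.ofBijective g ⟨hinj, hsurj⟩
  have hE : MDifferentiable 𝓘(ℂ) 𝓘(ℂ) E.symm := fun x => by
    obtain ⟨y, rfl⟩ := hsurj x
    obtain ⟨s, hs, hgs⟩ := hinv y
    refine hs.congr_of_eventuallyEq ?_
    filter_upwards [hgs] with x hx
    exact (Equiv.symm_apply_eq E).2 hx.symm
  exact ⟨⟨E, hg.contMDiff_omega, hE.contMDiff_omega⟩, rfl⟩

end HolomorphicMaps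

/-! ### Equivalence of quadratic differentials as an equivalence relation. -/

section Equivalence

open Filter

/-- Equivalence of quadratic differentials under biholomorphic maps. -/
def QuadraticDifferential.Equivalent {X X' : Type*} [TopologicalSpace X] [ChartedSpace ℂ X]
    [TopologicalSpace X'] [ChartedSpace ℂ X'] (Q : QuadraticDifferential X)
    (Q' : QuadraticDifferential X') : Prop :=
  ∃ φ : X ≃ₘ^ω⟮𝓘(ℂ), 𝓘(ℂ)⟯ X',
    ∀ p, Q' (φ p) (1 : ℂ) (1 : ℂ) * cderiv φ p ^ 2 = Q p (1 : ℂ) (1 : ℂ)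

variable {X X' X'' : Type*} [TopologicalSpace X] [ChartedSpace ℂ X]
    [TopologicalSpace X'] [ChartedSpace ℂ X'] [TopologicalSpace X''] [ChartedSpace ℂ X'']
    {Q : QuadraticDifferential X} {Q' : QuadraticDifferential X'} {Q'' : QuadraticDifferential X''}

theorem QuadraticDifferential.Equivalent.exists_pullback_eq (h : Q.Equivalent Q') :
    ∃ φ : X ≃ₘ^ω⟮𝓘(ℂ), 𝓘(ℂ)⟯ X', ∀ (p : X) (v w : TangentSpace 𝓘(ℂ) p),
      Q' (φ p) (mfderiv 𝓘(ℂ) 𝓘(ℂ) φ p v) (mfderiv 𝓘(ℂ) 𝓘(ℂ) φ p w) = Q p v w := by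
  obtain ⟨φ, hφ⟩ := h
  refine ⟨φ, fun p (v : ℂ) (w : ℂ) => ?_⟩
  refine (Q'.apply_eq_mul (φ p) _ _).trans (Eq.trans ?_ (Q.apply_eq_mul p v w).symm)
  have h1 := mfderiv_eq_mul_cderiv φ p v
  have h2 := mfderiv_eq_mul_cderiv φ p w
  rw [h1, h2, ← hφ p]
  ring

theorem QuadraticDifferential.Equivalent.symm (h : Q.Equivalent Q') : Q'.Equivalent Q := by
  obtain ⟨φ, hφ⟩ := h
  refine ⟨φ.symm, fun p => ?_⟩
  have h1 := cderiv_comp (x := p) (φ.contMDiff.mdifferentiable (by simp) (φ.symm p))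
    (φ.symm.contMDiff.mdifferentiable (by simp) p)
  have h2 : (φ ∘ φ.symm : X' → X') = id := funext φ.apply_symm_apply
  rw [h2, cderiv_id] at h1
  have h3 := hφ (φ.symm p)
  rw [φ.apply_symm_apply] at h3
  rw [← h3, mul_assoc, ← mul_pow, ← h1, one_pow, mul_one]

theorem QuadraticDifferential.Equivalent.trans (h : Q.Equivalent Q') (h' : Q'.Equivalent Q'') :
    Q.Equivalent Q'' := by
  obtain ⟨φ, hφ⟩ := h
  obtain ⟨ψ, hψ⟩ := h'
  refine ⟨φ.trans ψ, fun p => ?_⟩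
  have h1 := cderiv_comp (x := p) (ψ.contMDiff.mdifferentiable (by simp) (φ p))
    (φ.contMDiff.mdifferentiable (by simp) p)
  rw [← hφ p, ← hψ (φ p), mul_assoc, ← mul_pow, ← h1]
  rfl

end Equivalence

/-! ### Descent from the coverings to the base surfaces. -/

section Descent

open Filter

variable {X Y X' Y' : Type*} [TopologicalSpace X] [ChartedSpace ℂ X] [TopologicalSpace Y]
  [ChartedSpace ℂ Y] [TopologicalSpace X'] [ChartedSpace ℂ X'] [TopologicalSpace Y']
  [ChartedSpace ℂ Y'] [IsManifold 𝓘(ℂ) 1 X] [IsManifold 𝓘(ℂ) 1 Y] [IsManifold 𝓘(ℂ) 1 X']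
  {Q : QuadraticDifferential X} {Q' : QuadraticDifferential X'}

omit [IsManifold 𝓘(ℂ) 1 X] in
theorem QuadraticDifferential.HasOnlySimpleZeros.eventually_ne_zero (hQ : Q.IsHolomorphic)
    (hQ0 : Q.HasOnlySimpleZeros) {x : X} (h0 : Q x = 0) :
    ∀ᶠ x' in 𝓝[≠] x, Q x' (1 : ℂ) (1 : ℂ) ≠ 0 := by
  have hx := mem_chart_source ℂ x
  have h1 := (hQ.analyticAt_coeff x).differentiableAt.hasDerivAt.eventually_ne (c := 0) (hQ0 x h0)
  rw [eventually_nhdsWithin_iff] at h1 ⊢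
  filter_upwards [((chartAt ℂ x).continuousAt hx).eventually h1,
    (chartAt ℂ x).open_source.mem_nhds hx] with x' h2 h3 hne hz
  refine h2 (fun h => hne ((chartAt ℂ x).injOn h3 hx h)) ?_
  rw [QuadraticDifferential.coeff_eq, (chartAt ℂ x).left_inv h3, hz, mul_zero]

namespace HitchinCovering

/-- Commuting with the involutions makes `f` descend, and injectivity of `f` passes to the quotient.
Holomorphy of the quotient map is lifted through local inverses of the projection off the zeros of
`Q`. -/
theorem equivalent_of_map (H : HitchinCovering Q Y) (H' : HitchinCovering Q' Y')
    [CompactSpace Y] [T2Space Y] [CompactSpace X] [T2Space X] [Nonempty X] [T2Space X']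
    [PreconnectedSpace X'] (hQ : Q.IsHolomorphic) (hQ0 : Q.HasOnlySimpleZeros)
    (hσ : Continuous H.invol) {f : Y → Y'} (hf : Continuous f)
    (hinj : Function.Injective f) (hfσ : ∀ y, f (H.invol y) = H'.invol (f y))
    (hf0 : ∀ y, H.rootValue y = 0 → H'.rootValue (f y) = 0)
    (hfd : ∀ y, H.rootValue y ≠ 0 → MDifferentiableAt 𝓘(ℂ) 𝓘(ℂ) f y ∧
      H'.omega (f y) (1 : ℂ) * cderiv f y = H.omega y (1 : ℂ)) : Q.Equivalent Q' := by
  set φ : X → X' := fun x => H'.proj (f (Function.surjInv H.proj_surjective x)) with hφ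
  have hφp : ∀ y, φ (H.proj y) = H'.proj (f y) := fun y => by
    rcases H.eq_or_eq_invol (Function.surjInv_eq H.proj_surjective (H.proj y)).symm with h | h
    · simp only [hφ, h]
    · simp only [hφ, h, hfσ, H'.proj_invol]
  have hφcomp : φ ∘ H.proj = H'.proj ∘ f := funext hφp
  have hpc : Continuous H.proj := H.mdifferentiable_proj.continuous
  have hφc : Continuous φ := by
    -- A continuous surjection from a compact to a Hausdorff space is a quotient map.
    rw [(hpc.isClosedMap.isQuotientMap hpc H.proj_surjective).continuous_iff, hφcomp]
    exact H'.mdifferentiable_proj.continuous.comp hf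
  have hφinj : Function.Injective φ := fun x x' h => by
    obtain ⟨y, rfl⟩ := H.proj_surjective x
    obtain ⟨y', rfl⟩ := H.proj_surjective x'
    rw [hφp, hφp] at h
    rcases H'.eq_or_eq_invol h with h | h
    · rw [hinj h]
    · rw [← hfσ] at h
      rw [hinj h, H.proj_invol]
  have hφd : ∀ y, H.rootValue y ≠ 0 → MDifferentiableAt 𝓘(ℂ) 𝓘(ℂ) φ (H.proj y) := fun y hy => by
    obtain ⟨s, hs, hsy, -, hs'⟩ := exists_local_inverse
      (Eventually.of_forall H.mdifferentiable_proj) (H.cderiv_proj_ne_zero hσ hy)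
    have h1 : MDifferentiableAt 𝓘(ℂ) 𝓘(ℂ) (H'.proj ∘ f) (s (H.proj y)) := by
      rw [hsy]
      exact (H'.mdifferentiable_proj (f y)).comp y (hfd y hy).1
    refine (h1.comp _ hs).congr_of_eventuallyEq ?_
    filter_upwards [hs'] with x hx
    have := hφp (s x)
    rwa [hx] at this
  have hφm : MDifferentiable 𝓘(ℂ) 𝓘(ℂ) φ := fun x => by
    obtain ⟨y, rfl⟩ := H.proj_surjective x
    by_cases hy : H.rootValue y = 0
    swap
    · exact hφd y hy
    have hQy : Q (H.proj y) = 0 := (Q.eq_zero_iff _).2 (by rw [← H.rootValue_sq, hy]; simp)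
    -- Zeros of `Q` are isolated, so the singularity is removable by continuity.
    refine mdifferentiableAt_of_punctured hφc.continuousAt ?_
    filter_upwards [hQ0.eventually_ne_zero hQ hQy] with x' hx'
    obtain ⟨y, rfl⟩ := H.proj_surjective x'
    refine hφd y fun h => hx' ?_
    rw [← H.rootValue_sq, h]
    simp
  obtain ⟨ψ, hψ⟩ := exists_diffeomorph_of_injective hφm hφinj
  refine ⟨ψ, fun p => ?_⟩
  rw [hψ]
  obtain ⟨y, rfl⟩ := H.proj_surjective p
  rw [hφp, ← H'.rootValue_sq, ← H.rootValue_sq]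
  by_cases hy : H.rootValue y = 0
  · rw [hy, hf0 y hy]
    simp
  · have hp0 := H.cderiv_proj_ne_zero hσ hy
    have h1 := cderiv_comp (x := y) (hφm (H.proj y)) (H.mdifferentiable_proj y)
    have h2 := cderiv_comp (x := y) (H'.mdifferentiable_proj (f y)) (hfd y hy).1
    have h3 := (hfd y hy).2
    rw [hφcomp, h2] at h1
    rw [H'.omega_apply_one, H.omega_apply_one] at h3
    -- The relation between the forms `ω` becomes one between the roots after cancelling the nonzero
    -- derivative of the projection; its square is the claim.
    have h4 : H'.rootValue (f y) * cderiv φ (H.proj y) = H.rootValue y := by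
      refine mul_right_cancel₀ hp0 ?_
      linear_combination h3 - H'.rootValue (f y) * h1
    rw [← mul_pow, h4]

end HitchinCovering

end Descent

/-! ### Local and global constancy in the parameter. -/

section Families

open Filter

variable {T : Type*} [TopologicalSpace T] [ChartedSpace ℝ T] [IsManifold 𝓘(ℝ, ℝ) ∞ T]
  {S : Type*} [TopologicalSpace S] [ChartedSpace ℂ S] [IsManifold 𝓘(ℝ, ℂ) ∞ S]
  {X Y : T → Type*} [∀ t, TopologicalSpace (X t)] [∀ t, ChartedSpace ℂ (X t)]
  [∀ t, IsManifold 𝓘(ℂ) 1 (X t)] [∀ t, TopologicalSpace (Y t)] [∀ t, ChartedSpace ℂ (Y t)]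
  [∀ t, IsManifold 𝓘(ℂ) 1 (Y t)] [∀ t, T2Space (Y t)] [∀ t, CompactSpace (Y t)]
  [∀ t, T2Space (X t)] [∀ t, CompactSpace (X t)] [∀ t, ConnectedSpace (X t)]
  {Q : ∀ t, QuadraticDifferential (X t)}

/-- The map `χ` of the small deformation, read from `Y t` to `Y s`, pulls `ω_s` back to `ω_t`, so it
meets the conditions for descent. -/
theorem HitchinCovering.eventually_equivalent (H : ∀ t, HitchinCovering (Q t) (Y t))
    (hQ : ∀ t, (Q t).IsHolomorphic) (hQ0 : ∀ t, (Q t).HasOnlySimpleZeros)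
    (Φ : ∀ t, S ≃ₘ^∞⟮𝓘(ℝ, ℂ), 𝓘(ℝ, ℂ)⟯ Y t)
    (hA : SmoothFormFamily fun t => pullForm (Φ t) (H t).omega)
    {σ : S → S} (hσ : ContMDiff 𝓘(ℝ, ℂ) 𝓘(ℝ, ℂ) ∞ σ)
    (hσΦ : ∀ t p, Φ t (σ p) = (H t).invol (Φ t p)) (s : T)
    (hper : ∀ t γ, IsClosedCurve γ →
      ∫ r in (0 : ℝ)..1, pathIntegrand (pullForm (Φ s) (H s).omega) γ r =
        ∫ r in (0 : ℝ)..1, pathIntegrand (pullForm (Φ t) (H t).omega) γ r) :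
    ∀ᶠ t in 𝓝 s, (Q t).Equivalent (Q s) := by
  obtain ⟨F, hdef, hFσ, hF⟩ :=
    HitchinCovering.exists_smallDeformation H hQ hQ0 Φ hA hσ hσΦ s hper
  have : CompactSpace S := (Φ s).toHomeomorph.symm.compactSpace
  have : T2Space S := (Φ s).toHomeomorph.symm.t2Space
  have hσσ : ∀ p, σ (σ p) = p := (H s).involutive_of_conj (Φ s) (hσΦ s)
  have hcont : ∀ t, Continuous (H t).invol := fun t =>
    (H t).continuous_invol (Φ t) hσ.continuous (hσΦ t)
  have hfix : ∀ t p, σ p = p ↔ (H t).rootValue (Φ t p) = 0 := fun t =>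
    (H t).fixed_iff_of_conj (Φ t) (hσΦ t)
  have hmap := hdef.eventually_exists_map hσ.continuous hσσ
    (fun p => by
      change σ (σ p) = σ p ↔ σ p = p
      rw [hσσ]
      exact eq_comm)
    (fun G p hG => hG.neg_comp_invol hσ hσσ ((H s).pullForm_omega_invol (Φ s) hσ (hσΦ s))) hFσ
  filter_upwards [hmap] with t ht
  obtain ⟨χ, hχc, hχinj, hχσ, hχB, hχ⟩ := ht
  set f : Y t → Y s := fun y => Φ s (χ ((Φ t).symm y)) with hfdef
  have hf : ∀ p, f (Φ t p) = Φ s (χ p) := fun p => by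
    simp only [hfdef, (Φ t).symm_apply_apply]
  have hfc : Continuous f := (Φ s).continuous.comp (hχc.comp (Φ t).symm.continuous)
  refine (H t).equivalent_of_map (H s) (hQ t) (hQ0 t) (hcont t) hfc
    ((Φ s).injective.comp (hχinj.comp (Φ t).symm.injective)) (fun y => ?_) (fun y hy => ?_)
    (fun y hy => ?_)
  all_goals obtain ⟨p, rfl⟩ := (Φ t).surjective y
  · change f ((H t).invol (Φ t p)) = (H s).invol (f (Φ t p))
    rw [← hσΦ, hf, hf, hχσ, hσΦ]
  · change (H t).rootValue (Φ t p) = 0 at hy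
    change (H s).rootValue (f (Φ t p)) = 0
    have hp := (hfix t p).2 hy
    rw [hf, hχB p hp]
    exact (hfix s p).1 hp
  · change (H t).rootValue (Φ t p) ≠ 0 at hy
    change MDifferentiableAt 𝓘(ℂ) 𝓘(ℂ) f (Φ t p) ∧
      (H s).omega (f (Φ t p)) (1 : ℂ) * cderiv f (Φ t p) = (H t).omega (Φ t p) (1 : ℂ)
    obtain ⟨hχp, G, hG, hGχ, hGev⟩ := hχ p (fun hp => hy ((hfix t p).1 hp))
    have hroot : (H s).rootValue (f (Φ t p)) ≠ 0 := fun h => hχp ((hfix s _).2 (by rwa [← hf]))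
    have hK : ∀ᶠ y in 𝓝 (f (Φ t p)), HasMFDerivAt 𝓘(ℂ) 𝓘(ℂ) (G ∘ (Φ s).symm) y
        ((H s).omega y (1 : ℂ) • ContinuousLinearMap.id ℂ ℂ) := by
      have hc : Tendsto (Φ s).symm (𝓝 (f (Φ t p))) (𝓝 (χ p)) := by
        have := (Φ s).symm.continuous.tendsto (f (Φ t p))
        rwa [hf, (Φ s).symm_apply_apply, ← hf] at this
      filter_upwards [hc.eventually hGχ] with y hy
      exact HasMFDerivAt.of_comp_pullForm (Φ s) hy
    have hL : HasMFDerivAt 𝓘(ℂ) 𝓘(ℂ) ((fun q => G q + F t q) ∘ (Φ t).symm) (Φ t p)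
        ((H t).omega (Φ t p) (1 : ℂ) • ContinuousLinearMap.id ℂ ℂ) := by
      refine HasMFDerivAt.of_comp_pullForm (Φ t) ?_
      rw [(Φ t).symm_apply_apply]
      refine (hG.self_of_nhds.add (hF t p)).congr_mfderiv ?_
      exact add_sub_cancel _ _
    have hKL : (G ∘ (Φ s).symm) ∘ f =ᶠ[𝓝 (Φ t p)] (fun q => G q + F t q) ∘ (Φ t).symm := by
      have hc : Tendsto (Φ t).symm (𝓝 (Φ t p)) (𝓝 p) := by
        have := (Φ t).symm.continuous.tendsto (Φ t p)
        rwa [(Φ t).symm_apply_apply] at this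
      filter_upwards [hc.eventually hGev] with y hy
      simp only [Function.comp, hfdef, (Φ s).symm_apply_apply]
      exact hy
    have hK' := hK.self_of_nhds
    obtain ⟨r, hr, -, hrK, -⟩ := exists_local_inverse
      (hK.mono fun y hy => hy.mdifferentiableAt) (by
        rw [hK'.cderiv_eq, (H s).omega_apply_one]
        exact mul_ne_zero hroot ((H s).cderiv_proj_ne_zero (hcont s) hroot))
    -- Near the point, `f` is the holomorphic function with differential `ω_t`, followed by a local
    -- inverse of a holomorphic primitive of `ω_s`.
    have hfm : MDifferentiableAt 𝓘(ℂ) 𝓘(ℂ) f (Φ t p) := by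
      have h1 : f =ᶠ[𝓝 (Φ t p)] r ∘ ((fun q => G q + F t q) ∘ (Φ t).symm) := by
        filter_upwards [hfc.continuousAt.eventually hrK, hKL] with y h1 h2
        rw [Function.comp, ← h2]
        exact h1.symm
      refine MDifferentiableAt.congr_of_eventuallyEq ?_ h1
      refine MDifferentiableAt.comp _ ?_ hL.mdifferentiableAt
      have h2 := hKL.self_of_nhds
      rwa [← h2]
    refine ⟨hfm, ?_⟩
    rw [← hK'.cderiv_eq, ← hL.cderiv_eq, ← cderiv_comp hK'.mdifferentiableAt hfm, hKL.cderiv_eq]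

/-- A transitive relation that holds in both directions between each parameter and all nearby ones
holds throughout a connected parameter space. -/
theorem HitchinCovering.equivalent_of_periods_eq [PreconnectedSpace T]
    (H : ∀ t, HitchinCovering (Q t) (Y t))
    (hQ : ∀ t, (Q t).IsHolomorphic) (hQ0 : ∀ t, (Q t).HasOnlySimpleZeros)
    (Φ : ∀ t, S ≃ₘ^∞⟮𝓘(ℝ, ℂ), 𝓘(ℝ, ℂ)⟯ Y t)
    (hA : SmoothFormFamily fun t => pullForm (Φ t) (H t).omega)
    {σ : S → S} (hσ : ContMDiff 𝓘(ℝ, ℂ) 𝓘(ℝ, ℂ) ∞ σ)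
    (hσΦ : ∀ t p, Φ t (σ p) = (H t).invol (Φ t p))
    (hper : ∀ s t γ, IsClosedCurve γ →
      ∫ r in (0 : ℝ)..1, pathIntegrand (pullForm (Φ s) (H s).omega) γ r =
        ∫ r in (0 : ℝ)..1, pathIntegrand (pullForm (Φ t) (H t).omega) γ r) (s t : T) :
    (Q s).Equivalent (Q t) := by
  refine PreconnectedSpace.induction₂' (fun s t => (Q s).Equivalent (Q t)) (fun s => ?_)
    ⟨fun _ _ _ h h' => h.trans h'⟩ s t
  filter_upwards [HitchinCovering.eventually_equivalent H hQ hQ0 Φ hA hσ hσΦ s (hper s)] with t ht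
  exact ⟨ht.symm, ht⟩

end Families

end

theorem lemma4 (δ : ℝ) (_hδ : 0 < δ)
    -- the smooth family of compact Riemann surfaces `M t`
    {S : Type*} [TopologicalSpace S] [ChartedSpace ℂ S] [IsManifold 𝓘(ℝ, ℂ) ∞ S]
    {M : ParamInterval δ → Type*} [∀ t, TopologicalSpace (M t)] [∀ t, ChartedSpace ℂ (M t)]
    [∀ t, IsManifold 𝓘(ℂ) ω (M t)] [∀ t, T2Space (M t)] [∀ t, CompactSpace (M t)]
    [∀ t, ConnectedSpace (M t)]
    (F : SmoothFamily δ S M)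
    -- the smooth family of holomorphic quadratic differentials `Q t`, with only simple zeros
    (Q : ∀ t, QuadraticDifferential (M t))
    (_hQ : ∀ t, (Q t).IsHolomorphic)
    (_hQsmooth : F.SmoothQuadratics Q)
    (_hQzeros : ∀ t, (Q t).HasOnlySimpleZeros)
    -- the Hitchin coverings `Mhat t`, identified with one smooth surface `Shat`
    {Shat : Type*} [TopologicalSpace Shat] [ChartedSpace ℂ Shat] [IsManifold 𝓘(ℝ, ℂ) ∞ Shat]
    {Mhat : ParamInterval δ → Type*} [∀ t, TopologicalSpace (Mhat t)]
    [∀ t, ChartedSpace ℂ (Mhat t)] [∀ t, IsManifold 𝓘(ℂ) ω (Mhat t)] [∀ t, T2Space (Mhat t)]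
    [∀ t, CompactSpace (Mhat t)]
    (H : ∀ t, HitchinCovering (Q t) (Mhat t))
    (Fhat : SmoothFamily δ Shat Mhat)
    (_hωsmooth : Fhat.SmoothOneForms fun t => (H t).omega)
    -- in the identification, all involutions are one smooth map `σ`
    (σ : Shat → Shat) (_hσ : ContMDiff 𝓘(ℝ, ℂ) 𝓘(ℝ, ℂ) ∞ σ)
    (_hσt : ∀ t p, Fhat.ident t (σ p) = (H t).invol (Fhat.ident t p))
    -- the periods of `ω t` do not depend on `t`
    (_hperiods : ∀ γ : ℝ → Shat, IsClosedCurve γ → ∀ s t,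
      Fhat.period s (H s).omega γ = Fhat.period t (H t).omega γ) :
    ∀ s t, ∃ φ : M s ≃ₘ^ω⟮𝓘(ℂ), 𝓘(ℂ)⟯ M t, ∀ (p : M s) (v w : TangentSpace 𝓘(ℂ) p),
      Q t (φ p) (mfderiv 𝓘(ℂ) 𝓘(ℂ) φ p v) (mfderiv 𝓘(ℂ) 𝓘(ℂ) φ p w) = Q s p v w := by
  intro s t
  have : ∀ t, IsManifold 𝓘(ℂ) 1 (M t) := fun t => IsManifold.of_le (n := ω) le_top
  have : ∀ t, IsManifold 𝓘(ℂ) 1 (Mhat t) := fun t => IsManifold.of_le (n := ω) le_top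
  have : PreconnectedSpace (ParamInterval δ) := Subtype.preconnectedSpace isPreconnected_Ioo
  -- `pullForm` bundles `pullOneForm` as a real linear map, so smoothness and periods carry over
  -- pointwise.
  have hform : ∀ t p v, pullForm (Fhat.ident t) (H t).omega p v =
      Fhat.pullOneForm t (H t).omega p v := fun t => pullForm_apply (Fhat.ident t) (H t).omega
  have hA : SmoothFormFamily fun t => pullForm (Fhat.ident t) (H t).omega := fun e he v => by
    refine (_hωsmooth e he v).congr fun x _ => ?_
    exact hform x.1 (e.symm x.2) _
  have hint : ∀ t γ, Fhat.period t (H t).omega γ =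
      ∫ r in (0 : ℝ)..1, pathIntegrand (pullForm (Fhat.ident t) (H t).omega) γ r := fun t γ => by
    refine intervalIntegral.integral_congr fun r _ => ?_
    exact (hform t (γ r) _).symm
  refine (HitchinCovering.equivalent_of_periods_eq H _hQ _hQzeros Fhat.ident hA _hσ _hσt
    (fun s t γ hγ => ?_) s t).exists_pullback_eq
  rw [← hint, ← hint]
  exact _hperiods γ hγ s t
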